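/- **Theorem (sufficient condition).** Let $\mathcal H=\mathcal H_0\otimes\mathcal H_1$ with finite dimensions $d_0=\dim\mathcal H_0\ge 2$, $d_1=\dim\mathcal H_1\ge 1$, let $H$ be Hermitian on $\mathcal H$, and let $L$ act on $\mathcal H_0$. Put $\mathcal D_L\rho=L\rho L^\dagger-\frac12(L^\dagger L\rho+\rho L^\dagger L)$, and suppose that the kernel of $\mathcal D_L$ on the operators of $\mathcal H_0$ is one-dimensional, spanned by a pure state $|\psi_{\rm Zeno}\rangle\langle\psi_{\rm Zeno}|$. Suppose that for every $\Gamma>0$ there is a unique density matrix $\rho_{\rm NESS}(\Gamma)$ with $-i[H,\rho]+\Gamma\,\mathcal D_{L\otimes 1}\rho=0$. Let $(|e^j\rangle)_{0\le j<d_0}$ be an orthonormal basis of $\mathcal H_0$ with $e^0=\psi_{\rm Zeno}$, $e^1=\psi_{\rm Zeno}^\perp$, and put $h_{jk}=\langle e^j|H|e^k\rangle$ (operators on $\mathcal H_1$). Let $\psi_{\rm target}\in\mathcal H_1$ be a unit vector, $\lambda_0\in\mathbb R$, $\kappa\in\mathbb C\setminus\{0\}$ and $|\Psi\rangle=|\psi_{\rm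 Zeno}\rangle\otimes|\psi_{\rm target}\rangle$, and suppose $$H|\Psi\rangle=\lambda_0|\Psi\rangle+\kappa\,|\psi_{\rm Zeno}^\perp\rangle\otimes|\psi_{\rm target}\rangle .$$ Suppose that $\lambda_0$ is a nondegenerate eigenvalue of $h_{00}$. For an orthonormal eigenbasis $(|\alpha\rangle)_{0\le\alpha<d_1}$ of $h_{00}$ with $|0\rangle=|\psi_{\rm target}\rangle$ and $h_{00}|\alpha\rangle=\lambda_\alpha|\alpha\rangle$ put, for $1\le\alpha,\beta\le d_1-1$ and $1\le k\le d_0-1$, $$K_{\alpha\beta}=\sum_{k=1}^{d_0-1}\Big(|\langle\alpha|h_{k0}|\beta\rangle|^2-\delta_{\alpha\beta}\langle\alpha|h_{k0}^\dagger h_{k0}|\alpha\rangle\Big),\qquad \Lambda=\sum_{\alpha=1}^{d_1-1}\frac{|\alpha\rangle\langle\alpha|}{\lambda_\alpha-\lambda_0},$$ $$F_k=h_{k1}+[\Lambda h_{01},h_{k0}],\qquad R_\alpha=\sum_{k=1}^{d_0-1}\langle\alpha|F_k|0\rangle\langle0|F_k^\dagger|\alpha\rangle .$$ Suppose that $K$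 is invertible for every such eigenbasis (if $h_{00}$ has simple spectrum, it is enough to check one). Then $$\lim_{\Gamma\to\infty}\rho_{\rm NESS}(\Gamma)=|\Psi\rangle\langle\Psi| .$$ Suppose in addition that $L$ is the Jordan block in the basis $(e^j)$: $Le^0=0$ and $Le^j=e^{j-1}$ for $j\ge1$. Then $$\lim_{\Gamma\to\infty}\Gamma^2\big(1-\operatorname{tr}\rho_{\rm NESS}(\Gamma)^2\big)=\Gamma_{\rm ch}^2:=-8|\kappa|^2\sum_{\alpha=1}^{d_1-1}\sum_{\beta=1}^{d_1-1}(K^{-1})_{\alpha\beta}R_\beta$$ for every such eigenbasis if $h_{00}$ has simple spectrum. In general this holds for every such eigenbasis that satisfies, with $r(\Gamma)=\operatorname{tr}_{\mathcal H_0}\rho_{\rm NESS}(\Gamma)$, $$\lim_{\Gamma\to\infty}\Gamma^2\big(\langle\alpha|r|\beta\rangle-\langle\alpha|r|0\rangle\langle0|r|\beta\rangle\big)=0\quad\text{for all }\alpha\ne\beta\text{ in }\{1,\dots,d_1-1\}\text{ with }\lambda_\alpha=\lambda_\beta,$$ and at least one such eigenbasis exists. -/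

import Mathlib

open Filter Topology Matrix
open scoped Kronecker ComplexOrder

noncomputable section

namespace ZenoTarget

/-! The auxiliary space `H₀` has dimension `m + 2` and is identified with `ℂ^(m+2)` through the
orthonormal basis `e⁰ = ψ_Zeno, e¹ = ψ_Zeno^⊥, e², …`; the space `H₁` has dimension `n + 1`.
Operators on `H₀ ⊗ H₁` are matrices indexed by `Fin (m + 2) × Fin (n + 1)`. -/

/-- Operators on `H₀ ⊗ H₁`. -/
abbrev Op (m n : ℕ) := Matrix (Fin (m + 2) × Fin (n + 1)) (Fin (m + 2) × Fin (n + 1)) ℂ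

/-- Operators on `H₁`. -/
abbrev Op₁ (n : ℕ) := Matrix (Fin (n + 1)) (Fin (n + 1)) ℂ

/-- Vectors of `H₁`, with the Euclidean norm. -/
abbrev Ket₁ (n : ℕ) := EuclideanSpace ℂ (Fin (n + 1))

/-- The Lindblad dissipator `D_L ρ = L ρ L† - (L† L ρ + ρ L† L) / 2`. -/
def dissipator {ι : Type*} [Fintype ι] (L ρ : Matrix ι ι ℂ) : Matrix ι ι ℂ :=
  L * ρ * Lᴴ - (1 / 2 : ℂ) • (Lᴴ * L * ρ + ρ * (Lᴴ * L))

/-- The kernel of `D_L` on operators of `H₀` is one-dimensional and spanned by the pure state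
`|e⁰⟩⟨e⁰|`. -/
def HasPureKernel {m : ℕ} (L : Matrix (Fin (m + 2)) (Fin (m + 2)) ℂ) : Prop :=
  ∀ X : Matrix (Fin (m + 2)) (Fin (m + 2)) ℂ,
    dissipator L X = 0 ↔ ∃ c : ℂ, X = c • Matrix.single 0 0 1

/-- The generator `ρ ↦ -i [H, ρ] + Γ D_{L ⊗ 1} ρ`. -/
def lindbladian {m n : ℕ} (H : Op m n) (L : Matrix (Fin (m + 2)) (Fin (m + 2)) ℂ) (Γ : ℝ)
    (ρ : Op m n) : Op m n :=
  -Complex.I • (H * ρ - ρ * H) +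
    (Γ : ℂ) • dissipator (L ⊗ₖ (1 : Matrix (Fin (n + 1)) (Fin (n + 1)) ℂ)) ρ

/-- `ρ` is a time-independent density matrix. -/
def IsNESS {m n : ℕ} (H : Op m n) (L : Matrix (Fin (m + 2)) (Fin (m + 2)) ℂ) (Γ : ℝ)
    (ρ : Op m n) : Prop :=
  ρ.PosSemidef ∧ ρ.trace = 1 ∧ lindbladian H L Γ ρ = 0

/-- The product vector `e^j ⊗ φ`. -/
def ket {m n : ℕ} (j : Fin (m + 2)) (φ : Ket₁ n) : Fin (m + 2) × Fin (n + 1) → ℂ :=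
  fun p => if p.1 = j then φ p.2 else 0

/-- The block `h_{jk} = ⟨e^j| H |e^k⟩`, an operator on `H₁`. -/
def block {m n : ℕ} (H : Op m n) (j k : Fin (m + 2)) : Op₁ n :=
  Matrix.of fun a b => H (j, a) (k, b)

/-- The matrix element `⟨φ| A |χ⟩` (antilinear in `φ`). -/
def braket {n : ℕ} (φ : Ket₁ n) (A : Op₁ n) (χ : Ket₁ n) : ℂ :=
  star (φ : Fin (n + 1) → ℂ) ⬝ᵥ (A *ᵥ (χ : Fin (n + 1) → ℂ))

/-- The rank-one operator `|φ⟩⟨φ|`. -/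
def proj {n : ℕ} (φ : Ket₁ n) : Op₁ n :=
  Matrix.vecMulVec (φ : Fin (n + 1) → ℂ) (star (φ : Fin (n + 1) → ℂ))

/-- `b` is an orthonormal eigenbasis of `h₀₀`, with eigenvalues `lam`, whose vector number `0`
is `ψ`. -/
def IsEigenbasis {n : ℕ} (h₀₀ : Op₁ n) (ψ : Ket₁ n)
    (b : OrthonormalBasis (Fin (n + 1)) ℂ (Ket₁ n)) (lam : Fin (n + 1) → ℝ) : Prop :=
  b 0 = ψ ∧ ∀ α, h₀₀ *ᵥ (b α : Fin (n + 1) → ℂ) = (lam α : ℂ) • (b α : Fin (n + 1) → ℂ)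

/-- `K_{αβ} = ∑_{k ≥ 1} (|⟨α|h_{k0}|β⟩|² - δ_{αβ} ⟨α|h_{k0}† h_{k0}|α⟩)`, for `α, β ≥ 1`. The
index `α : Fin n` stands for the basis vector number `α + 1`, and likewise for `k`. -/
def matK {m n : ℕ} (H : Op m n) (b : OrthonormalBasis (Fin (n + 1)) ℂ (Ket₁ n)) :
    Matrix (Fin n) (Fin n) ℝ :=
  Matrix.of fun α β => ∑ k : Fin (m + 1),
    (‖braket (b α.succ) (block H k.succ 0) (b β.succ)‖ ^ 2 -
      if α = β then
        (braket (b α.succ) ((block H k.succ 0)ᴴ * block H k.succ 0) (b α.succ)).re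
      else 0)

/-- `Λ = ∑_{α ≥ 1} (lam_α - lam_0)⁻¹ |α⟩⟨α|`. -/
def matLam {n : ℕ} (b : OrthonormalBasis (Fin (n + 1)) ℂ (Ket₁ n)) (lam : Fin (n + 1) → ℝ) :
    Op₁ n :=
  ∑ α : Fin n, (((lam α.succ - lam 0)⁻¹ : ℝ) : ℂ) • proj (b α.succ)

/-- `F_k = h_{k1} + [Λ h₀₁, h_{k0}]`. -/
def matF {m n : ℕ} (H : Op m n) (b : OrthonormalBasis (Fin (n + 1)) ℂ (Ket₁ n))
    (lam : Fin (n + 1) → ℝ) (k : Fin (m + 2)) : Op₁ n :=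
  block H k 1 + (matLam b lam * block H 0 1 * block H k 0 -
    block H k 0 * (matLam b lam * block H 0 1))

/-- `R_α = ∑_{k ≥ 1} ⟨α| F_k |0⟩⟨0| F_k† |α⟩`, for `α ≥ 1`. -/
def vecR {m n : ℕ} (H : Op m n) (b : OrthonormalBasis (Fin (n + 1)) ℂ (Ket₁ n))
    (lam : Fin (n + 1) → ℝ) (α : Fin n) : ℝ :=
  ∑ k : Fin (m + 1),
    (braket (b α.succ)
      (matF H b lam k.succ * proj (b 0) * (matF H b lam k.succ)ᴴ) (b α.succ)).re

/-- The squared characteristic dissipative strength `-8 |κ|² ∑_{α, β ≥ 1} (K⁻¹)_{αβ} R_β`. The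
matrix `K` has nonpositive eigenvalues, hence the sign. -/
def gammaChSq {m n : ℕ} (H : Op m n) (κ : ℂ) (b : OrthonormalBasis (Fin (n + 1)) ℂ (Ket₁ n))
    (lam : Fin (n + 1) → ℝ) : ℝ :=
  -8 * ‖κ‖ ^ 2 * ∑ α : Fin n, ∑ β : Fin n, (matK H b)⁻¹ α β * vecR H b lam β

/-- The single Jordan block `J`: `J e⁰ = 0` and `J e^j = e^(j-1)` for `j ≥ 1`. -/
def jordan (m : ℕ) : Matrix (Fin (m + 2)) (Fin (m + 2)) ℂ :=
  Matrix.of fun i j => if (i : ℕ) + 1 = (j : ℕ) then 1 else 0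

/-- The partial trace over `H₀`. -/
def reduced {m n : ℕ} (ρ : Op m n) : Op₁ n :=
  Matrix.of fun a b => ∑ j, ρ (j, a) (j, b)

/-- With `r(Γ) = tr_{H₀} ρ(Γ)`: for any two distinct vectors `α, β ≥ 1` of the eigenbasis with the
same eigenvalue, `Γ² (⟨α|r|β⟩ - ⟨α|r|0⟩⟨0|r|β⟩) → 0`. There is nothing to check if `h₀₀` has
simple spectrum; inside a degenerate eigenspace this selects the basis that diagonalizes the second
order correction to the target state. -/
def DiagonalizesCorrection {m n : ℕ} (ρ : ℝ → Op m n)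
    (b : OrthonormalBasis (Fin (n + 1)) ℂ (Ket₁ n)) (lam : Fin (n + 1) → ℝ) : Prop :=
  ∀ α β : Fin n, α ≠ β → lam α.succ = lam β.succ →
    Tendsto (fun Γ : ℝ => (Γ : ℂ) ^ 2 *
      (braket (b α.succ) (reduced (ρ Γ)) (b β.succ) -
        braket (b α.succ) (reduced (ρ Γ)) (b 0) * braket (b 0) (reduced (ρ Γ)) (b β.succ)))
      atTop (𝓝 0)

end ZenoTarget

end

/-! Write `ε = 1/Γ` and let `P` be the projection on `e⁰`. For large `Γ` the dissipator confines the
state to its kernel, the operators `|e⁰⟩⟨e⁰| ⊗ C`, and `H` moves `C` only perturbatively. At leading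
order `C` must commute with `h₀₀`. At the next order the dissipator has to be inverted on `[H,
|e⁰⟩⟨e⁰| ⊗ C]`, which lives in the row and the column of `e⁰`, off the corner. Since `L e⁰ = 0`, the
dissipator acts there as multiplication by `-L†L/2` from one side, so that an inverse `N` of `L†L`
off `e⁰` gives the response explicitly. The outcome is a Lindblad-type generator `effGen` on `H₁`
with jump operators `h_{k0}` (`tendsto_slow_drift`).

Convergence. By compactness it suffices to identify cluster points of the steady states. In a common
eigenbasis of `h₀₀` and `C` the effective equation is a classical rate equation. Its rates are the
values of the positive definite form `N` on the vectors `(⟨α|h_{k0}|β⟩)_k`, so they vanish exactly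
when the equal-weight rates in `K` do. The targeting condition makes `ψ` an eigenvector of every
`h_{k0}`: state `0` is absorbing. A stationary distribution that charged other states would have a
closed set of them as support, and there the columns of `K` would sum to zero, against invertibility
(`stationary_eq_zero`, `tendsto_target`).

Impurity. For the Jordan block one constructs a pure vector `Φ = e⁰⊗ψ + εφ₁ + ε²φ₂ + ε³φ₃` for which
`|Φ⟩⟨Φ|` is stationary up to `O(ε³)` (`exists_isExpansion`, `lindbladian_approx`). The remainder
`Γ²(ρ - |Φ⟩⟨Φ|)` obeys the same slow equation, now with a source given by the leading residual. It
is bounded, because a normalized limit of an unbounded sequence would be a nonzero solution of the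
homogeneous equation, and it converges to some `|e⁰⟩⟨e⁰| ⊗ C` (`exists_correction`). The diagonal of
the source consists of `16|κ|² R_α`, and the generator acts on a diagonal `C` through `K`, whence `c
= -4|κ|² K⁻¹R`. A pure state has no impurity, so the limit is twice the weight of `C` off the
target, `2 ∑ c_α` (`tendsto_impurity`). -/

noncomputable section

namespace ZenoTarget

section

variable {m n : ℕ}

/-! ### Blocks, partial traces and the dissipator -/

/-- The operator `|e⁰⟩⟨e⁰| ⊗ C`. -/
def emb (m : ℕ) (C : Op₁ n) : Op m n := Matrix.single 0 0 1 ⊗ₖ C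

/-- The operator `A ⊗ 1`. -/
def amp (n : ℕ) (A : Matrix (Fin (m + 2)) (Fin (m + 2)) ℂ) : Op m n := A ⊗ₖ (1 : Op₁ n)

lemma ext_block {X Y : Op m n} (h : ∀ i j, block X i j = block Y i j) : X = Y := by
  ext ⟨i, a⟩ ⟨j, b⟩
  exact congrFun (congrFun (h i j) a) b

lemma block_mul (X Y : Op m n) (i j : Fin (m + 2)) :
    block (X * Y) i j = ∑ k, block X i k * block Y k j := by
  ext a b
  simp [block, Matrix.mul_apply, Fintype.sum_prod_type, Matrix.sum_apply]

lemma block_amp (A : Matrix (Fin (m + 2)) (Fin (m + 2)) ℂ) (i j : Fin (m + 2)) :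
    block (amp n A) i j = A i j • (1 : Op₁ n) := by
  ext a b
  simp [block, amp]

lemma block_emb (C : Op₁ n) (i j : Fin (m + 2)) :
    block (emb m C) i j = if i = 0 ∧ j = 0 then C else 0 := by
  ext a b
  by_cases hi : i = 0 <;> by_cases hj : j = 0 <;>
    simp [block, emb, hi, hj, eq_comm]

lemma block_conjTranspose (X : Op m n) (i j : Fin (m + 2)) :
    block Xᴴ i j = (block X j i)ᴴ := rfl

lemma block_amp_mul (A : Matrix (Fin (m + 2)) (Fin (m + 2)) ℂ) (X : Op m n)
    (i j : Fin (m + 2)) : block (amp n A * X) i j = ∑ k, A i k • block X k j := by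
  simp [block_mul, block_amp]

lemma block_mul_amp (A : Matrix (Fin (m + 2)) (Fin (m + 2)) ℂ) (X : Op m n)
    (i j : Fin (m + 2)) : block (X * amp n A) i j = ∑ k, A k j • block X i k := by
  simp [block_mul, block_amp]

lemma amp_mul (A B : Matrix (Fin (m + 2)) (Fin (m + 2)) ℂ) :
    amp n (A * B) = amp n A * amp n B := by
  simp [amp, ← Matrix.mul_kronecker_mul]

lemma amp_one : amp n (1 : Matrix (Fin (m + 2)) (Fin (m + 2)) ℂ) = 1 := by
  simp [amp]

lemma amp_zero : amp n (0 : Matrix (Fin (m + 2)) (Fin (m + 2)) ℂ) = 0 := by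
  simp [amp]

lemma amp_sub (A B : Matrix (Fin (m + 2)) (Fin (m + 2)) ℂ) :
    amp n (A - B) = amp n A - amp n B := by
  ext i j
  simp [amp, sub_mul]

lemma amp_conjTranspose (A : Matrix (Fin (m + 2)) (Fin (m + 2)) ℂ) :
    (amp n A)ᴴ = amp n Aᴴ := by
  simp [amp, Matrix.conjTranspose_kronecker]

lemma amp_single_mul_emb (C : Op₁ n) : amp n (Matrix.single 0 0 1) * emb m C = emb m C := by
  simp [amp, emb, ← Matrix.mul_kronecker_mul]

lemma emb_mul_amp_single (C : Op₁ n) : emb m C * amp n (Matrix.single 0 0 1) = emb m C := by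
  simp [amp, emb, ← Matrix.mul_kronecker_mul]

lemma reduced_eq_sum_block (X : Op m n) : reduced X = ∑ j, block X j j := by
  ext a b
  simp [reduced, block, Matrix.sum_apply]

lemma reduced_add (X Y : Op m n) : reduced (X + Y) = reduced X + reduced Y := by
  ext a b
  simp [reduced, Finset.sum_add_distrib]

lemma reduced_smul (c : ℂ) (X : Op m n) : reduced (c • X) = c • reduced X := by
  ext a b
  simp [reduced, Finset.mul_sum]

lemma reduced_sub (X Y : Op m n) : reduced (X - Y) = reduced X - reduced Y := by
  ext a b
  simp [reduced, Finset.sum_sub_distrib]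

lemma reduced_zero : reduced (0 : Op m n) = 0 := by
  ext a b
  simp [reduced]

lemma reduced_conjTranspose (X : Op m n) : reduced Xᴴ = (reduced X)ᴴ := by
  ext a b
  simp [reduced]

lemma trace_reduced (X : Op m n) : (reduced X).trace = X.trace := by
  simp only [Matrix.trace, reduced, Matrix.diag, Matrix.of_apply, Fintype.sum_prod_type]
  exact Finset.sum_comm

lemma continuous_reduced : Continuous (reduced : Op m n → Op₁ n) := by
  unfold reduced
  refine continuous_matrix fun a b => ?_
  simp only [Matrix.of_apply]
  fun_prop

lemma reduced_emb (C : Op₁ n) : reduced (emb m C) = C := by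
  simp [reduced_eq_sum_block, block_emb]

lemma emb_add (C C' : Op₁ n) : emb m (C + C') = emb m C + emb m C' := by
  simp [emb, Matrix.kronecker_add]

lemma emb_smul (c : ℂ) (C : Op₁ n) : emb m (c • C) = c • emb m C := by
  simp [emb, Matrix.kronecker_smul]

lemma emb_zero : emb m (0 : Op₁ n) = 0 := by
  simp [emb]

lemma continuous_emb : Continuous (emb m : Op₁ n → Op m n) := by
  unfold emb
  refine continuous_matrix fun a b => ?_
  simp only [Matrix.kroneckerMap_apply]
  fun_prop

lemma reduced_mul_emb (X : Op m n) (C : Op₁ n) : reduced (X * emb m C) = block X 0 0 * C := by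
  simp [reduced_eq_sum_block, block_mul, block_emb, ite_and]

lemma reduced_emb_mul (X : Op m n) (C : Op₁ n) : reduced (emb m C * X) = C * block X 0 0 := by
  simp [reduced_eq_sum_block, block_mul, block_emb, ite_and]

lemma reduced_amp_mul_comm (A : Matrix (Fin (m + 2)) (Fin (m + 2)) ℂ) (X : Op m n) :
    reduced (amp n A * X) = reduced (X * amp n A) := by
  simp only [reduced_eq_sum_block, block_amp_mul, block_mul_amp]
  exact Finset.sum_comm

/-- The dissipator as a linear map. -/
def dissipatorLin {ι : Type*} [Fintype ι] (L : Matrix ι ι ℂ) :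
    Matrix ι ι ℂ →ₗ[ℂ] Matrix ι ι ℂ where
  toFun := dissipator L
  map_add' X Y := by
    simp only [dissipator, mul_add, add_mul, smul_add]
    abel
  map_smul' c X := by
    simp [dissipator, smul_sub, smul_comm c]

lemma dissipator_amp (L : Matrix (Fin (m + 2)) (Fin (m + 2)) ℂ) (X : Op m n) :
    dissipator (L ⊗ₖ (1 : Op₁ n)) X = amp n L * X * amp n Lᴴ -
      (1 / 2 : ℂ) • (amp n (Lᴴ * L) * X + X * amp n (Lᴴ * L)) := by
  simp only [dissipator, amp_mul, ← amp_conjTranspose]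
  rfl

lemma trace_dissipator {ι : Type*} [Fintype ι] (L X : Matrix ι ι ℂ) :
    (dissipator L X).trace = 0 := by
  simp only [dissipator, Matrix.trace_sub, Matrix.trace_smul, Matrix.trace_add]
  rw [Matrix.trace_mul_comm X (Lᴴ * L), Matrix.trace_mul_comm (L * X) Lᴴ, ← Matrix.mul_assoc]
  simp only [smul_eq_mul]
  ring

lemma reduced_dissipator (L : Matrix (Fin (m + 2)) (Fin (m + 2)) ℂ) (X : Op m n) :
    reduced (dissipator (L ⊗ₖ (1 : Op₁ n)) X) = 0 := by
  rw [dissipator_amp, reduced_sub, reduced_smul, reduced_add, ← reduced_amp_mul_comm Lᴴ,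
    ← reduced_amp_mul_comm (Lᴴ * L), ← Matrix.mul_assoc, ← amp_mul]
  module

/-- The matrix on `H₀` obtained by fixing matrix indices on `H₁`. -/
def slice (X : Op m n) (a b : Fin (n + 1)) : Matrix (Fin (m + 2)) (Fin (m + 2)) ℂ :=
  Matrix.of fun i j => X (i, a) (j, b)

lemma slice_dissipator (L : Matrix (Fin (m + 2)) (Fin (m + 2)) ℂ) (X : Op m n)
    (a b : Fin (n + 1)) :
    slice (dissipator (L ⊗ₖ (1 : Op₁ n)) X) a b = dissipator L (slice X a b) := by
  have h1 (A : Matrix (Fin (m + 2)) (Fin (m + 2)) ℂ) (Y : Op m n) :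
      slice (amp n A * Y) a b = A * slice Y a b := by
    ext i j
    simp [slice, amp, Matrix.mul_apply, Fintype.sum_prod_type, Matrix.one_apply]
  have h2 (A : Matrix (Fin (m + 2)) (Fin (m + 2)) ℂ) (Y : Op m n) :
      slice (Y * amp n A) a b = slice Y a b * A := by
    ext i j
    simp [slice, amp, Matrix.mul_apply, Fintype.sum_prod_type, Matrix.one_apply]
  have h3 (Y Z : Op m n) : slice (Y - Z) a b = slice Y a b - slice Z a b := rfl
  have h4 (Y Z : Op m n) : slice (Y + Z) a b = slice Y a b + slice Z a b := rfl
  have h5 (c : ℂ) (Y : Op m n) : slice (c • Y) a b = c • slice Y a b := rfl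
  rw [dissipator_amp, h3, h5, h4, h2, h1, h1, h2, dissipator]

/-- The dissipator acts separately on each matrix over `H₀` obtained by fixing indices in `H₁`, so
the hypothesis on the kernel applies entrywise in `H₁`. -/
lemma dissipator_eq_zero_imp {L : Matrix (Fin (m + 2)) (Fin (m + 2)) ℂ} (hL : HasPureKernel L)
    {X : Op m n} (hX : dissipator (L ⊗ₖ (1 : Op₁ n)) X = 0) : X = emb m (reduced X) := by
  have key (a b) : ∃ c : ℂ, slice X a b = c • Matrix.single 0 0 1 := by
    rw [← hL, ← slice_dissipator, hX]
    rfl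
  ext ⟨i, a⟩ ⟨j, b⟩
  obtain ⟨c, hc⟩ := key a b
  have hX' (i j) : X (i, a) (j, b) = c * (Matrix.single 0 0 1 : Matrix _ _ ℂ) i j :=
    congrFun (congrFun hc i) j
  simp only [emb, Matrix.kroneckerMap_apply, reduced, Matrix.of_apply, hX', ← Finset.mul_sum]
  rw [mul_comm]
  congr 1
  simp [Matrix.single_apply]

/-- The dissipator has a left inverse modulo its kernel. -/
lemma exists_dissipator_leftInverse {L : Matrix (Fin (m + 2)) (Fin (m + 2)) ℂ}
    (hL : HasPureKernel L) (n : ℕ) : ∃ S : Op m n →ₗ[ℂ] Op m n,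
      ∀ X, S (dissipator (L ⊗ₖ (1 : Op₁ n)) X) = X - emb m (reduced X) := by
  let R : Op m n →ₗ[ℂ] Op m n :=
    { toFun := fun X => emb m (reduced X)
      map_add' := fun X Y => by rw [reduced_add, emb_add]
      map_smul' := fun c X => by rw [reduced_smul, emb_smul]; rfl }
  -- Adding the projection onto the kernel makes the dissipator invertible: the partial trace
  -- annihilates the dissipator and is inverse to `emb`, hence separates the two summands.
  let T : Op m n →ₗ[ℂ] Op m n := dissipatorLin (L ⊗ₖ (1 : Op₁ n)) + R
  have hT (X : Op m n) : T X = dissipator (L ⊗ₖ (1 : Op₁ n)) X + emb m (reduced X) := rfl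
  have hinj : Function.Injective T := by
    rw [← LinearMap.ker_eq_bot, LinearMap.ker_eq_bot']
    intro X hX
    rw [hT] at hX
    have h0 : reduced X = 0 := by
      have := congrArg reduced hX
      rwa [reduced_add, reduced_dissipator, reduced_emb, zero_add, reduced_zero] at this
    rw [h0, emb_zero, add_zero] at hX
    rw [dissipator_eq_zero_imp hL hX, h0, emb_zero]
  have hemb (C : Op₁ n) : dissipator (L ⊗ₖ (1 : Op₁ n)) (emb m C) = 0 := by
    ext ⟨i, a⟩ ⟨j, b⟩
    have h1 : slice (emb m C) a b = C a b • Matrix.single 0 0 1 := by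
      ext i j
      simp [slice, emb, mul_comm]
    have h2 : dissipator L (slice (emb m C) a b) = 0 := (hL _).2 ⟨_, h1⟩
    rw [← slice_dissipator] at h2
    exact congrFun (congrFun h2 i) j
  refine ⟨(LinearEquiv.ofInjectiveEndo T hinj).symm.toLinearMap, fun X => ?_⟩
  change (LinearEquiv.ofInjectiveEndo T hinj).symm _ = _
  rw [LinearEquiv.symm_apply_eq, LinearEquiv.coe_ofInjectiveEndo, map_sub, hT, hT, hemb,
    reduced_emb]
  abel

end

section

variable {m n : ℕ}

/-! ### Structure of a jump operator with a pure kernel -/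

lemma mul_single_zero_apply (A : Matrix (Fin (m + 2)) (Fin (m + 2)) ℂ) (i j : Fin (m + 2)) :
    (A * (Matrix.single 0 0 1 : Matrix (Fin (m + 2)) (Fin (m + 2)) ℂ)) i j = if j = 0 then A i 0 else 0 := by
  rw [Matrix.mul_apply]
  by_cases hj : j = 0
  · subst hj
    rw [Finset.sum_eq_single 0]
    · simp
    · intro k _ hk
      simp [hk.symm]
    · simp
  · have hj' : (0 : Fin (m + 2)) ≠ j := fun h => hj h.symm
    simp [hj, hj']

lemma single_zero_mul_apply (A : Matrix (Fin (m + 2)) (Fin (m + 2)) ℂ) (i j : Fin (m + 2)) :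
    ((Matrix.single 0 0 1 : Matrix (Fin (m + 2)) (Fin (m + 2)) ℂ) * A) i j = if i = 0 then A 0 j else 0 := by
  have h := mul_single_zero_apply Aᵀ j i
  rw [← Matrix.transpose_single, ← Matrix.transpose_mul] at h
  exact h

lemma single_zero_apply (i j : Fin (m + 2)) :
    (Matrix.single 0 0 1 : Matrix (Fin (m + 2)) (Fin (m + 2)) ℂ) i j =
      if i = 0 ∧ j = 0 then 1 else 0 := by
  simp [Matrix.single_apply, eq_comm]

/-- On operators `|x⟩⟨e⁰|` the jump term and one half of the anticommutator vanish. This is what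
makes the dissipator explicitly invertible in the column of `e⁰`. -/
lemma dissipator_mul_single {L X : Matrix (Fin (m + 2)) (Fin (m + 2)) ℂ}
    (hL : L * Matrix.single 0 0 1 = 0) :
    dissipator L (X * Matrix.single 0 0 1) =
      -(1 / 2 : ℂ) • (Lᴴ * L * X * Matrix.single 0 0 1) := by
  have h : (Matrix.single 0 0 1 : Matrix (Fin (m + 2)) (Fin (m + 2)) ℂ) * Lᴴ = 0 := by
    have := congrArg Matrix.conjTranspose hL
    simpa [Matrix.conjTranspose_mul] using this
  have h1 : L * (X * Matrix.single 0 0 1) * Lᴴ = 0 := by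
    simp only [Matrix.mul_assoc, h, Matrix.mul_zero]
  have h2 : X * Matrix.single 0 0 1 * (Lᴴ * L) = 0 := by
    rw [Matrix.mul_assoc, ← Matrix.mul_assoc (Matrix.single 0 0 1), h]
    simp
  rw [dissipator, h1, h2]
  simp only [Matrix.mul_assoc]
  module

/-- Stationarity of `|e⁰⟩⟨e⁰|` only makes `e⁰` an eigenvector of `L`. That its eigenvalue is zero
uses that the kernel contains nothing else and that `H₀` has dimension at least two. -/
lemma HasPureKernel.mul_single_eq_zero {L : Matrix (Fin (m + 2)) (Fin (m + 2)) ℂ}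
    (hL : HasPureKernel L) : L * Matrix.single 0 0 1 = 0 := by
  set P : Matrix (Fin (m + 2)) (Fin (m + 2)) ℂ := Matrix.single 0 0 1 with hP
  have hPP : P * P = P := by simp [P]
  have hPh : Pᴴ = P := by simp [P]
  have hD : dissipator L P = 0 := (hL _).2 ⟨1, by simp [P]⟩
  have hentry (i j) : L i 0 * star (L j 0) -
      (1 / 2 : ℂ) * ((if j = 0 then (Lᴴ * L) i 0 else 0) +
        if i = 0 then (Lᴴ * L) 0 j else 0) = 0 := by
    have := congrFun (congrFun hD i) j
    rw [dissipator] at this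
    have e1 : (L * P * Lᴴ) i j = L i 0 * star (L j 0) := by
      rw [Matrix.mul_apply]
      simp [P, mul_single_zero_apply]
    have e2 : (Lᴴ * L * P) i j = if j = 0 then (Lᴴ * L) i 0 else 0 := by
      rw [hP, mul_single_zero_apply]
    have e3 : (P * (Lᴴ * L)) i j = if i = 0 then (Lᴴ * L) 0 j else 0 := by
      rw [hP, single_zero_mul_apply]
    rw [Matrix.sub_apply, Matrix.smul_apply, Matrix.add_apply, e1, e2, e3] at this
    exact this
  have hcol (i : Fin (m + 2)) (hi : i ≠ 0) : L i 0 = 0 := by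
    have := hentry i i
    simpa [hi] using this
  have hG (i) : (Lᴴ * L) i 0 = star (L 0 i) * L 0 0 := by
    rw [Matrix.mul_apply, Finset.sum_eq_single 0]
    · rfl
    · intro k _ hk
      simp [hcol k hk]
    · simp
  have h00 : L 0 0 = 0 := by
    -- A nonzero eigenvalue would also clear the row of `e⁰` in `L`. Then `P` commutes with `L` and
    -- `L†`, and the dissipator commutes with the compression `X ↦ P X P`, whose image it
    -- annihilates. Everything in the range of the dissipator would thus have zero corner, although
    -- the range contains all traceless matrices.
    by_contra hc
    have hrow (i : Fin (m + 2)) (hi : i ≠ 0) : L 0 i = 0 := by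
      have := hentry i 0
      simpa [hi, hcol i hi, hG, hc] using this
    have hLP : L * P = L 0 0 • P := by
      ext i j
      by_cases hi : i = 0 <;> by_cases hj : j = 0 <;>
        simp [P, single_zero_apply, hi, hj, hcol]
    have hPL : P * L = L 0 0 • P := by
      ext i j
      by_cases hi : i = 0 <;> by_cases hj : j = 0 <;>
        simp [P, single_zero_apply, hi, hj, hrow]
    have hcomm : L * P = P * L := hLP.trans hPL.symm
    have hcomm' : Lᴴ * P = P * Lᴴ := by
      have := congrArg Matrix.conjTranspose hcomm
      rw [Matrix.conjTranspose_mul, Matrix.conjTranspose_mul, hPh] at this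
      exact this.symm
    let T : Matrix (Fin (m + 2)) (Fin (m + 2)) ℂ →ₗ[ℂ] Matrix (Fin (m + 2)) (Fin (m + 2)) ℂ :=
      dissipatorLin L + (Matrix.traceLinearMap _ ℂ ℂ).smulRight P
    have hT (X) : T X = dissipator L X + X.trace • P := rfl
    have hinj : Function.Injective T := by
      rw [← LinearMap.ker_eq_bot, LinearMap.ker_eq_bot']
      intro X hX
      rw [hT] at hX
      have h0 : X.trace = 0 := by
        have := congrArg Matrix.trace hX
        simpa [trace_dissipator, P] using this
      rw [h0, zero_smul, add_zero] at hX
      obtain ⟨c, rfl⟩ := (hL _).1 hX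
      have : c = 0 := by simpa using h0
      simp [this]
    -- The factor `m + 2` is the dimension of `H₀`. It makes the right side traceless, so that it
    -- lies in the range of the dissipator itself; its corner is `-(m + 1) ≠ 0`.
    obtain ⟨X, hX⟩ := LinearMap.injective_iff_surjective.1 hinj (1 - (m + 2 : ℂ) • P)
    rw [hT] at hX
    have h0 : X.trace = 0 := by
      have := congrArg Matrix.trace hX
      simpa [trace_dissipator, P] using this
    rw [h0, zero_smul, add_zero] at hX
    have h1 : P * dissipator L X * P = dissipator L (P * X * P) := by
      simp only [dissipator, mul_sub, sub_mul, mul_add, add_mul, Matrix.mul_smul,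
        Matrix.smul_mul]
      have a1 : P * (L * X * Lᴴ) * P = L * (P * X * P) * Lᴴ := by
        calc _ = (P * L) * X * (Lᴴ * P) := by noncomm_ring
          _ = _ := by rw [hcomm', ← hcomm]; noncomm_ring
      have a2 : P * (Lᴴ * L * X) * P = Lᴴ * L * (P * X * P) := by
        calc _ = (P * Lᴴ) * L * X * P := by noncomm_ring
          _ = Lᴴ * (P * L) * X * P := by rw [← hcomm']; noncomm_ring
          _ = _ := by rw [← hcomm]; noncomm_ring
      have a3 : P * (X * (Lᴴ * L)) * P = P * X * P * (Lᴴ * L) := by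
        calc _ = P * X * Lᴴ * (L * P) := by noncomm_ring
          _ = P * X * (Lᴴ * P) * L := by rw [hcomm]; noncomm_ring
          _ = _ := by rw [hcomm']; noncomm_ring
      rw [a1, a2, a3]
    have h2 : dissipator L (P * X * P) = 0 := by
      refine (hL _).2 ⟨X 0 0, ?_⟩
      ext i j
      by_cases hi : i = 0 <;> by_cases hj : j = 0 <;>
        simp [P, single_zero_apply, hi, hj]
    rw [h2, hX] at h1
    have h3 := congrFun (congrFun h1 0) 0
    simp only [mul_sub, sub_mul, mul_one, hPP, Matrix.mul_smul, Matrix.smul_mul] at h3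
    have h4 : (1 : ℂ) - (m + 2) = 0 := by simpa [P] using h3
    have h5 : ((m + 1 : ℕ) : ℂ) = 0 := by push_cast; linear_combination -h4
    exact Nat.cast_ne_zero.2 (Nat.succ_ne_zero m) h5
  ext i j
  by_cases hi : i = 0 <;> simp [P, mul_single_zero_apply, hi, h00, hcol]

/-- `N` inverts `L† L` on the orthogonal complement of `e⁰` and vanishes on `e⁰`. -/
structure IsJumpInverse (L N : Matrix (Fin (m + 2)) (Fin (m + 2)) ℂ) : Prop where
  mul_single : L * Matrix.single 0 0 1 = 0
  gram_mul : Lᴴ * L * N = 1 - Matrix.single 0 0 1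
  mul_gram : N * (Lᴴ * L) = 1 - Matrix.single 0 0 1
  row_zero : Matrix.single 0 0 1 * N = 0
  col_zero : N * Matrix.single 0 0 1 = 0

/-- The operator `L†L + P` is positive definite, and `N` is its inverse minus `P`. Definiteness of
the block of `N` off `e⁰` later guarantees nonnegative rates that vanish only with all the matrix
elements behind them. -/
lemma HasPureKernel.exists_jumpInverse {L : Matrix (Fin (m + 2)) (Fin (m + 2)) ℂ}
    (hL : HasPureKernel L) : ∃ N : Matrix (Fin (m + 2)) (Fin (m + 2)) ℂ,
      IsJumpInverse L N ∧ (N.submatrix Fin.succ Fin.succ).PosDef := by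
  set P : Matrix (Fin (m + 2)) (Fin (m + 2)) ℂ := Matrix.single 0 0 1 with hP
  have hPP : P * P = P := by simp [P]
  have hPh : Pᴴ = P := by simp [P]
  have hLP : L * P = 0 := hL.mul_single_eq_zero
  have hPL : P * Lᴴ = 0 := by
    have := congrArg Matrix.conjTranspose hLP
    simpa [Matrix.conjTranspose_mul, hPh] using this
  have hpd : (Lᴴ * L + P).PosDef := by
    refine Matrix.PosDef.of_dotProduct_mulVec_pos ?_ fun x hx => ?_
    · simp [Matrix.IsHermitian, Matrix.conjTranspose_mul, hPh]
    · have hsum : star x ⬝ᵥ ((Lᴴ * L + P) *ᵥ x) =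
          star (L *ᵥ x) ⬝ᵥ (L *ᵥ x) + star (P *ᵥ x) ⬝ᵥ (P *ᵥ x) := by
        have e (A : Matrix (Fin (m + 2)) (Fin (m + 2)) ℂ) :
            star (A *ᵥ x) ⬝ᵥ (A *ᵥ x) = star x ⬝ᵥ ((Aᴴ * A) *ᵥ x) := by
          rw [Matrix.star_mulVec, ← Matrix.dotProduct_mulVec, Matrix.mulVec_mulVec]
        rw [e, e, hPh, hPP, Matrix.add_mulVec, dotProduct_add]
      rw [hsum]
      have p1 := dotProduct_star_self_nonneg (L *ᵥ x)
      have p2 := dotProduct_star_self_nonneg (P *ᵥ x)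
      refine lt_of_le_of_ne (add_nonneg p1 p2) fun h => hx ?_
      obtain ⟨q1, q2⟩ := (add_eq_zero_iff_of_nonneg p1 p2).1 h.symm
      rw [dotProduct_star_self_eq_zero] at q1 q2
      have hx0 : x 0 = 0 := by simpa [P, Matrix.mulVec, dotProduct, single_zero_apply] using congrFun q2 0
      -- A vector `x` with `L x = 0` and no component along `e⁰` would put `|x⟩⟨e⁰|` in the kernel
      -- of the dissipator, hence make it a multiple of `P`, and so `x = 0`.
      have hXP : Matrix.vecMulVec x (Pi.single 0 1) * P = Matrix.vecMulVec x (Pi.single 0 1) := by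
        ext i j
        by_cases hj : j = 0 <;>
          simp [P, Matrix.vecMulVec_apply, hj]
      have hker : dissipator L (Matrix.vecMulVec x (Pi.single 0 1)) = 0 := by
        rw [← hXP, dissipator_mul_single hLP, Matrix.mul_assoc _ _ P, hXP, Matrix.mul_assoc,
          Matrix.mul_vecMulVec, q1]
        simp
      obtain ⟨c, hc⟩ := (hL _).1 hker
      ext i
      by_cases hi : i = 0
      · rw [hi, hx0]; rfl
      · have := congrFun (congrFun hc i) 0
        simpa [Matrix.vecMulVec_apply, Ne.symm hi] using this
  set M := (Lᴴ * L + P)⁻¹ with hM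
  have hu : IsUnit (Lᴴ * L + P).det := (Matrix.isUnit_iff_isUnit_det _).1 hpd.isUnit
  have h1 : (Lᴴ * L + P) * M = 1 := Matrix.mul_nonsing_inv _ hu
  have h2 : M * (Lᴴ * L + P) = 1 := Matrix.nonsing_inv_mul _ hu
  have h3 : P * M = P := by
    have : P * (Lᴴ * L + P) = P := by
      rw [mul_add, ← Matrix.mul_assoc, hPL, Matrix.zero_mul, zero_add, hPP]
    calc P * M = P * (Lᴴ * L + P) * M := by rw [this]
      _ = P := by rw [Matrix.mul_assoc, h1, mul_one]
  have h4 : M * P = P := by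
    have : (Lᴴ * L + P) * P = P := by
      rw [add_mul, Matrix.mul_assoc, hLP, Matrix.mul_zero, zero_add, hPP]
    calc M * P = M * ((Lᴴ * L + P) * P) := by rw [this]
      _ = P := by rw [← Matrix.mul_assoc, h2, one_mul]
  refine ⟨M - P, ⟨hLP, ?_, ?_, ?_, ?_⟩, ?_⟩
  · rw [add_mul, h3] at h1
    rw [mul_sub, Matrix.mul_assoc Lᴴ L P, hLP, Matrix.mul_zero, sub_zero]
    exact eq_sub_of_add_eq h1
  · rw [mul_add, h4] at h2
    rw [sub_mul, ← Matrix.mul_assoc P, hPL, Matrix.zero_mul, sub_zero]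
    exact eq_sub_of_add_eq h2
  · rw [mul_sub, h3, hPP, sub_self]
  · rw [sub_mul, h4, hPP, sub_self]
  · have : (M - P).submatrix Fin.succ Fin.succ = M.submatrix Fin.succ Fin.succ := by
      ext i j
      simp [P, (Fin.succ_ne_zero i).symm]
    rw [this]
    exact hpd.inv.submatrix (Fin.succ_injective _)

lemma jordan_conjTranspose_mul_self (m : ℕ) :
    (jordan m)ᴴ * jordan m = 1 - Matrix.single 0 0 1 := by
  ext i j
  rw [Matrix.mul_apply, Matrix.sub_apply, Matrix.one_apply, single_zero_apply]
  induction i using Fin.cases with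
  | zero =>
    by_cases hj : j = 0
    · simp [hj, jordan]
    · have hj' : (0 : Fin (m + 2)) ≠ j := fun h => hj h.symm
      simp [hj, hj', jordan]
  | succ i =>
    rw [Finset.sum_eq_single i.castSucc]
    · have : (i.castSucc : ℕ) + 1 = (i.succ : ℕ) := by simp
      simp only [jordan, Matrix.conjTranspose_apply, Matrix.of_apply, Fin.succ_ne_zero, false_and,
        if_false, if_true, star_one, one_mul, sub_zero, this, ← Fin.ext_iff]
    · intro k _ hk
      have : ¬ (k : ℕ) = i := fun h => hk (Fin.ext h)
      simp [jordan, this]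
    · simp

lemma isJumpInverse_jordan (m : ℕ) : IsJumpInverse (jordan m) (1 - Matrix.single 0 0 1) where
  mul_single := by
    ext i j
    simp [mul_single_zero_apply, jordan]
  gram_mul := by
    rw [jordan_conjTranspose_mul_self]
    simp [mul_sub, sub_mul]
  mul_gram := by
    rw [jordan_conjTranspose_mul_self]
    simp [mul_sub, sub_mul]
  row_zero := by simp [mul_sub]
  col_zero := by simp [sub_mul]

end

section

variable {m n : ℕ}

/-! ### The effective generator on `H₁` -/

/-- The generator `C ↦ ∑ N_{jk} (2 h_k C h_j† - h_j† h_k C - C h_j† h_k)`. -/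
def effGen {ι : Type*} [Fintype ι] (N : Matrix ι ι ℂ) (h : ι → Op₁ n) (C : Op₁ n) : Op₁ n :=
  ∑ j, ∑ k, N j k • ((2 : ℂ) • (h k * C * (h j)ᴴ) - (h j)ᴴ * h k * C - C * ((h j)ᴴ * h k))

/-- The first order response of the steady state to the slow operator `emb C`. -/
def response (H : Op m n) (N : Matrix (Fin (m + 2)) (Fin (m + 2)) ℂ) (C : Op₁ n) : Op m n :=
  (-2 * Complex.I) • (amp n N * (H * emb m C) - emb m C * H * amp n N)

/-- The two orderings in each commutator combine into the gain term `2 h_k C h_j†` and the loss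
terms: `-i · (-2i) = -2`, and the two gain contributions agree by cyclicity of the partial trace in
the `H₀` factor. -/
lemma reduced_commutator_response {H : Op m n} (hH : H.IsHermitian)
    (N : Matrix (Fin (m + 2)) (Fin (m + 2)) ℂ) (C : Op₁ n) :
    -Complex.I • reduced (H * response H N C - response H N C * H) =
      (2 : ℂ) • effGen N (fun k => block H k 0) C := by
  have h0 (j) : block H 0 j = (block H j 0)ᴴ := by
    rw [← block_conjTranspose, hH.eq]
  have e1 : block (H * amp n N * H) 0 0 =
      ∑ j, ∑ k, N j k • ((block H j 0)ᴴ * block H k 0) := by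
    rw [Matrix.mul_assoc, block_mul]
    refine Finset.sum_congr rfl fun j _ => ?_
    rw [block_amp_mul, Finset.mul_sum, h0]
    simp
  have e2 : reduced (amp n N * (H * emb m C * H)) =
      ∑ j, ∑ k, N j k • (block H k 0 * C * (block H j 0)ᴴ) := by
    rw [reduced_eq_sum_block]
    refine Finset.sum_congr rfl fun j _ => ?_
    rw [block_amp_mul]
    refine Finset.sum_congr rfl fun k _ => ?_
    rw [Matrix.mul_assoc, block_mul, Finset.sum_eq_single 0]
    · rw [block_mul, Finset.sum_eq_single 0]
      · simp [block_emb, h0, Matrix.mul_assoc]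
      · intro i _ hi
        simp [block_emb, hi]
      · simp
    · intro i _ hi
      rw [block_mul, Finset.sum_eq_zero]
      · simp
      · intro l _
        simp [block_emb, hi]
    · simp
  have e3 : H * response H N C - response H N C * H = (-2 * Complex.I) •
      (H * amp n N * H * emb m C + emb m C * (H * amp n N * H) -
        (amp n N * (H * emb m C * H) + (H * emb m C * H) * amp n N)) := by
    simp only [response, Matrix.mul_smul, Matrix.smul_mul, ← smul_sub]
    congr 1
    noncomm_ring
  rw [e3, reduced_smul, reduced_sub, reduced_add, reduced_add, reduced_mul_emb, reduced_emb_mul,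
    ← reduced_amp_mul_comm, e2, e1, smul_smul]
  have hI : -Complex.I * (-2 * Complex.I) = -2 := by linear_combination 2 * Complex.I_mul_I
  rw [hI, effGen]
  simp only [Finset.sum_mul, Finset.mul_sum, smul_sub, Finset.sum_sub_distrib, Matrix.smul_mul,
    Matrix.mul_smul, smul_smul]
  simp only [mul_comm _ (2 : ℂ), mul_smul, ← Finset.smul_sum]
  module

lemma reduced_response {H : Op m n} {L N : Matrix (Fin (m + 2)) (Fin (m + 2)) ℂ}
    (hN : IsJumpInverse L N) (C : Op₁ n) : reduced (response H N C) = 0 := by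
  have h1 : reduced (amp n N * (H * emb m C)) = 0 := by
    have h : amp n N * (H * emb m C) = amp n N * (H * emb m C) * amp n (Matrix.single 0 0 1) := by
      rw [Matrix.mul_assoc, Matrix.mul_assoc, emb_mul_amp_single]
    rw [h, ← reduced_amp_mul_comm, ← Matrix.mul_assoc, ← amp_mul, hN.row_zero, amp_zero,
      Matrix.zero_mul, reduced_zero]
  have h2 : reduced (emb m C * H * amp n N) = 0 := by
    have h : emb m C * H * amp n N = amp n (Matrix.single 0 0 1) * (emb m C * H * amp n N) := by
      rw [← Matrix.mul_assoc, ← Matrix.mul_assoc, amp_single_mul_emb]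
    rw [h, reduced_amp_mul_comm, Matrix.mul_assoc, ← amp_mul, hN.col_zero, amp_zero,
      Matrix.mul_zero, reduced_zero]
  rw [response, reduced_smul, reduced_sub, h1, h2, sub_zero, smul_zero]

/-- The response is a solution of the first order equation. The factor `-1/2` in the action of the
dissipator on the row and column of `e⁰` is undone by the `2` in `response`, and `N` undoes `L†L` up
to the corner, where the commutator vanishes because `C` commutes with `h₀₀`. -/
lemma dissipator_response {H : Op m n} {L N : Matrix (Fin (m + 2)) (Fin (m + 2)) ℂ}
    (hN : IsJumpInverse L N) {C : Op₁ n} (hC : block H 0 0 * C = C * block H 0 0) :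
    dissipator (L ⊗ₖ (1 : Op₁ n)) (response H N C) =
      Complex.I • (H * emb m C - emb m C * H) := by
  have hLP : amp n L * amp n (Matrix.single 0 0 1) = 0 := by
    rw [← amp_mul, hN.mul_single, amp_zero]
  have hPL : amp n (Matrix.single 0 0 1) * amp n Lᴴ = 0 := by
    have := congrArg Matrix.conjTranspose hLP
    simpa [Matrix.conjTranspose_mul, amp_conjTranspose] using this
  have hLE : amp n L * emb m C = 0 := by
    rw [← amp_single_mul_emb, ← Matrix.mul_assoc, hLP, Matrix.zero_mul]
  have hEL : emb m C * amp n Lᴴ = 0 := by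
    rw [← emb_mul_amp_single, Matrix.mul_assoc, hPL, Matrix.mul_zero]
  have hQ1 : amp n (Lᴴ * L) * amp n N = 1 - amp n (Matrix.single 0 0 1) := by
    rw [← amp_mul, hN.gram_mul, amp_sub, amp_one]
  have hQ2 : amp n N * amp n (Lᴴ * L) = 1 - amp n (Matrix.single 0 0 1) := by
    rw [← amp_mul, hN.mul_gram, amp_sub, amp_one]
  -- Both sides have only the corner block, which is `h₀₀ C` on the left and `C h₀₀` on the right.
  have hc : amp n (Matrix.single 0 0 1) * (H * emb m C) =
      emb m C * H * amp n (Matrix.single 0 0 1) := by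
    refine ext_block fun i j => ?_
    rw [block_amp_mul, block_mul_amp, Finset.sum_eq_single 0, Finset.sum_eq_single 0, block_mul,
      block_mul, Finset.sum_eq_single 0, Finset.sum_eq_single 0]
    · by_cases hi : i = 0
      · by_cases hj : j = 0
        · simp [hi, hj, block_emb, hC]
        · simp [hi, hj, block_emb, single_zero_apply]
      · simp [hi, block_emb, single_zero_apply]
    all_goals simp +contextual [block_emb, single_zero_apply]
  have t1 : amp n L * (amp n N * (H * emb m C) - emb m C * H * amp n N) * amp n Lᴴ = 0 := by
    calc _ = amp n L * amp n N * H * (emb m C * amp n Lᴴ) -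
          (amp n L * emb m C) * H * amp n N * amp n Lᴴ := by noncomm_ring
      _ = 0 := by rw [hLE, hEL]; simp
  have t2 : amp n (Lᴴ * L) * (amp n N * (H * emb m C) - emb m C * H * amp n N) =
      H * emb m C - amp n (Matrix.single 0 0 1) * (H * emb m C) := by
    calc _ = (amp n (Lᴴ * L) * amp n N) * (H * emb m C) -
          amp n Lᴴ * (amp n L * emb m C) * H * amp n N := by rw [amp_mul]; noncomm_ring
      _ = _ := by rw [hLE, hQ1]; simp [sub_mul]
  have t3 : (amp n N * (H * emb m C) - emb m C * H * amp n N) * amp n (Lᴴ * L) =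
      -(emb m C * H - emb m C * H * amp n (Matrix.single 0 0 1)) := by
    calc _ = amp n N * H * (emb m C * amp n Lᴴ) * amp n L -
          emb m C * H * (amp n N * amp n (Lᴴ * L)) := by rw [amp_mul]; noncomm_ring
      _ = _ := by rw [hEL, hQ2]; simp [mul_sub]
  rw [dissipator_amp, response]
  simp only [Matrix.mul_smul, Matrix.smul_mul, t1, t2, t3, hc]
  module

/-- If `x(Γ)` is almost stationary and converges as `Γ → ∞`, then its limit is `|e⁰⟩⟨e⁰| ⊗ C`,
where `C` commutes with `h₀₀`, and the slow drift of `x(Γ)` is given by the effective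
generator. -/
theorem tendsto_slow_drift {H : Op m n} (hH : H.IsHermitian)
    {L N : Matrix (Fin (m + 2)) (Fin (m + 2)) ℂ} (hL : HasPureKernel L) (hN : IsJumpInverse L N)
    {l : Filter ℝ} [l.NeBot] (hl : l ≤ atTop) {x : ℝ → Op m n} {x₀ : Op m n}
    (hx : Tendsto x l (𝓝 x₀))
    (hp : Tendsto (fun Γ => lindbladian H L Γ (x Γ)) l (𝓝 0)) :
    x₀ = emb m (reduced x₀) ∧
    block H 0 0 * reduced x₀ = reduced x₀ * block H 0 0 ∧
    Tendsto (fun Γ : ℝ => (Γ : ℂ) • (reduced (lindbladian H L Γ (x Γ)) +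
      Complex.I • (block H 0 0 * reduced (x Γ) - reduced (x Γ) * block H 0 0))) l
      (𝓝 ((2 : ℂ) • effGen N (fun k => block H k 0) (reduced x₀))) := by
  obtain ⟨S, hS⟩ := exists_dissipator_leftInverse hL n
  have hScont : Continuous S := LinearMap.continuous_of_finiteDimensional S
  -- The part of `x(Γ)` outside the kernel is of order `1/Γ`: the definition of the generator is
  -- solved for `Γ` times the dissipator, and the left inverse is applied.
  have hy (Γ : ℝ) : (Γ : ℂ) • (x Γ - emb m (reduced (x Γ))) =
      S (lindbladian H L Γ (x Γ) + Complex.I • (H * x Γ - x Γ * H)) := by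
    rw [← hS, ← map_smul, lindbladian]
    congr 1
    module
  have hcomm : Tendsto (fun Γ => H * x Γ - x Γ * H) l (𝓝 (H * x₀ - x₀ * H)) := by
    have : Continuous fun X : Op m n => H * X - X * H := by fun_prop
    exact (this.tendsto x₀).comp hx
  have hred : Tendsto (fun Γ => reduced (x Γ)) l (𝓝 (reduced x₀)) :=
    (continuous_reduced.tendsto x₀).comp hx
  have hy_lim : Tendsto (fun Γ : ℝ => (Γ : ℂ) • (x Γ - emb m (reduced (x Γ)))) l
      (𝓝 (S (Complex.I • (H * x₀ - x₀ * H)))) := by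
    simp only [hy]
    have := hp.add (hcomm.const_smul Complex.I)
    rw [zero_add] at this
    exact (hScont.tendsto _).comp this
  have hinv : Tendsto (fun Γ : ℝ => ((Γ : ℂ))⁻¹) l (𝓝 0) := by
    have h1 : Tendsto (fun Γ : ℝ => Γ⁻¹) l (𝓝 0) := tendsto_inv_atTop_zero.mono_left hl
    have h2 := (Complex.continuous_ofReal.tendsto 0).comp h1
    simpa [Function.comp_def] using h2
  have hpos : ∀ᶠ Γ : ℝ in l, 0 < Γ := hl (eventually_gt_atTop 0)
  have hx₀ : x₀ = emb m (reduced x₀) := by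
    have h1 : Tendsto (fun Γ => x Γ - emb m (reduced (x Γ))) l
        (𝓝 (x₀ - emb m (reduced x₀))) :=
      hx.sub ((continuous_emb.tendsto _).comp hred)
    have h2 : Tendsto (fun Γ => x Γ - emb m (reduced (x Γ))) l (𝓝 0) := by
      have := hinv.smul hy_lim
      rw [zero_smul] at this
      refine this.congr' ?_
      filter_upwards [hpos] with Γ hΓ
      rw [smul_smul, inv_mul_cancel₀ (by exact_mod_cast hΓ.ne'), one_smul]
    exact sub_eq_zero.1 (tendsto_nhds_unique h1 h2)
  have hredlin (Γ : ℝ) : reduced (lindbladian H L Γ (x Γ)) =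
      -Complex.I • reduced (H * x Γ - x Γ * H) := by
    rw [lindbladian, reduced_add, reduced_smul, reduced_smul, reduced_dissipator, smul_zero,
      add_zero]
  -- The partial trace removes the dissipator with its large factor `Γ`, leaving only the commutator
  -- in the limit.
  have hC : block H 0 0 * reduced x₀ = reduced x₀ * block H 0 0 := by
    have h1 : Tendsto (fun Γ => reduced (lindbladian H L Γ (x Γ))) l
        (𝓝 (-Complex.I • reduced (H * x₀ - x₀ * H))) := by
      simp only [hredlin]
      exact ((continuous_reduced.tendsto _).comp hcomm).const_smul _
    have h2 : Tendsto (fun Γ => reduced (lindbladian H L Γ (x Γ))) l (𝓝 0) := by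
      have := (continuous_reduced.tendsto _).comp hp
      rwa [reduced_zero] at this
    have h3 := tendsto_nhds_unique h1 h2
    rw [smul_eq_zero, neg_eq_zero] at h3
    have h4 := h3.resolve_left Complex.I_ne_zero
    rw [hx₀, reduced_sub, reduced_mul_emb, reduced_emb_mul, sub_eq_zero] at h4
    exact h4
  refine ⟨hx₀, hC, ?_⟩
  -- Since the response has zero partial trace, the left inverse recovers it from its image under
  -- the dissipator.
  have hZ : S (Complex.I • (H * x₀ - x₀ * H)) = response H N (reduced x₀) := by
    have h := hS (response H N (reduced x₀))
    rw [reduced_response hN, emb_zero, sub_zero, dissipator_response hN hC, ← hx₀] at h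
    exact h
  rw [hZ] at hy_lim
  rw [← reduced_commutator_response hH]
  have hcont : Continuous fun X : Op m n => -Complex.I • reduced (H * X - X * H) := by
    have : Continuous fun X : Op m n => H * X - X * H := by fun_prop
    exact (continuous_reduced.comp this).const_smul (-Complex.I)
  -- Before the limit this is an exact identity: adding `i[h₀₀, reduced x]` removes the contribution
  -- of the kernel part of `x(Γ)` to the reduced commutator, and what remains is linear in `Γ (x -
  -- emb (reduced x))`.
  refine ((hcont.tendsto _).comp hy_lim).congr fun Γ => ?_
  simp only [Function.comp_apply]
  rw [hredlin, Matrix.mul_smul, Matrix.smul_mul, ← smul_sub, reduced_smul, Matrix.mul_sub,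
    Matrix.sub_mul, reduced_sub, reduced_sub, reduced_sub, reduced_mul_emb, reduced_emb_mul,
    reduced_sub]
  module

end

section

variable {m n : ℕ}

/-! ### Matrix elements in an orthonormal basis of `H₁` -/

/-- The unitary matrix whose columns are the vectors of `b`. -/
def basisMat (b : OrthonormalBasis (Fin (n + 1)) ℂ (Ket₁ n)) : Op₁ n :=
  Matrix.of fun i α => b α i

/-- The matrix of `A` in the basis `b`. -/
def rep (b : OrthonormalBasis (Fin (n + 1)) ℂ (Ket₁ n)) (A : Op₁ n) : Op₁ n :=
  (basisMat b)ᴴ * A * basisMat b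

variable (b : OrthonormalBasis (Fin (n + 1)) ℂ (Ket₁ n))

lemma inner_eq_star_dotProduct (φ χ : Ket₁ n) :
    inner ℂ φ χ = star (φ : Fin (n + 1) → ℂ) ⬝ᵥ (χ : Fin (n + 1) → ℂ) := by
  rw [EuclideanSpace.inner_eq_star_dotProduct, dotProduct_comm]

lemma star_dotProduct_basis (α β : Fin (n + 1)) :
    star (b α : Fin (n + 1) → ℂ) ⬝ᵥ (b β : Fin (n + 1) → ℂ) = if α = β then 1 else 0 := by
  rw [← inner_eq_star_dotProduct, orthonormal_iff_ite.1 b.orthonormal]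

lemma conjTranspose_basisMat_mul : (basisMat b)ᴴ * basisMat b = 1 := by
  ext α β
  rw [Matrix.one_apply, ← star_dotProduct_basis b]
  rfl

lemma basisMat_mul_conjTranspose : basisMat b * (basisMat b)ᴴ = 1 :=
  mul_eq_one_comm.1 (conjTranspose_basisMat_mul b)

lemma rep_apply (A : Op₁ n) (α β : Fin (n + 1)) :
    rep b A α β = star (b α : Fin (n + 1) → ℂ) ⬝ᵥ (A *ᵥ (b β : Fin (n + 1) → ℂ)) := by
  rw [rep, Matrix.mul_assoc]
  rfl

lemma braket_eq_rep (A : Op₁ n) (α β : Fin (n + 1)) : braket (b α) A (b β) = rep b A α β :=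
  (rep_apply b A α β).symm

lemma basisMat_rep (A : Op₁ n) : basisMat b * rep b A * (basisMat b)ᴴ = A := by
  calc _ = (basisMat b * (basisMat b)ᴴ) * A * (basisMat b * (basisMat b)ᴴ) := by
        rw [rep]; noncomm_ring
    _ = A := by simp [basisMat_mul_conjTranspose]

lemma rep_injective : Function.Injective (rep b) := fun A B h => by
  rw [← basisMat_rep b A, h, basisMat_rep]

lemma rep_mul (A B : Op₁ n) : rep b (A * B) = rep b A * rep b B := by
  calc _ = (basisMat b)ᴴ * A * 1 * B * basisMat b := by rw [rep]; noncomm_ring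
    _ = _ := by rw [← basisMat_mul_conjTranspose b, rep, rep]; noncomm_ring

lemma rep_conjTranspose (A : Op₁ n) : rep b Aᴴ = (rep b A)ᴴ := by
  simp [rep, Matrix.conjTranspose_mul, Matrix.mul_assoc]

lemma trace_rep (A : Op₁ n) : (rep b A).trace = A.trace := by
  rw [rep, Matrix.trace_mul_comm, ← Matrix.mul_assoc, basisMat_mul_conjTranspose, one_mul]

lemma rep_add (A B : Op₁ n) : rep b (A + B) = rep b A + rep b B := by
  simp [rep, mul_add, add_mul]

lemma rep_sub (A B : Op₁ n) : rep b (A - B) = rep b A - rep b B := by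
  simp [rep, mul_sub, sub_mul]

lemma rep_smul (c : ℂ) (A : Op₁ n) : rep b (c • A) = c • rep b A := by
  simp [rep]

lemma rep_zero : rep b 0 = 0 := by
  simp [rep]

lemma rep_sum {ι : Type*} (s : Finset ι) (A : ι → Op₁ n) :
    rep b (∑ i ∈ s, A i) = ∑ i ∈ s, rep b (A i) := by
  simp [rep, Finset.mul_sum, Finset.sum_mul]

lemma continuous_rep : Continuous (rep b) := by
  unfold rep
  fun_prop

lemma rep_effGen {ι : Type*} [Fintype ι] (N : Matrix ι ι ℂ) (h : ι → Op₁ n) (C : Op₁ n) :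
    rep b (effGen N h C) = effGen N (fun k => rep b (h k)) (rep b C) := by
  simp only [effGen, rep_sum, rep_smul, rep_sub, rep_mul, rep_conjTranspose]

lemma rep_apply_of_mulVec_eq {A : Op₁ n} {β : Fin (n + 1)} {c : ℂ}
    (h : A *ᵥ (b β : Fin (n + 1) → ℂ) = c • (b β : Fin (n + 1) → ℂ)) (α : Fin (n + 1)) :
    rep b A α β = if α = β then c else 0 := by
  rw [rep_apply, h, dotProduct_smul, star_dotProduct_basis]
  simp

lemma eq_zero_of_rep_eq_zero {v : Fin (n + 1) → ℂ}
    (h : ∀ α, star (b α : Fin (n + 1) → ℂ) ⬝ᵥ v = 0) : v = 0 := by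
  have h1 : (basisMat b)ᴴ *ᵥ v = 0 := funext h
  have h2 := congrArg (fun v => basisMat b *ᵥ v) h1
  simpa [Matrix.mulVec_mulVec, basisMat_mul_conjTranspose] using h2

variable {b}

lemma IsEigenbasis.rep_eq {h : Op₁ n} {ψ : Ket₁ n} {lam : Fin (n + 1) → ℝ}
    (hb : IsEigenbasis h ψ b lam) :
    rep b h = Matrix.diagonal fun α => (lam α : ℂ) := by
  ext α β
  rw [rep_apply_of_mulVec_eq b (hb.2 β), Matrix.diagonal_apply]
  split_ifs with hαβ
  · rw [hαβ]
  · rfl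

lemma IsEigenbasis.lam_zero {h : Op₁ n} {ψ : Ket₁ n} {lam : Fin (n + 1) → ℝ}
    (hb : IsEigenbasis h ψ b lam) {lam₀ : ℝ}
    (hψ : h *ᵥ (ψ : Fin (n + 1) → ℂ) = (lam₀ : ℂ) • (ψ : Fin (n + 1) → ℂ)) : lam 0 = lam₀ := by
  rw [← hb.1] at hψ
  have h1 := rep_apply_of_mulVec_eq b hψ 0
  rw [rep_apply_of_mulVec_eq b (hb.2 0) 0] at h1
  simpa using h1

lemma finrank_eigenspace_eq_one_unique {h : Op₁ n} {c : ℂ}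
    (hnd : Module.finrank ℂ (Module.End.eigenspace (Matrix.toLin' h) c) = 1)
    {v w : Fin (n + 1) → ℂ} (hv : h *ᵥ v = c • v) (hw : h *ᵥ w = c • w) (hv0 : v ≠ 0) :
    ∃ d : ℂ, w = d • v := by
  have hv' : v ∈ Module.End.eigenspace (Matrix.toLin' h) c := by
    rw [Module.End.mem_eigenspace_iff, Matrix.toLin'_apply, hv]
  have hw' : w ∈ Module.End.eigenspace (Matrix.toLin' h) c := by
    rw [Module.End.mem_eigenspace_iff, Matrix.toLin'_apply, hw]
  obtain ⟨d, hd⟩ := exists_smul_eq_of_finrank_eq_one hnd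
    (x := (⟨v, hv'⟩ : Module.End.eigenspace (Matrix.toLin' h) c))
    (fun h0 => hv0 (congrArg Subtype.val h0)) ⟨w, hw'⟩
  exact ⟨d, (congrArg Subtype.val hd).symm⟩

lemma basis_ne_zero (α : Fin (n + 1)) : (b α : Fin (n + 1) → ℂ) ≠ 0 := by
  intro h
  have := star_dotProduct_basis b α α
  simp [h] at this

lemma IsEigenbasis.lam_ne {h : Op₁ n} {ψ : Ket₁ n} {lam : Fin (n + 1) → ℝ}
    (hb : IsEigenbasis h ψ b lam)
    (hnd : Module.finrank ℂ (Module.End.eigenspace (Matrix.toLin' h) (lam 0 : ℂ)) = 1)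
    {α : Fin (n + 1)} (hα : α ≠ 0) : lam α ≠ lam 0 := by
  intro hlam
  have h1 := hb.2 α
  rw [hlam] at h1
  obtain ⟨d, hd⟩ := finrank_eigenspace_eq_one_unique hnd (hb.2 0) h1 (basis_ne_zero 0)
  have h2 := star_dotProduct_basis b α α
  have h3 := star_dotProduct_basis b α 0
  nth_rewrite 2 [hd] at h2
  rw [dotProduct_smul, h3, if_neg hα] at h2
  simp at h2

lemma IsEigenbasis.rep_apply_eq_zero {h C : Op₁ n} {ψ : Ket₁ n} {lam : Fin (n + 1) → ℝ}
    (hb : IsEigenbasis h ψ b lam) (hC : h * C = C * h) {α β : Fin (n + 1)}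
    (hαβ : lam α ≠ lam β) : rep b C α β = 0 := by
  have h1 := congrArg (rep b) hC
  rw [rep_mul, rep_mul, hb.rep_eq] at h1
  have h2 := congrFun (congrFun h1 α) β
  rw [Matrix.diagonal_mul, Matrix.mul_diagonal] at h2
  have h3 : ((lam α : ℂ) - lam β) * rep b C α β = 0 := by linear_combination h2
  refine (mul_eq_zero.1 h3).resolve_left fun h4 => hαβ ?_
  exact_mod_cast sub_eq_zero.1 h4

/-- Commuting Hermitian matrices have a common orthonormal eigenbasis. -/
lemma exists_common_eigenbasis {h C : Op₁ n} (hh : h.IsHermitian) (hC : C.IsHermitian)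
    (hcomm : h * C = C * h) :
    ∃ (b : OrthonormalBasis (Fin (n + 1)) ℂ (Ket₁ n)) (lam : Fin (n + 1) → ℝ)
      (mu : Fin (n + 1) → ℂ),
      (∀ α, h *ᵥ (b α : Fin (n + 1) → ℂ) = (lam α : ℂ) • (b α : Fin (n + 1) → ℂ)) ∧
      ∀ α, C *ᵥ (b α : Fin (n + 1) → ℂ) = mu α • (b α : Fin (n + 1) → ℂ) := by
  set A := Matrix.toEuclideanLin h with hA
  set B := Matrix.toEuclideanLin C with hB
  have hAs : A.IsSymmetric := Matrix.isSymmetric_toEuclideanLin_iff.2 hh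
  have hBs : B.IsSymmetric := Matrix.isSymmetric_toEuclideanLin_iff.2 hC
  have hAB : Commute A B := by
    refine LinearMap.ext fun v => ?_
    simp [A, B, Matrix.toLpLin_apply, Matrix.mulVec_mulVec, hcomm]
  have hint := LinearMap.IsSymmetric.directSum_isInternal_of_commute hAs hBs hAB
  have hort := LinearMap.IsSymmetric.orthogonalFamily_eigenspace_inf_eigenspace hAs hBs
  set V : ℂ × ℂ → Submodule ℂ (Ket₁ n) := fun i =>
    Module.End.eigenspace A i.2 ⊓ Module.End.eigenspace B i.1
  -- Only finitely many joint eigenspaces are nonzero; discarding the others gives a finite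
  -- orthogonal decomposition to which an orthonormal basis can be subordinated.
  have hfin : {i | V i ≠ ⊥}.Finite :=
    WellFoundedGT.finite_ne_bot_of_iSupIndep hint.submodule_iSupIndep
  have : Fintype {i // V i ≠ ⊥} := hfin.fintype
  have hint' := DirectSum.isInternal_ne_bot_iff.2 hint
  have hort' := hort.comp (γ := {i // V i ≠ ⊥}) Subtype.val_injective
  have hn : Module.finrank ℂ (Ket₁ n) = n + 1 := by simp
  let b := hint'.subordinateOrthonormalBasis hn hort'
  let idx := fun a => hint'.subordinateOrthonormalBasisIndex hn a hort'
  have hb (a) : b a ∈ V (idx a) := hint'.subordinateOrthonormalBasis_subordinate hn a hort'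
  have hbA (a) : A (b a) = (idx a).1.2 • b a := Module.End.mem_eigenspace_iff.1 (hb a).1
  have hbB (a) : B (b a) = (idx a).1.1 • b a := Module.End.mem_eigenspace_iff.1 (hb a).2
  have hreal (a) : ((((idx a).1.2).re : ℝ) : ℂ) = (idx a).1.2 := by
    have : Module.End.HasEigenvalue A (idx a).1.2 := by
      refine Module.End.hasEigenvalue_of_hasEigenvector (x := b a) ⟨(hb a).1, ?_⟩
      exact b.orthonormal.ne_zero a
    exact Complex.conj_eq_iff_re.1 (hAs.conj_eigenvalue_eq_self this)
  refine ⟨b, fun a => ((idx a).1.2).re, fun a => (idx a).1.1, fun a => ?_, fun a => ?_⟩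
  · have := congrArg WithLp.ofLp (hbA a)
    rw [hreal]
    simpa [A, Matrix.toLpLin_apply] using this
  · have := congrArg WithLp.ofLp (hbB a)
    simpa [B, Matrix.toLpLin_apply] using this

/-- The common eigenbasis may be chosen to start at a given nondegenerate eigenvector. -/
theorem exists_isEigenbasis {h C : Op₁ n} (hh : h.IsHermitian) (hC : C.IsHermitian)
    (hcomm : h * C = C * h) {ψ : Ket₁ n} (hψ : ‖ψ‖ = 1) {lam₀ : ℝ}
    (hψe : h *ᵥ (ψ : Fin (n + 1) → ℂ) = (lam₀ : ℂ) • (ψ : Fin (n + 1) → ℂ))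
    (hnd : Module.finrank ℂ (Module.End.eigenspace (Matrix.toLin' h) (lam₀ : ℂ)) = 1) :
    ∃ b lam, IsEigenbasis h ψ b lam ∧ ∀ α β, α ≠ β → rep b C α β = 0 := by
  obtain ⟨b, lam, mu, hb, hbC⟩ := exists_common_eigenbasis hh hC hcomm
  have hψ0 : (ψ : Fin (n + 1) → ℂ) ≠ 0 := by
    intro h0
    have : ψ = 0 := by
      ext i
      exact congrFun h0 i
    simp [this] at hψ
  -- Some vector of the basis overlaps `ψ`. Hermiticity forces it to have the eigenvalue `lam₀`, and
  -- nondegeneracy makes it proportional to `ψ`.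
  obtain ⟨a, ha⟩ : ∃ a, star (b a : Fin (n + 1) → ℂ) ⬝ᵥ (ψ : Fin (n + 1) → ℂ) ≠ 0 := by
    by_contra! hc
    exact hψ0 (eq_zero_of_rep_eq_zero b hc)
  have hlam : lam a = lam₀ := by
    have h1 : star (h *ᵥ (b a : Fin (n + 1) → ℂ)) ⬝ᵥ (ψ : Fin (n + 1) → ℂ) =
        star (b a : Fin (n + 1) → ℂ) ⬝ᵥ (h *ᵥ (ψ : Fin (n + 1) → ℂ)) := by
      rw [Matrix.star_mulVec, hh.eq, Matrix.dotProduct_mulVec]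
    rw [hb, hψe, star_smul, smul_dotProduct, dotProduct_smul] at h1
    have h2 := mul_right_cancel₀ ha h1
    simpa using h2
  have hba := hb a
  rw [hlam] at hba
  obtain ⟨d, hd⟩ := finrank_eigenspace_eq_one_unique hnd hba hψe (basis_ne_zero a)
  -- This vector is moved to position `0` and replaced by `ψ`, which removes the phase between them.
  let e := Equiv.swap 0 a
  let v : Fin (n + 1) → Ket₁ n := fun α => if α = 0 then ψ else b (e α)
  have he (α) (hα : α ≠ 0) : e α ≠ a := by
    intro h1
    apply hα
    have : e α = e 0 := by rw [h1]; simp [e]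
    exact e.injective this
  have hψb (α) (hα : α ≠ 0) : inner ℂ ψ (b (e α)) = 0 := by
    rw [inner_eq_star_dotProduct, hd, star_smul, smul_dotProduct, star_dotProduct_basis,
      if_neg (he α hα).symm, smul_zero]
  have hv : Orthonormal ℂ v := by
    rw [orthonormal_iff_ite]
    intro α β
    by_cases hα : α = 0 <;> by_cases hβ : β = 0
    · simp [v, hα, hβ, hψ]
    · simp only [v, hα, hβ, if_true, if_false, hψb β hβ]
      rw [if_neg (fun h => hβ h.symm)]
    · simp only [v, hα, hβ, if_true, if_false]
      rw [← inner_conj_symm, hψb α hα, map_zero]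
    · simp only [v, hα, hβ, if_false]
      rw [orthonormal_iff_ite.1 b.orthonormal]
      simp
  -- The family already has `n + 1` members, so the extension with `s = univ` is the family itself,
  -- now bundled as a basis.
  obtain ⟨b', hb'⟩ := Orthonormal.exists_orthonormalBasis_extension_of_card_eq (𝕜 := ℂ)
    (E := Ket₁ n) (ι := Fin (n + 1)) (by simp) (v := v) (s := Set.univ)
    (hv.comp _ Subtype.val_injective)
  have hbv (α) : b' α = v α := hb' α trivial
  have hall (α) : ∃ (β : Fin (n + 1)) (c : ℂ),
      (b' α : Fin (n + 1) → ℂ) = c • (b β : Fin (n + 1) → ℂ) := by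
    rw [hbv]
    by_cases hα : α = 0
    · refine ⟨a, d, ?_⟩
      simp only [v, if_pos hα]
      exact hd
    · exact ⟨e α, 1, by simp only [v, if_neg hα, one_smul]⟩
  choose f c hf using hall
  refine ⟨b', fun α => lam (f α), ⟨by rw [hbv]; simp [v], fun α => ?_⟩, fun α β hαβ => ?_⟩
  · rw [hf, Matrix.mulVec_smul, hb, smul_comm]
  · rw [rep_apply_of_mulVec_eq b' (c := mu (f β)), if_neg hαβ]
    rw [hf, Matrix.mulVec_smul, hbC, smul_comm]

end

section

variable {m n : ℕ}

/-! ### The classical rate equation -/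

/-- The transition rate from `β` to `α` of the effective generator. -/
def rate {ι : Type*} [Fintype ι] (N : Matrix ι ι ℂ) (h : ι → Op₁ n) (α β : Fin (n + 1)) : ℂ :=
  ∑ j, ∑ k, N j k * (h k α β * star (h j α β))

lemma effGen_diagonal_apply {ι : Type*} [Fintype ι] (N : Matrix ι ι ℂ) (h : ι → Op₁ n)
    (c : Fin (n + 1) → ℂ) (α : Fin (n + 1)) :
    effGen N h (Matrix.diagonal c) α α =
      2 * (∑ β, rate N h α β * c β - c α * ∑ γ, rate N h γ α) := by
  have e1 : ∑ β, rate N h α β * c β =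
      ∑ j, ∑ k, N j k * ∑ β, h k α β * c β * star (h j α β) := by
    simp only [rate, Finset.sum_mul, Finset.mul_sum]
    rw [Finset.sum_comm]
    refine Finset.sum_congr rfl fun j _ => ?_
    rw [Finset.sum_comm]
    refine Finset.sum_congr rfl fun k _ => Finset.sum_congr rfl fun β _ => by ring
  have e2 : c α * ∑ γ, rate N h γ α =
      ∑ j, ∑ k, N j k * ((∑ γ, star (h j γ α) * h k γ α) * c α) := by
    simp only [rate, Finset.sum_mul, Finset.mul_sum]
    rw [Finset.sum_comm]
    refine Finset.sum_congr rfl fun j _ => ?_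
    rw [Finset.sum_comm]
    refine Finset.sum_congr rfl fun k _ => Finset.sum_congr rfl fun β _ => by ring
  rw [e1, e2, ← Finset.sum_sub_distrib, Finset.mul_sum, effGen, Matrix.sum_apply]
  refine Finset.sum_congr rfl fun j _ => ?_
  rw [← Finset.sum_sub_distrib, Finset.mul_sum, Matrix.sum_apply]
  refine Finset.sum_congr rfl fun k _ => ?_
  have f1 : (h k * Matrix.diagonal c * (h j)ᴴ) α α = ∑ β, h k α β * c β * star (h j α β) := by
    rw [Matrix.mul_apply]
    simp [Matrix.mul_diagonal]
  have f2 : ((h j)ᴴ * h k) α α = ∑ γ, star (h j γ α) * h k γ α := by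
    rw [Matrix.mul_apply]
    simp
  rw [Matrix.smul_apply, Matrix.sub_apply, Matrix.sub_apply, Matrix.smul_apply, f1,
    Matrix.mul_diagonal, Matrix.diagonal_mul, f2]
  simp only [smul_eq_mul]
  ring

/-- Row and column `0` of `N` vanish, so only the blocks `h_{k0}` with `k ≥ 1` contribute. Each rate
is a value of the quadratic form of the positive definite part of `N`. -/
lemma IsJumpInverse.rate_eq {L N : Matrix (Fin (m + 2)) (Fin (m + 2)) ℂ}
    (hN : IsJumpInverse L N) (h : Fin (m + 2) → Op₁ n) (α β : Fin (n + 1)) :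
    rate N h α β = star (fun k : Fin (m + 1) => h k.succ α β) ⬝ᵥ
      (N.submatrix Fin.succ Fin.succ *ᵥ fun k : Fin (m + 1) => h k.succ α β) := by
  have h1 (k) : N 0 k = 0 := by
    have := congrFun (congrFun hN.row_zero 0) k
    rwa [single_zero_mul_apply, if_pos rfl] at this
  have h2 (k) : N k 0 = 0 := by
    have := congrFun (congrFun hN.col_zero k) 0
    rwa [mul_single_zero_apply, if_pos rfl] at this
  simp only [rate, dotProduct, Matrix.mulVec]
  rw [Fin.sum_univ_succ]
  simp only [h1, zero_mul, Finset.sum_const_zero, zero_add]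
  refine Finset.sum_congr rfl fun j _ => ?_
  rw [Fin.sum_univ_succ, h2, zero_mul, zero_add, Finset.mul_sum]
  refine Finset.sum_congr rfl fun k _ => ?_
  simp only [Matrix.submatrix_apply, Pi.star_apply]
  ring

/-- The transition rates with equal weights. -/
def wt (h : Fin (m + 2) → Op₁ n) (α β : Fin (n + 1)) : ℝ :=
  ∑ k : Fin (m + 1), ‖h k.succ α β‖ ^ 2

lemma rate_one_sub_single (h : Fin (m + 2) → Op₁ n) (α β : Fin (n + 1)) :
    rate (1 - Matrix.single 0 0 1) h α β = wt h α β := by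
  rw [(isJumpInverse_jordan m).rate_eq]
  have : (1 - Matrix.single 0 0 1 : Matrix (Fin (m + 2)) (Fin (m + 2)) ℂ).submatrix
      Fin.succ Fin.succ = 1 := by
    ext i j
    simp [Matrix.one_apply, (Fin.succ_ne_zero i).symm]
  rw [this, Matrix.one_mulVec, wt, dotProduct]
  push_cast
  refine Finset.sum_congr rfl fun k _ => ?_
  rw [Pi.star_apply, ← Complex.conj_mul']
  rfl

lemma matK_apply (H : Op m n) (b : OrthonormalBasis (Fin (n + 1)) ℂ (Ket₁ n)) (α β : Fin n) :
    matK H b α β = wt (fun k => rep b (block H k 0)) α.succ β.succ -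
      if α = β then ∑ γ, wt (fun k => rep b (block H k 0)) γ α.succ else 0 := by
  have h1 (k : Fin (m + 1)) :
      (rep b ((block H k.succ 0)ᴴ * block H k.succ 0) α.succ α.succ).re =
        ∑ γ, ‖rep b (block H k.succ 0) γ α.succ‖ ^ 2 := by
    rw [rep_mul, rep_conjTranspose, Matrix.mul_apply, Complex.re_sum]
    refine Finset.sum_congr rfl fun γ _ => ?_
    rw [Matrix.conjTranspose_apply, Complex.star_def, Complex.conj_mul']
    norm_cast
  simp only [matK, Matrix.of_apply, braket_eq_rep, h1, Finset.sum_sub_distrib, wt]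
  congr 1
  split_ifs
  · rw [Finset.sum_comm]
  · simp

/-- A classical rate equation whose only absorbing state is `0`, as expressed by invertibility of
the reduced rate matrix, has no other stationary distribution. The weights of the transitions are
irrelevant. -/
lemma stationary_eq_zero {w w' : Fin (n + 1) → Fin (n + 1) → ℝ} (hw : ∀ α β, 0 ≤ w α β)
    (hww' : ∀ α β, w α β = 0 → w' α β = 0) {c : Fin (n + 1) → ℝ} (hc : ∀ α, 0 ≤ c α)
    (hst : ∀ α, ∑ β, w α β * c β = c α * ∑ γ, w γ α) (habs : ∀ α : Fin n, w α.succ 0 = 0)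
    (hK : IsUnit (Matrix.of fun α β : Fin n => w' α.succ β.succ -
      if α = β then ∑ γ, w' γ α.succ else 0).det) (α : Fin n) : c α.succ = 0 := by
  by_contra hα
  set K : Matrix (Fin n) (Fin n) ℝ := Matrix.of fun α β : Fin n => w' α.succ β.succ -
      if α = β then ∑ γ, w' γ α.succ else 0 with hKdef
  have hnn (α β) : 0 ≤ w α β * c β := mul_nonneg (hw α β) (hc β)
  -- Nothing leaves the absorbing state `0`, so in its balance equation the term `w 0 0` cancels and
  -- the total inflow from the other states must be zero.
  have hw0 (β : Fin n) (hβ : c β.succ ≠ 0) : w 0 β.succ = 0 := by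
    have h := hst 0
    rw [Fin.sum_univ_succ, Fin.sum_univ_succ (fun γ => w γ 0)] at h
    simp only [habs, Finset.sum_const_zero, add_zero] at h
    have h1 : ∑ β : Fin n, w 0 β.succ * c β.succ = 0 := by linarith
    have h2 := (Finset.sum_eq_zero_iff_of_nonneg fun β _ => hnn 0 (Fin.succ β)).1 h1 β
      (Finset.mem_univ _)
    exact (mul_eq_zero.1 h2).resolve_right hβ
  -- An unoccupied state has no outflow, hence receives nothing from occupied ones.
  have hws (γ β : Fin n) (hγ : c γ.succ = 0) (hβ : c β.succ ≠ 0) : w γ.succ β.succ = 0 := by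
    have h := hst γ.succ
    rw [hγ, zero_mul] at h
    have h2 := (Finset.sum_eq_zero_iff_of_nonneg fun β _ => hnn γ.succ β).1 h β.succ
      (Finset.mem_univ _)
    exact (mul_eq_zero.1 h2).resolve_right hβ
  let T := {β : Fin n // c β.succ ≠ 0}
  let KT : Matrix T T ℝ := K.submatrix Subtype.val Subtype.val
  have hsumT (f : Fin n → ℝ) (hf : ∀ γ : Fin n, c γ.succ = 0 → f γ = 0) :
      ∑ γ : Fin n, f γ = ∑ γ : T, f γ.1 := by
    have h1 : ∑ γ : Fin n, f γ = ∑ γ with c (Fin.succ γ) ≠ 0, f γ := by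
      symm
      refine Finset.sum_subset (Finset.filter_subset _ _) fun γ _ hγ => hf γ ?_
      simpa using hγ
    rw [h1]
    exact Finset.sum_subtype (p := fun γ : Fin n => c γ.succ ≠ 0) _ (by simp) f
  -- Transitions out of an occupied state `β ≥ 1` therefore end in occupied states `≥ 1`. Restricted
  -- to these, the column sums of `K` are gain minus total loss, which is zero.
  have hleft : (fun _ => 1 : T → ℝ) ᵥ* KT = 0 := by
    ext β
    have h1 : ∑ γ : Fin n, w' γ.succ β.1.succ = ∑ γ : T, w' γ.1.succ β.1.succ :=
      hsumT _ fun γ hγ => hww' _ _ (hws γ β.1 hγ β.2)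
    have h2 : ∑ γ : T, (if γ.1 = β.1 then ∑ δ, w' δ γ.1.succ else 0) = ∑ δ, w' δ β.1.succ := by
      rw [Finset.sum_eq_single β]
      · simp
      · intro γ _ hγ
        rw [if_neg fun h => hγ (Subtype.ext h)]
      · simp
    simp only [Matrix.vecMul, dotProduct, one_mul, KT, Matrix.submatrix_apply, hKdef,
      Matrix.of_apply, Finset.sum_sub_distrib, Pi.zero_apply]
    rw [h2, Fin.sum_univ_succ, hww' _ _ (hw0 β.1 β.2), zero_add, h1, sub_self]
  have hne : (fun _ => 1 : T → ℝ) ≠ 0 := fun h => by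
    have := congrFun h ⟨α, hα⟩
    simp at this
  obtain ⟨v, hv0, hv⟩ := Matrix.exists_mulVec_eq_zero_iff.2
    (Matrix.exists_vecMul_eq_zero_iff.1 ⟨_, hne, hleft⟩)
  -- A null vector of the restricted matrix extends by zero to one of `K`, since entries of `K` from
  -- occupied to unoccupied states vanish.
  let u : Fin n → ℝ := fun β => if h : c β.succ ≠ 0 then v ⟨β, h⟩ else 0
  have huT (β : T) : u β.1 = v β := by
    simp only [u]
    rw [dif_pos β.2]
  have hu0 : u ≠ 0 := by
    intro h
    apply hv0
    ext β
    rw [← huT, h]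
    rfl
  have hKu : K *ᵥ u = 0 := by
    ext γ
    have h1 : (K *ᵥ u) γ = ∑ β : T, K γ β.1 * v β := by
      rw [Matrix.mulVec, dotProduct, hsumT]
      · simp only [huT]
      · intro β hβ
        simp [u, hβ]
    rw [h1]
    by_cases hγ : c γ.succ = 0
    · refine Finset.sum_eq_zero fun β _ => ?_
      have hγβ : γ ≠ β.1 := fun h => β.2 (h ▸ hγ)
      simp [hKdef, hγβ, hww' _ _ (hws γ β.1 hγ β.2)]
    · exact congrFun hv ⟨γ, hγ⟩
  exact hK.ne_zero (Matrix.exists_mulVec_eq_zero_iff.1 ⟨u, hu0, hKu⟩)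

/-! ### Consequences of the targeting condition -/

lemma block_mulVec_target {H : Op m n} {ψ : Ket₁ n} {lam₀ : ℝ} {κ : ℂ}
    (hcond : H *ᵥ ket 0 ψ = (lam₀ : ℂ) • ket 0 ψ + κ • ket 1 ψ) (k : Fin (m + 2)) :
    block H k 0 *ᵥ (ψ : Fin (n + 1) → ℂ) =
      ((if k = 0 then (lam₀ : ℂ) else 0) + if k = 1 then κ else 0) •
        (ψ : Fin (n + 1) → ℂ) := by
  ext a
  have h := congrFun hcond (k, a)
  have e : (H *ᵥ ket 0 ψ) (k, a) = (block H k 0 *ᵥ (ψ : Fin (n + 1) → ℂ)) a := by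
    simp only [Matrix.mulVec, dotProduct, Fintype.sum_prod_type, ket, block, Matrix.of_apply]
    rw [Finset.sum_eq_single 0]
    · simp
    · intro j _ hj
      simp [hj]
    · simp
  rw [← e, h]
  simp only [Pi.add_apply, Pi.smul_apply, ket, smul_eq_mul]
  split_ifs <;> ring

/-- This is the absorbing property of the target state: no `h_{k0}` leads out of `ψ`. -/
lemma rep_block_target {H : Op m n} {ψ : Ket₁ n} {lam₀ : ℝ} {κ : ℂ}
    (hcond : H *ᵥ ket 0 ψ = (lam₀ : ℂ) • ket 0 ψ + κ • ket 1 ψ)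
    {b : OrthonormalBasis (Fin (n + 1)) ℂ (Ket₁ n)} (hb : b 0 = ψ) (k : Fin (m + 2))
    {α : Fin (n + 1)} (hα : α ≠ 0) : rep b (block H k 0) α 0 = 0 := by
  have h := block_mulVec_target hcond k
  rw [← hb] at h
  rw [rep_apply_of_mulVec_eq b h, if_neg hα]

lemma isHermitian_block {H : Op m n} (hH : H.IsHermitian) : (block H 0 0).IsHermitian := by
  rw [Matrix.IsHermitian, ← block_conjTranspose, hH.eq]

/-- Between vectors of equal `h₀₀`-eigenvalue the commutator with `h₀₀` has no matrix element, so
the effective generator alone remains. -/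
lemma tendsto_rep_slow_drift {H : Op m n} (hH : H.IsHermitian)
    {L N : Matrix (Fin (m + 2)) (Fin (m + 2)) ℂ} (hL : HasPureKernel L) (hN : IsJumpInverse L N)
    {l : Filter ℝ} [l.NeBot] (hl : l ≤ atTop) {x : ℝ → Op m n} {x₀ : Op m n}
    (hx : Tendsto x l (𝓝 x₀))
    (hp : Tendsto (fun Γ => lindbladian H L Γ (x Γ)) l (𝓝 0))
    {ψ : Ket₁ n} {b : OrthonormalBasis (Fin (n + 1)) ℂ (Ket₁ n)} {lam : Fin (n + 1) → ℝ}
    (hb : IsEigenbasis (block H 0 0) ψ b lam) {α β : Fin (n + 1)} (hαβ : lam α = lam β) :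
    Tendsto (fun Γ : ℝ => (Γ : ℂ) * rep b (reduced (lindbladian H L Γ (x Γ))) α β) l
      (𝓝 (2 * effGen N (fun k => rep b (block H k 0)) (rep b (reduced x₀)) α β)) := by
  have h := (tendsto_slow_drift hH hL hN hl hx hp).2.2
  have hcont : Continuous fun A : Op₁ n => rep b A α β :=
    (continuous_apply_apply α β).comp (continuous_rep b)
  have h2 := (hcont.tendsto _).comp h
  rw [rep_smul, rep_effGen] at h2
  refine h2.congr fun Γ => ?_
  simp only [Function.comp_apply]
  rw [rep_smul, rep_add, rep_smul, rep_sub, rep_mul, rep_mul, hb.rep_eq]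
  simp only [Matrix.smul_apply, Matrix.add_apply, Matrix.sub_apply, Matrix.diagonal_mul,
    Matrix.mul_diagonal, hαβ, smul_eq_mul]
  ring

/-! ### Convergence to the target -/

/-- Matrices with bounded entries form a compact set. -/
lemma isCompact_entries_le (r : ℝ) : IsCompact {X : Op m n | ∀ i j, ‖X i j‖ ≤ r} := by
  have h : {X : Op m n | ∀ i j, ‖X i j‖ ≤ r} =
      Set.univ.pi fun _ => Set.univ.pi fun _ => Metric.closedBall (0 : ℂ) r := by
    ext X
    exact ⟨fun h i _ j _ => mem_closedBall_zero_iff.2 (h i j),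
      fun h i j => mem_closedBall_zero_iff.1 (h i trivial j trivial)⟩
  rw [h]
  exact isCompact_univ_pi fun _ => isCompact_univ_pi fun _ => isCompact_closedBall 0 r

-- With `ρ = B†B`, the diagonal entries are squared column norms of `B` that sum to one, and the
-- off-diagonal ones are controlled by the inequality `xy ≤ (x² + y²)/2`.
open scoped MatrixOrder Matrix.Norms.L2Operator in
lemma norm_apply_le_one_of_posSemidef {ι : Type*} [Fintype ι] {ρ : Matrix ι ι ℂ}
    (h : ρ.PosSemidef) (htr : ρ.trace = 1) (i j : ι) : ‖ρ i j‖ ≤ 1 := by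
  classical
  obtain ⟨B, hB⟩ := CStarAlgebra.nonneg_iff_eq_star_mul_self.1 h.nonneg
  rw [Matrix.star_eq_conjTranspose] at hB
  subst hB
  have hd (i : ι) : (Bᴴ * B) i i = ((∑ k, ‖B k i‖ ^ 2 : ℝ) : ℂ) := by
    rw [Matrix.mul_apply]
    push_cast
    refine Finset.sum_congr rfl fun k _ => ?_
    rw [Matrix.conjTranspose_apply, Complex.star_def, Complex.conj_mul']
  have ht : ∑ i, ∑ k, ‖B k i‖ ^ 2 = 1 := by
    rw [Matrix.trace] at htr
    simp only [Matrix.diag, hd] at htr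
    exact_mod_cast htr
  have hle (i : ι) : ∑ k, ‖B k i‖ ^ 2 ≤ 1 := by
    rw [← ht]
    exact Finset.single_le_sum (f := fun i => ∑ k, ‖B k i‖ ^ 2)
      (fun i _ => Finset.sum_nonneg fun k _ => sq_nonneg _) (Finset.mem_univ i)
  calc ‖(Bᴴ * B) i j‖ ≤ ∑ k, ‖B k i‖ * ‖B k j‖ := by
        rw [Matrix.mul_apply]
        refine (norm_sum_le _ _).trans (le_of_eq ?_)
        simp
    _ ≤ ∑ k, (‖B k i‖ ^ 2 + ‖B k j‖ ^ 2) / 2 := by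
        refine Finset.sum_le_sum fun k _ => ?_
        nlinarith [sq_nonneg (‖B k i‖ - ‖B k j‖)]
    _ = (∑ k, ‖B k i‖ ^ 2 + ∑ k, ‖B k j‖ ^ 2) / 2 := by
        rw [← Finset.sum_div, Finset.sum_add_distrib]
    _ ≤ 1 := by linarith [hle i, hle j]

lemma emb_proj {ψ : Ket₁ n} :
    emb m (proj ψ) = Matrix.vecMulVec (ket 0 ψ) (star (ket 0 ψ)) := by
  ext ⟨i, a⟩ ⟨j, b⟩
  by_cases hi : i = 0 <;> by_cases hj : j = 0 <;>
    simp [emb, proj, Matrix.vecMulVec_apply, ket, single_zero_apply, hi, hj]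

lemma rep_proj_zero (b : OrthonormalBasis (Fin (n + 1)) ℂ (Ket₁ n)) (α β : Fin (n + 1)) :
    rep b (proj (b 0)) α β = if α = 0 ∧ β = 0 then 1 else 0 := by
  rw [rep_apply, proj, Matrix.vecMulVec_mulVec, star_dotProduct_basis]
  by_cases hα : α = 0 <;> by_cases hβ : β = 0 <;>
    simp [star_dotProduct_basis, hα, hβ, eq_comm]

theorem tendsto_target {H : Op m n} (hH : H.IsHermitian)
    {L : Matrix (Fin (m + 2)) (Fin (m + 2)) ℂ} (hL : HasPureKernel L) {ρ : ℝ → Op m n}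
    (hρ : ∀ Γ : ℝ, 0 < Γ → IsNESS H L Γ (ρ Γ)) {ψ : Ket₁ n} (hψ : ‖ψ‖ = 1) {lam₀ : ℝ} {κ : ℂ}
    (hcond : H *ᵥ ket 0 ψ = (lam₀ : ℂ) • ket 0 ψ + κ • ket 1 ψ)
    (hnd : Module.finrank ℂ (Module.End.eigenspace
      (Matrix.toLin' (block H 0 0)) (lam₀ : ℂ)) = 1)
    (hK : ∀ b lam, IsEigenbasis (block H 0 0) ψ b lam → IsUnit (matK H b).det) :
    Tendsto ρ atTop (𝓝 (Matrix.vecMulVec (ket 0 ψ) (star (ket 0 ψ)))) := by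
  obtain ⟨N, hN, hNpd⟩ := hL.exists_jumpInverse
  have hψe : block H 0 0 *ᵥ (ψ : Fin (n + 1) → ℂ) = (lam₀ : ℂ) • (ψ : Fin (n + 1) → ℂ) := by
    simpa using block_mulVec_target hcond 0
  have hpos : ∀ᶠ Γ : ℝ in atTop, 0 < Γ := eventually_gt_atTop 0
  -- Cluster points are tested along ultrafilters, on which the steady states converge, so that the
  -- slow drift applies.
  refine (isCompact_entries_le 1).tendsto_nhds_of_unique_mapClusterPt ?_ fun x₀ _ hx₀ => ?_
  · filter_upwards [hpos] with Γ hΓ i j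
    exact norm_apply_le_one_of_posSemidef (hρ Γ hΓ).1 (hρ Γ hΓ).2.1 i j
  obtain ⟨l, hl, hx⟩ := mapClusterPt_iff_ultrafilter.1 hx₀
  have hposl : ∀ᶠ Γ : ℝ in (l : Filter ℝ), 0 < Γ := hl hpos
  have hlind : (fun Γ => lindbladian H L Γ (ρ Γ)) =ᶠ[(l : Filter ℝ)] fun _ => 0 := by
    filter_upwards [hposl] with Γ hΓ
    exact (hρ Γ hΓ).2.2
  have hp : Tendsto (fun Γ => lindbladian H L Γ (ρ Γ)) l (𝓝 0) :=
    tendsto_const_nhds.congr' hlind.symm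
  obtain ⟨hemb, hcomm, -⟩ := tendsto_slow_drift hH hL hN hl hx hp
  have hpsd : x₀.PosSemidef := by
    have hclosed : IsClosed {X : Op m n | X.PosSemidef} := by
      simp only [Matrix.posSemidef_iff_dotProduct_mulVec, Set.ofPred_and]
      refine IsClosed.inter ?_ ?_
      · exact isClosed_eq (by fun_prop) (by fun_prop)
      · simp only [Set.ofPred_forall]
        exact isClosed_iInter fun v => isClosed_le continuous_const (by fun_prop)
    refine hclosed.mem_of_tendsto hx ?_
    filter_upwards [hposl] with Γ hΓ
    exact (hρ Γ hΓ).1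
  have htr : x₀.trace = 1 := by
    have hcont : Continuous fun X : Op m n => X.trace := by fun_prop
    refine tendsto_nhds_unique ((hcont.tendsto _).comp hx) (tendsto_const_nhds.congr' ?_)
    filter_upwards [hposl] with Γ hΓ
    exact (hρ Γ hΓ).2.1.symm
  set C := reduced x₀ with hCdef
  have hCpsd : C.PosSemidef := by
    have : C = x₀.submatrix (fun a => (0, a)) (fun a => (0, a)) := by
      rw [hemb]
      ext a b
      simp [emb]
    rw [this]
    exact hpsd.submatrix _
  obtain ⟨b, lam, hb, hdiag⟩ :=
    exists_isEigenbasis (isHermitian_block hH) hCpsd.isHermitian hcomm hψ hψe hnd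
  have hrepC : (rep b C).PosSemidef := hCpsd.conjTranspose_mul_mul_same (basisMat b)
  let c : Fin (n + 1) → ℝ := fun α => (rep b C α α).re
  have hc0 (α) : 0 ≤ rep b C α α := hrepC.diag_nonneg
  have hcC (α) : rep b C α α = c α := by
    have := (Complex.le_def.1 (hc0 α)).2
    exact Complex.ext rfl this.symm
  have hcd : rep b C = Matrix.diagonal fun α => (c α : ℂ) := by
    ext α β
    rw [Matrix.diagonal_apply]
    split_ifs with h
    · rw [← h, hcC]
    · exact hdiag α β h
  have heff (α) : effGen N (fun k => rep b (block H k 0)) (rep b C) α α = 0 := by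
    have h1 := tendsto_rep_slow_drift hH hL hN hl hx hp hb (rfl : lam α = lam α)
    have h2 : Tendsto (fun Γ : ℝ => (Γ : ℂ) * rep b (reduced (lindbladian H L Γ (ρ Γ))) α α) l
        (𝓝 0) := by
      refine tendsto_const_nhds.congr' ?_
      filter_upwards [hlind] with Γ hΓ
      rw [hΓ, reduced_zero, rep_zero]
      simp
    simpa using tendsto_nhds_unique h1 h2
  let w : Fin (n + 1) → Fin (n + 1) → ℝ :=
    fun α β => (rate N (fun k => rep b (block H k 0)) α β).re
  have hw0 (α β) : 0 ≤ rate N (fun k => rep b (block H k 0)) α β := by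
    rw [hN.rate_eq]
    exact hNpd.posSemidef.dotProduct_mulVec_nonneg _
  have hwC (α β) : rate N (fun k => rep b (block H k 0)) α β = w α β := by
    have := (Complex.le_def.1 (hw0 α β)).2
    exact Complex.ext rfl this.symm
  have hst (α) : ∑ β, w α β * c β = c α * ∑ γ, w γ α := by
    have h := heff α
    rw [hcd, effGen_diagonal_apply] at h
    simp only [hwC] at h
    have h2 := (mul_eq_zero.1 h).resolve_left two_ne_zero
    rw [sub_eq_zero] at h2
    exact_mod_cast h2
  have hcz (α : Fin n) : c α.succ = 0 := by
    -- The true rates `w` depend on `N`, while `K` uses equal weights. Definiteness of `N` shows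
    -- that the former vanish only where the latter do.
    refine stationary_eq_zero (w := w) (w' := wt fun k => rep b (block H k 0))
      (fun α β => ?_) (fun α β h => ?_) (fun α => ?_) hst (fun α => ?_) ?_ α
    · exact (Complex.le_def.1 (hw0 α β)).1
    · have h1 : rate N (fun k => rep b (block H k 0)) α β = 0 := by rw [hwC, h]; rfl
      rw [hN.rate_eq] at h1
      have h2 : (fun k : Fin (m + 1) => rep b (block H k.succ 0) α β) = 0 := by
        by_contra hne
        exact (hNpd.dotProduct_mulVec_pos hne).ne' h1
      simp only [wt]
      refine Finset.sum_eq_zero fun k _ => ?_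
      have h3 : rep b (block H k.succ 0) α β = 0 := congrFun h2 k
      rw [h3]
      simp
    · exact (Complex.le_def.1 (hc0 α)).1
    · simp only [w, hN.rate_eq, rep_block_target hcond hb.1 _ (Fin.succ_ne_zero α)]
      have : (fun _ : Fin (m + 1) => (0 : ℂ)) = 0 := rfl
      rw [this]
      simp
    · have : (Matrix.of fun α β : Fin n => wt (fun k => rep b (block H k 0)) α.succ β.succ -
          if α = β then ∑ γ, wt (fun k => rep b (block H k 0)) γ α.succ else 0) = matK H b := by
        ext α β
        rw [matK_apply, Matrix.of_apply]
      rw [this]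
      exact hK b lam hb
  have hc1 : c 0 = 1 := by
    have h := trace_rep b C
    rw [hCdef, trace_reduced, htr, ← hCdef, hcd, Matrix.trace_diagonal, Fin.sum_univ_succ] at h
    simp only [hcz] at h
    simpa using h
  have hC : C = proj ψ := by
    apply rep_injective b
    rw [← hb.1, hcd]
    ext α β
    rw [rep_proj_zero, Matrix.diagonal_apply]
    induction α using Fin.cases with
    | zero => simp [hc1, eq_comm]
    | succ α => simp [hcz]
  rw [hemb, hC, emb_proj]

end

section

variable {m n : ℕ}

/-! ### The approximate pure steady state for the Jordan block -/

/-- Vectors of `H₀ ⊗ H₁`. -/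
abbrev Vec (m n : ℕ) := Fin (m + 2) × Fin (n + 1) → ℂ

/-- The component of `X` along `e^k`. -/
def comp (X : Vec m n) (k : Fin (m + 2)) : Fin (n + 1) → ℂ := fun a => X (k, a)

/-- The vector `e⁰ ⊗ v`. -/
def inj (m : ℕ) (v : Fin (n + 1) → ℂ) : Vec m n := fun p => if p.1 = 0 then v p.2 else 0

/-- The result of applying the non-Hermitian part of the generator, in the gauge `(c, lam)`. -/
def drift (H J : Op m n) (Γ : ℝ) (c : ℂ) (lam : ℝ) (Φ : Vec m n) : Vec m n :=
  -Complex.I • (H *ᵥ Φ - (lam : ℂ) • Φ) - ((Γ : ℂ) / 2) • ((Jᴴ * J) *ᵥ Φ) +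
    ((Γ : ℂ) * star c) • (J *ᵥ Φ) - ((Γ : ℂ) * (c * star c) / 2) • Φ

/-- The Lindblad form is unchanged when the jump operator is shifted by a scalar `c` and the
Hamiltonian is corrected accordingly; the real shift `lam` drops out of the commutator. A suitable
`c` makes the jump residual `LΦ - cΦ` small, so that a pure state can be nearly stationary. -/
lemma lindbladian_vecMulVec {H : Op m n} (hH : H.IsHermitian)
    (L : Matrix (Fin (m + 2)) (Fin (m + 2)) ℂ) (Γ : ℝ) (c : ℂ) (lam : ℝ) (Φ : Vec m n) :
    lindbladian H L Γ (Matrix.vecMulVec Φ (star Φ)) =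
      Matrix.vecMulVec (drift H (amp n L) Γ c lam Φ) (star Φ) +
      Matrix.vecMulVec Φ (star (drift H (amp n L) Γ c lam Φ)) +
      (Γ : ℂ) • Matrix.vecMulVec (amp n L *ᵥ Φ - c • Φ) (star (amp n L *ᵥ Φ - c • Φ)) := by
  have e1 : Matrix.vecMulVec Φ (star Φ) * H = Matrix.vecMulVec Φ (star (H *ᵥ Φ)) := by
    rw [Matrix.vecMulVec_mul, Matrix.star_mulVec, hH.eq]
  have e2 : Matrix.vecMulVec Φ (star Φ) * ((amp n L)ᴴ * amp n L) =
      Matrix.vecMulVec Φ (star (((amp n L)ᴴ * amp n L) *ᵥ Φ)) := by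
    rw [Matrix.vecMulVec_mul, Matrix.star_mulVec, Matrix.conjTranspose_mul,
      Matrix.conjTranspose_conjTranspose]
  have e3 : amp n L * Matrix.vecMulVec Φ (star Φ) * (amp n L)ᴴ =
      Matrix.vecMulVec (amp n L *ᵥ Φ) (star (amp n L *ᵥ Φ)) := by
    rw [Matrix.mul_vecMulVec, Matrix.vecMulVec_mul, Matrix.star_mulVec]
  have e4 : dissipator (L ⊗ₖ (1 : Op₁ n)) (Matrix.vecMulVec Φ (star Φ)) =
      Matrix.vecMulVec (amp n L *ᵥ Φ) (star (amp n L *ᵥ Φ)) -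
      (1 / 2 : ℂ) • (Matrix.vecMulVec (((amp n L)ᴴ * amp n L) *ᵥ Φ) (star Φ) +
        Matrix.vecMulVec Φ (star (((amp n L)ᴴ * amp n L) *ᵥ Φ))) := by
    rw [← e3, ← e2, ← Matrix.mul_vecMulVec]
    rfl
  rw [lindbladian, e4, e1, Matrix.mul_vecMulVec, drift]
  ext p q
  simp only [Matrix.add_apply, Matrix.sub_apply, Matrix.smul_apply, Matrix.vecMulVec_apply,
    Pi.star_apply, Pi.add_apply, Pi.sub_apply, Pi.smul_apply, smul_eq_mul, star_add, star_sub,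
    star_mul', star_neg, star_div₀, Complex.star_def, Complex.conj_I,
    Complex.conj_ofReal, map_ofNat, Complex.conj_conj]
  ring

lemma comp_add (X Y : Vec m n) (k : Fin (m + 2)) : comp (X + Y) k = comp X k + comp Y k := rfl

lemma comp_sub (X Y : Vec m n) (k : Fin (m + 2)) : comp (X - Y) k = comp X k - comp Y k := rfl

lemma comp_smul (c : ℂ) (X : Vec m n) (k : Fin (m + 2)) : comp (c • X) k = c • comp X k := rfl

lemma comp_inj (v : Fin (n + 1) → ℂ) (k : Fin (m + 2)) :
    comp (inj m v) k = if k = 0 then v else 0 := by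
  ext a
  simp only [comp, inj]
  split_ifs <;> rfl

lemma comp_ket (φ : Ket₁ n) (j k : Fin (m + 2)) :
    comp (ket j φ) k = if k = j then (φ : Fin (n + 1) → ℂ) else 0 := by
  ext a
  simp only [comp, ket]
  split_ifs <;> rfl

lemma ext_comp {X Y : Vec m n} (h : ∀ k, comp X k = comp Y k) : X = Y := by
  ext ⟨k, a⟩
  exact congrFun (h k) a

lemma comp_mulVec (X : Op m n) (Y : Vec m n) (k : Fin (m + 2)) :
    comp (X *ᵥ Y) k = ∑ j, block X k j *ᵥ comp Y j := by
  ext a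
  simp [comp, block, Matrix.mulVec, dotProduct, Fintype.sum_prod_type, Finset.sum_apply]

lemma comp_amp_mulVec (A : Matrix (Fin (m + 2)) (Fin (m + 2)) ℂ) (Y : Vec m n)
    (k : Fin (m + 2)) : comp (amp n A *ᵥ Y) k = ∑ j, A k j • comp Y j := by
  simp [comp_mulVec, block_amp, Matrix.smul_mulVec]

lemma comp_mulVec_inj (X : Op m n) (v : Fin (n + 1) → ℂ) (k : Fin (m + 2)) :
    comp (X *ᵥ inj m v) k = block X k 0 *ᵥ v := by
  rw [comp_mulVec, Finset.sum_eq_single 0]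
  · simp [comp_inj]
  · intro j _ hj
    simp [comp_inj, hj]
  · simp

lemma comp_mulVec_ket (X : Op m n) (φ : Ket₁ n) (j k : Fin (m + 2)) :
    comp (X *ᵥ ket j φ) k = block X k j *ᵥ (φ : Fin (n + 1) → ℂ) := by
  rw [comp_mulVec, Finset.sum_eq_single j]
  · simp [comp_ket]
  · intro i _ hi
    simp [comp_ket, hi]
  · simp

lemma dotProduct_eq_sum_comp (X Y : Vec m n) :
    star X ⬝ᵥ Y = ∑ k, star (comp X k) ⬝ᵥ comp Y k := by
  simp [dotProduct, Fintype.sum_prod_type, comp]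

lemma star_inj_dotProduct (v : Fin (n + 1) → ℂ) (Y : Vec m n) :
    star (inj m v) ⬝ᵥ Y = star v ⬝ᵥ comp Y 0 := by
  rw [dotProduct_eq_sum_comp, Finset.sum_eq_single 0]
  · simp [comp_inj]
  · intro k _ hk
    simp [comp_inj, hk]
  · simp

lemma star_ket_dotProduct (j : Fin (m + 2)) (φ : Ket₁ n) (Y : Vec m n) :
    star (ket j φ) ⬝ᵥ Y = star (φ : Fin (n + 1) → ℂ) ⬝ᵥ comp Y j := by
  rw [dotProduct_eq_sum_comp, Finset.sum_eq_single j]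
  · simp [comp_ket]
  · intro k _ hk
    simp [comp_ket, hk]
  · simp

/-- The shift `J ⊗ 1` on `H₀ ⊗ H₁`. -/
abbrev shift (m n : ℕ) : Op m n := amp n (jordan m)

lemma comp_shift_castSucc (X : Vec m n) (i : Fin (m + 1)) :
    comp (shift m n *ᵥ X) i.castSucc = comp X i.succ := by
  rw [comp_amp_mulVec, Finset.sum_eq_single i.succ]
  · simp [jordan]
  · intro j _ hj
    have : ¬ ((i : ℕ) + 1 = j) := fun h => hj (Fin.ext (by simp [← h]))
    simp [jordan, this]
  · simp

lemma comp_shift_last (X : Vec m n) : comp (shift m n *ᵥ X) (Fin.last _) = 0 := by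
  rw [comp_amp_mulVec]
  refine Finset.sum_eq_zero fun j _ => ?_
  have : ¬ (m + 1 + 1 = (j : ℕ)) := fun h => by have := j.2; omega
  simp [jordan, this]

lemma gram_shift_mulVec (X : Vec m n) :
    ((shift m n)ᴴ * shift m n) *ᵥ X = X - inj m (comp X 0) := by
  rw [amp_conjTranspose, ← amp_mul, jordan_conjTranspose_mul_self, amp_sub, amp_one,
    Matrix.sub_mulVec, Matrix.one_mulVec]
  congr 1
  refine ext_comp fun k => ?_
  rw [comp_amp_mulVec, comp_inj, Finset.sum_eq_single 0]
  · simp [single_zero_apply]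
  · intro j _ hj
    simp [single_zero_apply, hj]
  · simp

lemma shift_mulVec_inj (v : Fin (n + 1) → ℂ) : shift m n *ᵥ inj m v = 0 := by
  refine ext_comp fun k => ?_
  induction k using Fin.lastCases with
  | last => rw [comp_shift_last]; rfl
  | cast i =>
    rw [comp_shift_castSucc, comp_inj, if_neg (Fin.succ_ne_zero i)]
    rfl

lemma shift_gram_mulVec (X : Vec m n) :
    shift m n *ᵥ (((shift m n)ᴴ * shift m n) *ᵥ X) = shift m n *ᵥ X := by
  rw [gram_shift_mulVec, Matrix.mulVec_sub, shift_mulVec_inj, sub_zero]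

lemma shift_mulVec_ket_zero (ψ : Ket₁ n) : shift m n *ᵥ ket 0 ψ = 0 :=
  shift_mulVec_inj _

lemma shift_mulVec_ket_one (ψ : Ket₁ n) : shift m n *ᵥ ket 1 ψ = ket 0 ψ := by
  refine ext_comp fun k => ?_
  induction k using Fin.lastCases with
  | last =>
    rw [comp_shift_last, comp_ket, if_neg]
    exact Fin.last_pos.ne'
  | cast i =>
    have : i.succ = (1 : Fin (m + 2)) ↔ i.castSucc = 0 := by
      rw [← Fin.succ_zero_eq_one, Fin.succ_inj, Fin.castSucc_eq_zero_iff]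
    simp only [comp_shift_castSucc, comp_ket, this]

lemma star_dotProduct_mulVec {ι : Type*} [Fintype ι] (A : Matrix ι ι ℂ) (X Y : ι → ℂ) :
    star X ⬝ᵥ (A *ᵥ Y) = star (Aᴴ *ᵥ X) ⬝ᵥ Y := by
  rw [Matrix.star_mulVec, Matrix.conjTranspose_conjTranspose, Matrix.dotProduct_mulVec]

lemma star_dotProduct_comm {ι : Type*} [Fintype ι] (X Y : ι → ℂ) :
    star (star X ⬝ᵥ Y) = star Y ⬝ᵥ X := by
  rw [Matrix.star_dotProduct, star_star]

/-- The equation `(h - lam₀) a = v` is solvable when `v` is orthogonal to the nondegenerate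
eigenvector. -/
lemma exists_resolvent {h : Op₁ n} (hh : h.IsHermitian) {ψ : Fin (n + 1) → ℂ}
    (hψ : star ψ ⬝ᵥ ψ = 1) {lam₀ : ℝ} (hψe : h *ᵥ ψ = (lam₀ : ℂ) • ψ)
    (hnd : Module.finrank ℂ (Module.End.eigenspace (Matrix.toLin' h) (lam₀ : ℂ)) = 1)
    {v : Fin (n + 1) → ℂ} (hv : star ψ ⬝ᵥ v = 0) :
    ∃ a, h *ᵥ a - (lam₀ : ℂ) • a = v ∧ star ψ ⬝ᵥ a = 0 := by
  let T : (Fin (n + 1) → ℂ) →ₗ[ℂ] (Fin (n + 1) → ℂ) :=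
    { toFun := fun a => h *ᵥ a - (lam₀ : ℂ) • a + (star ψ ⬝ᵥ a) • ψ
      map_add' := fun a a' => by
        simp only [Matrix.mulVec_add, smul_add, dotProduct_add, add_smul]
        abel
      map_smul' := fun c a => by
        simp only [Matrix.mulVec_smul, dotProduct_smul, RingHom.id_apply, smul_eq_mul]
        module }
  have hT (a) : T a = h *ᵥ a - (lam₀ : ℂ) • a + (star ψ ⬝ᵥ a) • ψ := rfl
  have horth (a) : star ψ ⬝ᵥ T a = star ψ ⬝ᵥ a := by
    rw [hT, dotProduct_add, dotProduct_sub, dotProduct_smul, dotProduct_smul, hψ,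
      star_dotProduct_mulVec, hh.eq, hψe, star_smul, smul_dotProduct]
    simp
  have hinj : Function.Injective T := by
    rw [← LinearMap.ker_eq_bot, LinearMap.ker_eq_bot']
    intro a ha
    have h0 := horth a
    rw [ha, dotProduct_zero] at h0
    rw [hT, ← h0, zero_smul, add_zero, sub_eq_zero] at ha
    have hψ0 : ψ ≠ 0 := by
      rintro rfl
      simp at hψ
    obtain ⟨d, rfl⟩ := finrank_eigenspace_eq_one_unique hnd hψe ha hψ0
    rw [dotProduct_smul, hψ] at h0
    have : d = 0 := by simpa using h0.symm
    rw [this, zero_smul]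
  obtain ⟨a, ha⟩ := LinearMap.injective_iff_surjective.1 hinj v
  have h0 := horth a
  rw [ha, hv] at h0
  refine ⟨a, ?_, h0.symm⟩
  rw [← ha, hT, ← h0, zero_smul, add_zero]

/-- The coefficients of the expansion, in powers of `1 / Γ`, of an approximately stationary pure
state. -/
structure IsExpansion (H : Op m n) (ψ : Ket₁ n) (lam₀ : ℝ) (ℓ : ℂ) (a : Fin (n + 1) → ℂ)
    (φ₁ φ₂ φ₃ : Vec m n) (μ : ℝ) : Prop where
  orth : star (ψ : Fin (n + 1) → ℂ) ⬝ᵥ a = 0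
  resolvent : block H 0 0 *ᵥ a - (lam₀ : ℂ) • a =
    -(Complex.I / 2 * (ℓ * star ℓ)) • (ψ : Fin (n + 1) → ℂ) -
      ℓ • (block H 0 1 *ᵥ (ψ : Fin (n + 1) → ℂ))
  first : φ₁ = ℓ • ket 1 ψ + inj m a
  gram_two : ((shift m n)ᴴ * shift m n) *ᵥ φ₂ =
    (-2 * Complex.I) • (H *ᵥ φ₁ - (lam₀ : ℂ) • φ₁) + (ℓ * star ℓ) • ket 0 ψ
  gram_three : ((shift m n)ᴴ * shift m n) *ᵥ φ₃ =
    (-2 * Complex.I) • (H *ᵥ φ₂ - (lam₀ : ℂ) • φ₂) + (2 * Complex.I * μ) • ket 0 ψ +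
      (2 * star ℓ) • (shift m n *ᵥ φ₂) - (ℓ * star ℓ) • φ₁

/-- At each order the equation prescribes `J†J φ`, which requires the component along `e⁰` of the
right side to vanish. The free part of the previous coefficient in `e⁰ ⊗ H₁` is used for this,
through the resolvent of `h₀₀`; orthogonality to `ψ` holds by the targeting condition at the first
step and fixes the energy shift `μ` at the second. -/
lemma exists_isExpansion {H : Op m n} (hH : H.IsHermitian) {ψ : Ket₁ n} (hψ : ‖ψ‖ = 1)
    {lam₀ : ℝ} {κ : ℂ}
    (hcond : H *ᵥ ket 0 ψ = (lam₀ : ℂ) • ket 0 ψ + κ • ket 1 ψ)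
    (hnd : Module.finrank ℂ (Module.End.eigenspace
      (Matrix.toLin' (block H 0 0)) (lam₀ : ℂ)) = 1) :
    ∃ a φ₁ φ₂ φ₃ μ, IsExpansion H ψ lam₀ (-2 * Complex.I * κ) a φ₁ φ₂ φ₃ μ := by
  set ℓ : ℂ := -2 * Complex.I * κ with hℓ
  have hsℓ : star ℓ = 2 * Complex.I * star κ := by simp [hℓ]
  set ψ' : Fin (n + 1) → ℂ := (ψ : Fin (n + 1) → ℂ) with hψ'
  have hψψ : star ψ' ⬝ᵥ ψ' = 1 := by
    rw [← inner_eq_star_dotProduct, inner_self_eq_norm_sq_to_K, hψ]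
    simp
  have hh := isHermitian_block hH
  have hψe : block H 0 0 *ᵥ ψ' = (lam₀ : ℂ) • ψ' := by
    simpa using block_mulVec_target hcond 0
  have hII := Complex.I_mul_I
  have h01 : (0 : Fin (m + 2)) ≠ 1 := by simp
  -- The adjoint form of the targeting condition, by which `ψ`-components of `H X` are computed
  -- without further knowledge of `H`.
  have hadj (X : Vec m n) : star ψ' ⬝ᵥ comp (H *ᵥ X) 0 =
      lam₀ * (star ψ' ⬝ᵥ comp X 0) + star κ * (star ψ' ⬝ᵥ comp X 1) := by
    rw [← star_ket_dotProduct, star_dotProduct_mulVec, hH.eq, hcond, star_add, star_smul,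
      star_smul, add_dotProduct, smul_dotProduct, smul_dotProduct, star_ket_dotProduct,
      star_ket_dotProduct]
    simp [hψ']
  -- Here `⟨ψ|h₀₁|ψ⟩` is the conjugate of `κ`, and with `ℓ = -2iκ` the two terms of `v` have
  -- opposite `ψ`-components.
  obtain ⟨a, ha, haψ⟩ := exists_resolvent hh hψψ hψe hnd
    (v := -(Complex.I / 2 * (ℓ * star ℓ)) • ψ' - ℓ • (block H 0 1 *ᵥ ψ')) (by
      have h := hadj (ket 1 ψ)
      rw [comp_mulVec_ket, comp_ket, comp_ket, if_neg h01, if_pos rfl, dotProduct_zero] at h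
      rw [dotProduct_sub, dotProduct_smul, dotProduct_smul, h, ← hψ', hψψ, hsℓ]
      simp only [smul_eq_mul]
      linear_combination (-κ * star κ * Complex.I) * hII * (-2) + 0 * hℓ)
  set φ₁ : Vec m n := ℓ • ket 1 ψ + inj m a with hφ₁
  set r : Vec m n := (-2 * Complex.I) • (H *ᵥ φ₁ - (lam₀ : ℂ) • φ₁) + (ℓ * star ℓ) • ket 0 ψ
    with hr
  have hφ₁0 : comp φ₁ 0 = a := by
    rw [hφ₁, comp_add, comp_smul, comp_ket, comp_inj, if_neg h01, if_pos rfl]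
    simp
  have hHφ₁ : comp (H *ᵥ φ₁) 0 - (lam₀ : ℂ) • a = -(Complex.I / 2 * (ℓ * star ℓ)) • ψ' := by
    rw [hφ₁, Matrix.mulVec_add, Matrix.mulVec_smul, comp_add, comp_smul, comp_mulVec_ket,
      comp_mulVec_inj, add_sub_assoc, ha]
    abel
  have hr0 : comp r 0 = 0 := by
    rw [hr, comp_add, comp_smul, comp_sub, comp_smul, comp_smul, hφ₁0, hHφ₁, comp_ket, if_pos rfl,
      ← hψ', smul_smul, ← add_smul]
    have : -2 * Complex.I * -(Complex.I / 2 * (ℓ * star ℓ)) + ℓ * star ℓ = 0 := by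
      linear_combination (ℓ * star ℓ) * hII
    rw [this, zero_smul]
  -- A second order energy shift. Hermiticity of `H` makes the expectation real, so that it is an
  -- admissible shift of `lam₀`.
  set μ : ℝ := (star φ₁ ⬝ᵥ (H *ᵥ φ₁ - (lam₀ : ℂ) • φ₁)).re with hμ
  have hμC : (μ : ℂ) = star φ₁ ⬝ᵥ (H *ᵥ φ₁ - (lam₀ : ℂ) • φ₁) := by
    refine Complex.conj_eq_iff_re.1 ?_
    rw [← Complex.star_def, star_dotProduct_comm, star_sub, sub_dotProduct, star_smul,
      smul_dotProduct, dotProduct_sub, dotProduct_smul, star_dotProduct_mulVec, hH.eq]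
    simp
  -- The pairing `⟨φ₁|r⟩` is evaluated twice: by the definition of `r`, where `φ₁` is orthogonal to
  -- `e⁰ ⊗ ψ`, and by components, where `r` has none along `e⁰`.
  have hr1 : star ψ' ⬝ᵥ comp r 1 * star κ = -μ := by
    have h1 : star φ₁ ⬝ᵥ r = (-2 * Complex.I) * μ := by
      have h2 : star φ₁ ⬝ᵥ ket 0 ψ = 0 := by
        rw [← star_dotProduct_comm, star_ket_dotProduct, hφ₁0, haψ, star_zero]
      rw [hr, dotProduct_add, dotProduct_smul, dotProduct_smul, h2, hμC]
      simp
    have h3 : star φ₁ ⬝ᵥ r = star ℓ * (star ψ' ⬝ᵥ comp r 1) := by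
      rw [hφ₁, star_add, star_smul, add_dotProduct, smul_dotProduct, star_ket_dotProduct,
        star_inj_dotProduct, hr0, dotProduct_zero, add_zero]
      rfl
    rw [h3, hsℓ] at h1
    have h4 : 2 * Complex.I * (star ψ' ⬝ᵥ comp r 1 * star κ + μ) = 0 := by
      linear_combination h1
    have h5 := (mul_eq_zero.1 h4).resolve_left (by simp)
    linear_combination h5
  have hshift0 : comp (shift m n *ᵥ r) 0 = comp r 1 := comp_shift_castSucc r 0
  -- The right side `v` is what the vanishing of the `e⁰` component of `φ₃` demands, and `hr1` is
  -- its orthogonality to `ψ`.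
  obtain ⟨a₂, ha₂, -⟩ := exists_resolvent hh hψψ hψe hnd
    (v := -comp (H *ᵥ r) 0 + (μ : ℂ) • ψ' - (Complex.I * star ℓ) • comp r 1 +
      (Complex.I / 2 * (ℓ * star ℓ)) • a) (by
      rw [dotProduct_add, dotProduct_sub, dotProduct_add, dotProduct_neg, hadj, hr0,
        dotProduct_smul, dotProduct_smul, dotProduct_smul, hψψ, haψ, dotProduct_zero, hsℓ]
      simp only [smul_eq_mul]
      linear_combination hr1 - 2 * star κ * (star ψ' ⬝ᵥ comp r 1) * hII)
  set φ₂ : Vec m n := r + inj m a₂ with hφ₂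
  set φ₃ : Vec m n := (-2 * Complex.I) • (H *ᵥ φ₂ - (lam₀ : ℂ) • φ₂) +
    (2 * Complex.I * μ) • ket 0 ψ + (2 * star ℓ) • (shift m n *ᵥ φ₂) - (ℓ * star ℓ) • φ₁ with hφ₃
  refine ⟨a, φ₁, φ₂, φ₃, μ, haψ, ha, rfl, ?_, ?_⟩
  · rw [gram_shift_mulVec, ← hr, hφ₂, comp_add, hr0, comp_inj, if_pos rfl, zero_add,
      add_sub_cancel_right]
  · rw [gram_shift_mulVec]
    have h0 : comp φ₃ 0 = 0 := by
      rw [hφ₃, comp_sub, comp_add, comp_add, comp_smul, comp_smul, comp_smul, comp_smul, hφ₁0,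
        comp_sub, comp_smul, hφ₂, Matrix.mulVec_add H r, Matrix.mulVec_add (shift m n) r,
        shift_mulVec_inj, add_zero,
        comp_add, comp_add, comp_mulVec_inj, hr0, comp_inj, if_pos rfl, zero_add, hshift0,
        comp_ket, if_pos rfl, add_sub_assoc (comp (H *ᵥ r) 0), ha₂, ← hψ']
      ext i
      simp only [Pi.add_apply, Pi.sub_apply, Pi.smul_apply, Pi.neg_apply, smul_eq_mul,
        Pi.zero_apply]
      linear_combination (2 * star ℓ * comp r 1 i - ℓ * star ℓ * a i) * hII
    rw [h0]
    have : inj m (0 : Fin (n + 1) → ℂ) = 0 := by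
      ext p
      simp [inj]
    rw [this, sub_zero]

end

/-! ### Residual of the pure approximation and its expression through `F_k` -/

section

variable {m n : ℕ}

/-- The approximate steady state vector, with `ε = 1 / Γ`. -/
def approx (ψ : Ket₁ n) (φ₁ φ₂ φ₃ : Vec m n) (ε : ℂ) : Vec m n :=
  ket 0 ψ + ε • φ₁ + ε ^ 2 • φ₂ + ε ^ 3 • φ₃

/-- The rescaled residual of the non-Hermitian part. -/
def driftRes (H : Op m n) (lam₀ : ℝ) (ℓ : ℂ) (μ : ℝ) (φ₁ φ₂ φ₃ : Vec m n) (ε : ℂ) : Vec m n :=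
  -Complex.I • (H *ᵥ φ₃ - (lam₀ : ℂ) • φ₃) + (Complex.I * μ) • φ₁ +
    star ℓ • (shift m n *ᵥ φ₃) - (ℓ * star ℓ / 2) • φ₂ +
    ε • ((Complex.I * μ) • φ₂ - (ℓ * star ℓ / 2) • φ₃) + (ε ^ 2 * (Complex.I * μ)) • φ₃

/-- The rescaled residual of the jump part. -/
def jumpRes (ℓ : ℂ) (φ₁ φ₂ φ₃ : Vec m n) (ε : ℂ) : Vec m n :=
  shift m n *ᵥ φ₂ - ℓ • φ₁ + ε • (shift m n *ᵥ φ₃ - ℓ • φ₂) - (ε ^ 2 * ℓ) • φ₃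

/-- The rescaled residual of the approximate steady state. -/
def residual (H : Op m n) (ψ : Ket₁ n) (lam₀ : ℝ) (ℓ : ℂ) (μ : ℝ) (φ₁ φ₂ φ₃ : Vec m n) (ε : ℂ) :
    Op m n :=
  Matrix.vecMulVec (driftRes H lam₀ ℓ μ φ₁ φ₂ φ₃ ε) (star (approx ψ φ₁ φ₂ φ₃ ε)) +
    Matrix.vecMulVec (approx ψ φ₁ φ₂ φ₃ ε) (star (driftRes H lam₀ ℓ μ φ₁ φ₂ φ₃ ε)) +
    Matrix.vecMulVec (jumpRes ℓ φ₁ φ₂ φ₃ ε) (star (jumpRes ℓ φ₁ φ₂ φ₃ ε))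

section Expansion

variable {H : Op m n} {ψ : Ket₁ n} {lam₀ : ℝ} {κ ℓ : ℂ} {a : Fin (n + 1) → ℂ}
  {φ₁ φ₂ φ₃ : Vec m n} {μ : ℝ}

lemma IsExpansion.comp_first_zero (h : IsExpansion H ψ lam₀ ℓ a φ₁ φ₂ φ₃ μ) :
    comp φ₁ 0 = a := by
  have h01 : (0 : Fin (m + 2)) ≠ 1 := by simp
  rw [h.first, comp_add, comp_smul, comp_ket, comp_inj, if_neg h01, if_pos rfl]
  simp

lemma IsExpansion.shift_first (h : IsExpansion H ψ lam₀ ℓ a φ₁ φ₂ φ₃ μ) :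
    shift m n *ᵥ φ₁ = ℓ • ket 0 ψ := by
  rw [h.first, Matrix.mulVec_add, Matrix.mulVec_smul, shift_mulVec_ket_one, shift_mulVec_inj,
    add_zero]

lemma IsExpansion.gram_first (h : IsExpansion H ψ lam₀ ℓ a φ₁ φ₂ φ₃ μ) :
    ((shift m n)ᴴ * shift m n) *ᵥ φ₁ = ℓ • ket 1 ψ := by
  rw [gram_shift_mulVec, h.comp_first_zero, h.first, add_sub_cancel_right]

lemma IsExpansion.drift_approx (h : IsExpansion H ψ lam₀ ℓ a φ₁ φ₂ φ₃ μ)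
    (hcond : H *ᵥ ket 0 ψ = (lam₀ : ℂ) • ket 0 ψ + κ • ket 1 ψ) (hℓ : ℓ = -2 * Complex.I * κ)
    {Γ : ℝ} (hΓ : Γ ≠ 0) :
    drift H (shift m n) Γ ((Γ : ℂ)⁻¹ * ℓ) (lam₀ + μ * Γ⁻¹ ^ 2) (approx ψ φ₁ φ₂ φ₃ (Γ : ℂ)⁻¹) =
      ((Γ : ℂ)⁻¹ ^ 3) • driftRes H lam₀ ℓ μ φ₁ φ₂ φ₃ (Γ : ℂ)⁻¹ := by
  have hΓ' : (Γ : ℂ) ≠ 0 := by exact_mod_cast hΓ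
  have hG0 : ((shift m n)ᴴ * shift m n) *ᵥ ket 0 ψ = 0 := by
    rw [← Matrix.mulVec_mulVec, shift_mulVec_ket_zero, Matrix.mulVec_zero]
  have hs : star ((Γ : ℂ)⁻¹ * ℓ) = (Γ : ℂ)⁻¹ * star ℓ := by
    simp
  rw [drift, approx, driftRes, hs]
  simp only [Matrix.mulVec_add, Matrix.mulVec_smul, hcond, hG0, h.gram_first, h.gram_two,
    h.gram_three, shift_mulVec_ket_zero, h.shift_first]
  ext p
  simp only [Pi.add_apply, Pi.sub_apply, Pi.smul_apply, smul_eq_mul, Pi.zero_apply]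
  push_cast
  -- The equations for `φ₂` and `φ₃` cancel the orders `ε` and `ε²`; the choice of `ℓ` cancels the
  -- component along `e¹ ⊗ ψ` at order zero.
  have hk : -Complex.I * κ = ℓ / 2 := by rw [hℓ]; ring
  field_simp
  linear_combination (2 * (Γ : ℂ) ^ 5 * ket (m := m) 1 ψ p) * hk

lemma IsExpansion.jump_approx (h : IsExpansion H ψ lam₀ ℓ a φ₁ φ₂ φ₃ μ) (ε : ℂ) :
    shift m n *ᵥ approx ψ φ₁ φ₂ φ₃ ε - (ε * ℓ) • approx ψ φ₁ φ₂ φ₃ ε =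
      ε ^ 2 • jumpRes ℓ φ₁ φ₂ φ₃ ε := by
  rw [approx, jumpRes]
  simp only [Matrix.mulVec_add, Matrix.mulVec_smul, shift_mulVec_ket_zero, h.shift_first]
  module

/-- The drift part is of order `ε³`. The jump part is quadratic in a vector of order `ε²` and
carries a factor `Γ`, so it has the same order. -/
lemma IsExpansion.lindbladian_approx (h : IsExpansion H ψ lam₀ ℓ a φ₁ φ₂ φ₃ μ)
    (hH : H.IsHermitian)
    (hcond : H *ᵥ ket 0 ψ = (lam₀ : ℂ) • ket 0 ψ + κ • ket 1 ψ) (hℓ : ℓ = -2 * Complex.I * κ)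
    {Γ : ℝ} (hΓ : Γ ≠ 0) :
    lindbladian H (jordan m) Γ (Matrix.vecMulVec (approx ψ φ₁ φ₂ φ₃ (Γ : ℂ)⁻¹)
      (star (approx ψ φ₁ φ₂ φ₃ (Γ : ℂ)⁻¹))) =
      ((Γ : ℂ)⁻¹ ^ 3) • residual H ψ lam₀ ℓ μ φ₁ φ₂ φ₃ (Γ : ℂ)⁻¹ := by
  have hΓ' : (Γ : ℂ) ≠ 0 := by exact_mod_cast hΓ
  rw [lindbladian_vecMulVec hH _ Γ ((Γ : ℂ)⁻¹ * ℓ) (lam₀ + μ * Γ⁻¹ ^ 2),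
    h.drift_approx hcond hℓ hΓ, h.jump_approx, residual]
  simp only [star_smul, Matrix.smul_vecMulVec, Matrix.vecMulVec_smul, smul_add, smul_smul]
  have h1 : star ((Γ : ℂ)⁻¹ ^ 3) = (Γ : ℂ)⁻¹ ^ 3 := by simp
  have h2 : (Γ : ℂ) * (star ((Γ : ℂ)⁻¹ ^ 2) * (Γ : ℂ)⁻¹ ^ 2) = (Γ : ℂ)⁻¹ ^ 3 := by
    simp only [star_pow, star_inv₀, Complex.star_def, Complex.conj_ofReal]
    field_simp
  simp only [h1, h2]

lemma continuous_residual (H : Op m n) (ψ : Ket₁ n) (lam₀ : ℝ) (ℓ : ℂ) (μ : ℝ)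
    (φ₁ φ₂ φ₃ : Vec m n) : Continuous (residual H ψ lam₀ ℓ μ φ₁ φ₂ φ₃) := by
  have h1 : Continuous (approx ψ φ₁ φ₂ φ₃) := by
    unfold approx
    fun_prop
  have h2 : Continuous (driftRes H lam₀ ℓ μ φ₁ φ₂ φ₃) := by
    unfold driftRes
    fun_prop
  have h3 : Continuous (jumpRes ℓ φ₁ φ₂ φ₃) := by
    unfold jumpRes
    fun_prop
  unfold residual
  fun_prop

lemma rep_reduced_vecMulVec (b : OrthonormalBasis (Fin (n + 1)) ℂ (Ket₁ n)) (X Y : Vec m n)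
    (α β : Fin (n + 1)) :
    rep b (reduced (Matrix.vecMulVec X (star Y))) α β =
      ∑ k, (star (b α : Fin (n + 1) → ℂ) ⬝ᵥ comp X k) *
        star (star (b β : Fin (n + 1) → ℂ) ⬝ᵥ comp Y k) := by
  have h : reduced (Matrix.vecMulVec X (star Y)) =
      ∑ k, Matrix.vecMulVec (comp X k) (star (comp Y k)) := by
    ext a b
    simp [reduced, comp, Matrix.vecMulVec_apply, Matrix.sum_apply]
  rw [h, rep_sum, Matrix.sum_apply]
  refine Finset.sum_congr rfl fun k _ => ?_
  rw [rep_apply, Matrix.vecMulVec_mulVec, star_dotProduct_comm]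
  simp [mul_comm]

variable {b : OrthonormalBasis (Fin (n + 1)) ℂ (Ket₁ n)} {lam : Fin (n + 1) → ℝ}

lemma star_dotProduct_target (hb : b 0 = ψ) {α : Fin (n + 1)} (hα : α ≠ 0) :
    star (b α : Fin (n + 1) → ℂ) ⬝ᵥ (ψ : Fin (n + 1) → ℂ) = 0 := by
  rw [← hb, star_dotProduct_basis, if_neg hα]

lemma matLam_mulVec (v : Fin (n + 1) → ℂ) (α : Fin n) :
    star (b α.succ : Fin (n + 1) → ℂ) ⬝ᵥ (matLam b lam *ᵥ v) =
      ((lam α.succ - lam 0)⁻¹ : ℝ) * (star (b α.succ : Fin (n + 1) → ℂ) ⬝ᵥ v) := by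
  rw [matLam, Matrix.sum_mulVec, dotProduct_sum, Finset.sum_eq_single α]
  · rw [Matrix.smul_mulVec, proj, Matrix.vecMulVec_mulVec, dotProduct_smul]
    simp [star_dotProduct_basis]
  · intro β _ hβ
    rw [Matrix.smul_mulVec, proj, Matrix.vecMulVec_mulVec, dotProduct_smul]
    simp [star_dotProduct_basis, hβ.symm]
  · simp

lemma matLam_mulVec_zero (v : Fin (n + 1) → ℂ) :
    star (b 0 : Fin (n + 1) → ℂ) ⬝ᵥ (matLam b lam *ᵥ v) = 0 := by
  rw [matLam, Matrix.sum_mulVec, dotProduct_sum]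
  refine Finset.sum_eq_zero fun β _ => ?_
  rw [Matrix.smul_mulVec, proj, Matrix.vecMulVec_mulVec, dotProduct_smul]
  simp [star_dotProduct_basis, (Fin.succ_ne_zero β).symm]

/-- The first order correction inside `e⁰ ⊗ H₁`. -/
lemma IsExpansion.eq_matLam (h : IsExpansion H ψ lam₀ ℓ a φ₁ φ₂ φ₃ μ) (hH : H.IsHermitian)
    (hb : IsEigenbasis (block H 0 0) ψ b lam) (hlam : lam 0 = lam₀)
    (hne : ∀ α : Fin n, lam α.succ ≠ lam 0) :
    a = -ℓ • (matLam b lam *ᵥ (block H 0 1 *ᵥ (ψ : Fin (n + 1) → ℂ))) := by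
  rw [← sub_eq_zero]
  refine eq_zero_of_rep_eq_zero b fun α => ?_
  rw [dotProduct_sub, dotProduct_smul]
  induction α using Fin.cases with
  | zero => rw [matLam_mulVec_zero, hb.1, h.orth]; simp
  | succ α =>
    rw [matLam_mulVec]
    have h1 := congrArg (fun v => star (b α.succ : Fin (n + 1) → ℂ) ⬝ᵥ v) h.resolvent
    simp only [dotProduct_sub, dotProduct_smul,
      star_dotProduct_target hb.1 (Fin.succ_ne_zero α)] at h1
    rw [star_dotProduct_mulVec, (isHermitian_block hH).eq, hb.2, star_smul, smul_dotProduct,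
      ← hlam] at h1
    have h2 : ((lam α.succ : ℂ) - lam 0) ≠ 0 := by
      rw [sub_ne_zero]
      exact_mod_cast hne α
    simp only [smul_eq_mul, Complex.star_def, Complex.conj_ofReal] at h1 ⊢
    push_cast
    field_simp
    linear_combination h1

/-- The leading jump residual in terms of the operators `F_k`. -/
lemma IsExpansion.jumpRes_castSucc (h : IsExpansion H ψ lam₀ ℓ a φ₁ φ₂ φ₃ μ)
    (hH : H.IsHermitian)
    (hcond : H *ᵥ ket 0 ψ = (lam₀ : ℂ) • ket 0 ψ + κ • ket 1 ψ) (hℓ : ℓ = -2 * Complex.I * κ)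
    (hb : IsEigenbasis (block H 0 0) ψ b lam) (hlam : lam 0 = lam₀)
    (hne : ∀ α : Fin n, lam α.succ ≠ lam 0) (i : Fin (m + 1)) (α : Fin n) :
    star (b α.succ : Fin (n + 1) → ℂ) ⬝ᵥ comp (jumpRes ℓ φ₁ φ₂ φ₃ 0) i.castSucc =
      -2 * Complex.I * ℓ * rep b (matF H b lam i.succ) α.succ 0 := by
  have hψ := star_dotProduct_target hb.1 (Fin.succ_ne_zero α)
  have hj1 : i.succ = (1 : Fin (m + 2)) ↔ i.castSucc = 0 := by
    rw [← Fin.succ_zero_eq_one, Fin.succ_inj, Fin.castSucc_eq_zero_iff]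
  set v := matLam b lam *ᵥ (block H 0 1 *ᵥ (ψ : Fin (n + 1) → ℂ)) with hv
  have ha : a = -ℓ • v := h.eq_matLam hH hb hlam hne
  have hF : rep b (matF H b lam i.succ) α.succ 0 =
      star (b α.succ : Fin (n + 1) → ℂ) ⬝ᵥ (block H i.succ 1 *ᵥ (ψ : Fin (n + 1) → ℂ)) +
      ((if i.castSucc = 0 then κ else 0) * (star (b α.succ : Fin (n + 1) → ℂ) ⬝ᵥ v) -
        star (b α.succ : Fin (n + 1) → ℂ) ⬝ᵥ (block H i.succ 0 *ᵥ v)) := by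
    have h1 := block_mulVec_target hcond i.succ
    rw [if_neg (Fin.succ_ne_zero i), zero_add] at h1
    rw [rep_apply, hb.1, matF, Matrix.add_mulVec, Matrix.sub_mulVec, ← Matrix.mulVec_mulVec,
      ← Matrix.mulVec_mulVec (M := block H i.succ 0), h1, Matrix.mulVec_smul,
      ← Matrix.mulVec_mulVec, ← hv, dotProduct_add, dotProduct_sub, dotProduct_smul]
    simp only [hj1, smul_eq_mul]
  -- Since `J J†J = J`, the shifted `φ₂` depends only on `J†J φ₂`, which the expansion gives in
  -- terms of `φ₁`; the part of `φ₂` in `e⁰ ⊗ H₁` does not enter.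
  have hJ : comp (jumpRes ℓ φ₁ φ₂ φ₃ 0) i.castSucc =
      comp (((shift m n)ᴴ * shift m n) *ᵥ φ₂) i.succ - ℓ • comp φ₁ i.castSucc := by
    rw [← comp_shift_castSucc, shift_gram_mulVec]
    simp [jumpRes, comp_sub, comp_smul]
  rw [hJ, h.gram_two, hF, comp_add, comp_smul, comp_sub, comp_smul, comp_smul, comp_ket,
    if_neg (Fin.succ_ne_zero i), h.first, Matrix.mulVec_add, Matrix.mulVec_smul, comp_add,
    comp_add, comp_add, comp_smul, comp_smul, comp_smul, comp_mulVec_ket, comp_mulVec_inj,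
    comp_ket, comp_ket, comp_inj, comp_inj, if_neg (Fin.succ_ne_zero i), ha]
  by_cases hi : i.castSucc = 0
  · have h01 : (0 : Fin (m + 2)) ≠ 1 := by simp
    simp only [hj1, hi, if_true, if_neg h01, dotProduct_sub, dotProduct_add, dotProduct_smul,
      Matrix.mulVec_smul, smul_zero, smul_eq_mul, add_zero, zero_add, hψ,
      neg_smul, dotProduct_neg, Matrix.mulVec_neg, mul_zero, sub_zero]
    rw [hℓ]
    ring
  · simp only [hj1, hi, if_false, dotProduct_sub, dotProduct_add, dotProduct_smul,
      Matrix.mulVec_smul, smul_zero, smul_eq_mul, add_zero,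
      neg_smul, dotProduct_neg, Matrix.mulVec_neg, sub_zero]
    split_ifs <;> simp only [hψ, dotProduct_zero] <;> ring

lemma IsExpansion.jumpRes_last (h : IsExpansion H ψ lam₀ ℓ a φ₁ φ₂ φ₃ μ) (hb : b 0 = ψ)
    (α : Fin n) :
    star (b α.succ : Fin (n + 1) → ℂ) ⬝ᵥ comp (jumpRes ℓ φ₁ φ₂ φ₃ 0) (Fin.last _) = 0 := by
  have hψ := star_dotProduct_target hb (Fin.succ_ne_zero α)
  have hlast : Fin.last (m + 1) ≠ 0 := Fin.last_pos.ne'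
  have hJ : jumpRes ℓ φ₁ φ₂ φ₃ 0 = shift m n *ᵥ φ₂ - ℓ • φ₁ := by simp [jumpRes]
  rw [hJ, comp_sub, comp_shift_last, comp_smul, h.first, comp_add, comp_smul, comp_ket, comp_inj,
    if_neg hlast]
  split_ifs <;> simp [hψ]

lemma vecR_eq (H : Op m n) (b : OrthonormalBasis (Fin (n + 1)) ℂ (Ket₁ n))
    (lam : Fin (n + 1) → ℝ) (α : Fin n) :
    vecR H b lam α = ∑ k : Fin (m + 1), ‖rep b (matF H b lam k.succ) α.succ 0‖ ^ 2 := by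
  rw [vecR]
  refine Finset.sum_congr rfl fun k _ => ?_
  rw [braket_eq_rep, rep_mul, rep_mul, rep_conjTranspose, Matrix.mul_apply,
    Finset.sum_eq_single 0]
  · rw [Matrix.mul_apply, Finset.sum_eq_single 0]
    · rw [rep_proj_zero, if_pos ⟨rfl, rfl⟩, mul_one, Matrix.conjTranspose_apply,
        Complex.star_def, Complex.mul_conj']
      norm_cast
    · intro j _ hj
      simp [rep_proj_zero, hj]
    · simp
  · intro j _ hj
    rw [Matrix.mul_apply]
    simp [rep_proj_zero, hj]
  · simp

/-- At `ε = 0` the approximate vector is `e⁰ ⊗ ψ`, orthogonal to `α ≥ 1` in every component, so both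
drift terms vanish and only the jump term survives. The constant is `|-2iℓ|² = 16|κ|²`. -/
lemma IsExpansion.rep_reduced_residual (h : IsExpansion H ψ lam₀ ℓ a φ₁ φ₂ φ₃ μ)
    (hH : H.IsHermitian)
    (hcond : H *ᵥ ket 0 ψ = (lam₀ : ℂ) • ket 0 ψ + κ • ket 1 ψ) (hℓ : ℓ = -2 * Complex.I * κ)
    (hb : IsEigenbasis (block H 0 0) ψ b lam) (hlam : lam 0 = lam₀)
    (hne : ∀ α : Fin n, lam α.succ ≠ lam 0) (α : Fin n) :
    rep b (reduced (residual H ψ lam₀ ℓ μ φ₁ φ₂ φ₃ 0)) α.succ α.succ =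
      ((16 * ‖κ‖ ^ 2 * vecR H b lam α : ℝ) : ℂ) := by
  have hψ := star_dotProduct_target hb.1 (Fin.succ_ne_zero α)
  have hket (k : Fin (m + 2)) :
      star (b α.succ : Fin (n + 1) → ℂ) ⬝ᵥ comp (ket 0 ψ) k = 0 := by
    rw [comp_ket]
    split_ifs <;> simp [hψ]
  have happ : approx ψ φ₁ φ₂ φ₃ 0 = ket 0 ψ := by simp [approx]
  have hnorm : ‖-2 * Complex.I * ℓ‖ ^ 2 = 16 * ‖κ‖ ^ 2 := by
    rw [hℓ]
    simp only [norm_mul, norm_neg, Complex.norm_I, Complex.norm_ofNat]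
    ring
  rw [residual, happ, reduced_add, reduced_add, rep_add, rep_add, Matrix.add_apply,
    Matrix.add_apply, rep_reduced_vecMulVec, rep_reduced_vecMulVec, rep_reduced_vecMulVec]
  simp only [hket, zero_mul, star_zero, mul_zero, Finset.sum_const_zero, zero_add]
  rw [Fin.sum_univ_castSucc, h.jumpRes_last hb.1, zero_mul, add_zero, vecR_eq, ← hnorm,
    Finset.mul_sum]
  push_cast
  refine Finset.sum_congr rfl fun i _ => ?_
  rw [h.jumpRes_castSucc hH hcond hℓ hb hlam hne, Complex.star_def, Complex.mul_conj',
    norm_mul, Complex.ofReal_mul, mul_pow]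

end Expansion

end

section

variable {m n : ℕ}

/-! ### The second order correction -/

/-- The sum of the absolute values of the entries. -/
def entrySum (X : Op m n) : ℝ := ∑ i, ∑ j, ‖X i j‖

lemma continuous_entrySum : Continuous (entrySum : Op m n → ℝ) := by
  unfold entrySum
  fun_prop

lemma norm_apply_le_entrySum (X : Op m n) (i j : Fin (m + 2) × Fin (n + 1)) :
    ‖X i j‖ ≤ entrySum X :=
  (Finset.single_le_sum (f := fun j => ‖X i j‖) (fun _ _ => norm_nonneg _)
    (Finset.mem_univ j)).trans
  (Finset.single_le_sum (f := fun i => ∑ j, ‖X i j‖)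
    (fun _ _ => Finset.sum_nonneg fun _ _ => norm_nonneg _) (Finset.mem_univ i))

lemma entrySum_smul (c : ℂ) (X : Op m n) : entrySum (c • X) = ‖c‖ * entrySum X := by
  simp [entrySum, Finset.mul_sum]

lemma lindbladian_smul (H : Op m n) (L : Matrix (Fin (m + 2)) (Fin (m + 2)) ℂ) (Γ : ℝ) (c : ℂ)
    (X : Op m n) : lindbladian H L Γ (c • X) = c • lindbladian H L Γ X := by
  have h : dissipator (L ⊗ₖ (1 : Op₁ n)) (c • X) = c • dissipator (L ⊗ₖ (1 : Op₁ n)) X :=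
    (dissipatorLin (L ⊗ₖ (1 : Op₁ n))).map_smul c X
  rw [lindbladian, lindbladian, h, Matrix.mul_smul, Matrix.smul_mul]
  module

lemma lindbladian_sub (H : Op m n) (L : Matrix (Fin (m + 2)) (Fin (m + 2)) ℂ) (Γ : ℝ)
    (X Y : Op m n) :
    lindbladian H L Γ (X - Y) = lindbladian H L Γ X - lindbladian H L Γ Y := by
  have h : dissipator (L ⊗ₖ (1 : Op₁ n)) (X - Y) =
      dissipator (L ⊗ₖ (1 : Op₁ n)) X - dissipator (L ⊗ₖ (1 : Op₁ n)) Y :=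
    (dissipatorLin (L ⊗ₖ (1 : Op₁ n))).map_sub X Y
  rw [lindbladian, lindbladian, lindbladian, h, Matrix.mul_sub, Matrix.sub_mul]
  module

lemma effGen_sub {ι : Type*} [Fintype ι] (N : Matrix ι ι ℂ) (h : ι → Op₁ n) (C C' : Op₁ n) :
    effGen N h (C - C') = effGen N h C - effGen N h C' := by
  simp only [effGen, ← Finset.sum_sub_distrib]
  refine Finset.sum_congr rfl fun j _ => Finset.sum_congr rfl fun k _ => ?_
  simp only [Matrix.mul_sub, Matrix.sub_mul]
  module

/-- The effective generator for the Jordan block, in the basis `b`. -/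
abbrev repGen (H : Op m n) (b : OrthonormalBasis (Fin (n + 1)) ℂ (Ket₁ n)) (C : Op₁ n) : Op₁ n :=
  effGen (1 - Matrix.single 0 0 1) (fun k => rep b (block H k 0)) (rep b C)

section

variable {H : Op m n} {ψ : Ket₁ n} {lam₀ : ℝ} {κ ℓ : ℂ} {a : Fin (n + 1) → ℂ}
  {φ₁ φ₂ φ₃ : Vec m n} {μ : ℝ} {b : OrthonormalBasis (Fin (n + 1)) ℂ (Ket₁ n)}
  {lam : Fin (n + 1) → ℝ} {ρ : ℝ → Op m n}

/-- On matrices that are diagonal in `b`, the effective generator acts through `K`. -/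
lemma repGen_succ (hcond : H *ᵥ ket 0 ψ = (lam₀ : ℂ) • ket 0 ψ + κ • ket 1 ψ) (hb : b 0 = ψ)
    {C : Op₁ n} {c : Fin (n + 1) → ℝ} (hc : rep b C = Matrix.diagonal fun α => (c α : ℂ))
    (α : Fin n) :
    repGen H b C α.succ α.succ =
      ((2 * (matK H b *ᵥ fun β : Fin n => c β.succ) α : ℝ) : ℂ) := by
  have h0 : wt (fun k => rep b (block H k 0)) α.succ 0 = 0 := by
    refine Finset.sum_eq_zero fun k _ => ?_
    have h1 := rep_block_target hcond hb k.succ (Fin.succ_ne_zero α)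
    simp [h1]
  have hK : (matK H b *ᵥ fun β : Fin n => c β.succ) α =
      ∑ β, wt (fun k => rep b (block H k 0)) α.succ β * c β -
        c α.succ * ∑ γ, wt (fun k => rep b (block H k 0)) γ α.succ := by
    rw [Fin.sum_univ_succ, h0, zero_mul, zero_add, Matrix.mulVec, dotProduct]
    simp only [matK_apply, sub_mul, Finset.sum_sub_distrib, ite_mul, zero_mul,
      Finset.sum_ite_eq, Finset.mem_univ, if_true]
    ring
  rw [repGen, hc, effGen_diagonal_apply, hK]
  simp only [rate_one_sub_single]
  push_cast
  ring

lemma rep_eq_diagonal_re {C : Op₁ n} (hC : C.IsHermitian)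
    (hd : ∀ α β, α ≠ β → rep b C α β = 0) :
    rep b C = Matrix.diagonal fun α => (((rep b C α α).re : ℝ) : ℂ) := by
  ext α β
  rw [Matrix.diagonal_apply]
  split_ifs with h
  · subst h
    have h1 : (rep b C)ᴴ = rep b C := by rw [← rep_conjTranspose, hC.eq]
    have h2 := congrFun (congrFun h1 α) α
    exact (Complex.conj_eq_iff_re.1 h2).symm
  · exact hd α β h

/-- The effective generator is injective on traceless Hermitian matrices that commute with
`h₀₀`. -/
lemma eq_zero_of_repGen_eq_zero (hH : H.IsHermitian) (hψ : ‖ψ‖ = 1)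
    (hcond : H *ᵥ ket 0 ψ = (lam₀ : ℂ) • ket 0 ψ + κ • ket 1 ψ)
    (hnd : Module.finrank ℂ (Module.End.eigenspace
      (Matrix.toLin' (block H 0 0)) (lam₀ : ℂ)) = 1)
    (hK : ∀ b lam, IsEigenbasis (block H 0 0) ψ b lam → IsUnit (matK H b).det)
    {C : Op₁ n} (hC : C.IsHermitian) (hcomm : block H 0 0 * C = C * block H 0 0)
    (htr : C.trace = 0)
    (h0 : ∀ b lam, IsEigenbasis (block H 0 0) ψ b lam →
      ∀ α : Fin n, repGen H b C α.succ α.succ = 0) : C = 0 := by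
  have hψe : block H 0 0 *ᵥ (ψ : Fin (n + 1) → ℂ) = (lam₀ : ℂ) • (ψ : Fin (n + 1) → ℂ) := by
    simpa using block_mulVec_target hcond 0
  -- The basis must diagonalize `C`, which is not known beforehand; this is why invertibility of `K`
  -- and the vanishing of the generator are assumed for every eigenbasis.
  obtain ⟨b, lam, hb, hd⟩ := exists_isEigenbasis (isHermitian_block hH) hC hcomm hψ hψe hnd
  obtain ⟨c, hdiag⟩ : ∃ c : Fin (n + 1) → ℝ, rep b C = Matrix.diagonal fun α => (c α : ℂ) :=
    ⟨_, rep_eq_diagonal_re hC hd⟩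
  have hKc : (matK H b *ᵥ fun β : Fin n => c β.succ) = 0 := by
    ext α
    have h1 := h0 b lam hb α
    rw [repGen_succ hcond hb.1 hdiag] at h1
    have h2 : 2 * (matK H b *ᵥ fun β : Fin n => c β.succ) α = 0 := by exact_mod_cast h1
    simpa using h2
  have hcs : (fun β : Fin n => c β.succ) = 0 := by
    have h1 := congrArg (fun v => (matK H b)⁻¹ *ᵥ v) hKc
    simpa [Matrix.mulVec_mulVec, Matrix.nonsing_inv_mul _ (hK b lam hb)] using h1
  have hcs' (β : Fin n) : c β.succ = 0 := congrFun hcs β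
  have hc0 : c 0 = 0 := by
    have h1 := trace_rep b C
    rw [htr, hdiag, Matrix.trace_diagonal, Fin.sum_univ_succ] at h1
    simpa [hcs'] using h1
  apply rep_injective b
  rw [hdiag, rep_zero]
  ext α β
  rw [Matrix.diagonal_apply]
  induction α using Fin.cases with
  | zero => simp [hc0]
  | succ α => simp [hcs']

/-- The rescaled difference of the steady state and its pure approximation. -/
def remainder (ψ : Ket₁ n) (φ₁ φ₂ φ₃ : Vec m n) (ρ : ℝ → Op m n) (Γ : ℝ) : Op m n :=
  (Γ : ℂ) ^ 2 • (ρ Γ - Matrix.vecMulVec (approx ψ φ₁ φ₂ φ₃ (Γ : ℂ)⁻¹)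
    (star (approx ψ φ₁ φ₂ φ₃ (Γ : ℂ)⁻¹)))

lemma IsExpansion.lindbladian_remainder (h : IsExpansion H ψ lam₀ ℓ a φ₁ φ₂ φ₃ μ)
    (hH : H.IsHermitian)
    (hcond : H *ᵥ ket 0 ψ = (lam₀ : ℂ) • ket 0 ψ + κ • ket 1 ψ) (hℓ : ℓ = -2 * Complex.I * κ)
    {Γ : ℝ} (hΓ : Γ ≠ 0) (hρ : lindbladian H (jordan m) Γ (ρ Γ) = 0) :
    lindbladian H (jordan m) Γ (remainder ψ φ₁ φ₂ φ₃ ρ Γ) =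
      -(Γ : ℂ)⁻¹ • residual H ψ lam₀ ℓ μ φ₁ φ₂ φ₃ (Γ : ℂ)⁻¹ := by
  have hΓ' : (Γ : ℂ) ≠ 0 := by exact_mod_cast hΓ
  rw [remainder, lindbladian_smul, lindbladian_sub, hρ, h.lindbladian_approx hH hcond hℓ hΓ,
    zero_sub, smul_neg, smul_smul, neg_smul]
  congr 2
  field_simp

/-- The rescaled defect of the norm of the approximate state. -/
def normDefect (ψ : Ket₁ n) (φ₁ φ₂ φ₃ : Vec m n) (ε : ℂ) : ℂ :=
  star (ket 0 ψ) ⬝ᵥ (φ₂ + ε • φ₃) + star (φ₂ + ε • φ₃) ⬝ᵥ ket 0 ψ +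
    star (φ₁ + ε • φ₂ + ε ^ 2 • φ₃) ⬝ᵥ (φ₁ + ε • φ₂ + ε ^ 2 • φ₃)

/-- The normalization `⟨ψ|a⟩ = 0` removes the term of first order, which keeps the trace of the
remainder bounded after rescaling by `Γ²`. -/
lemma IsExpansion.norm_approx (h : IsExpansion H ψ lam₀ ℓ a φ₁ φ₂ φ₃ μ) (hψ : ‖ψ‖ = 1) (x : ℝ) :
    star (approx ψ φ₁ φ₂ φ₃ (x : ℂ)) ⬝ᵥ approx ψ φ₁ φ₂ φ₃ (x : ℂ) =
      1 + (x : ℂ) ^ 2 * normDefect ψ φ₁ φ₂ φ₃ (x : ℂ) := by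
  have h0 : star (ket (m := m) 0 ψ) ⬝ᵥ ket 0 ψ = 1 := by
    rw [star_ket_dotProduct, comp_ket, if_pos rfl, ← inner_eq_star_dotProduct,
      inner_self_eq_norm_sq_to_K, hψ]
    simp
  have h1 : star (ket 0 ψ) ⬝ᵥ φ₁ = 0 := by
    rw [star_ket_dotProduct, h.comp_first_zero, h.orth]
  have h2 : star φ₁ ⬝ᵥ ket 0 ψ = 0 := by
    rw [← star_dotProduct_comm, h1, star_zero]
  rw [approx, normDefect]
  simp only [star_add, star_smul, add_dotProduct, dotProduct_add, smul_dotProduct,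
    dotProduct_smul, smul_eq_mul, h0, h1, h2, star_pow, Complex.star_def, Complex.conj_ofReal]
  ring

lemma trace_vecMulVec_star (X : Vec m n) :
    (Matrix.vecMulVec X (star X)).trace = star X ⬝ᵥ X := by
  rw [Matrix.trace_vecMulVec, dotProduct_comm]

lemma IsExpansion.trace_remainder (h : IsExpansion H ψ lam₀ ℓ a φ₁ φ₂ φ₃ μ) (hψ : ‖ψ‖ = 1)
    {Γ : ℝ} (hΓ : Γ ≠ 0) (hρ : (ρ Γ).trace = 1) :
    (remainder ψ φ₁ φ₂ φ₃ ρ Γ).trace = -normDefect ψ φ₁ φ₂ φ₃ (Γ : ℂ)⁻¹ := by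
  have hΓ' : (Γ : ℂ) ≠ 0 := by exact_mod_cast hΓ
  have h1 := h.norm_approx hψ Γ⁻¹
  rw [Complex.ofReal_inv] at h1
  rw [remainder, Matrix.trace_smul, Matrix.trace_sub, trace_vecMulVec_star, h1, hρ, smul_eq_mul]
  field_simp
  ring

lemma continuous_normDefect (ψ : Ket₁ n) (φ₁ φ₂ φ₃ : Vec m n) : Continuous (normDefect ψ φ₁ φ₂ φ₃) := by
  unfold normDefect
  fun_prop

lemma isHermitian_remainder {Γ : ℝ} (hρ : (ρ Γ).IsHermitian) :
    (remainder ψ φ₁ φ₂ φ₃ ρ Γ).IsHermitian := by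
  have h1 : (ρ Γ)ᴴ = ρ Γ := hρ
  rw [remainder, Matrix.IsHermitian, Matrix.conjTranspose_smul, Matrix.conjTranspose_sub, h1,
    Matrix.conjTranspose_vecMulVec, star_star]
  simp

lemma isClosed_isHermitian {ι : Type*} : IsClosed {X : Matrix ι ι ℂ | X.IsHermitian} :=
  isClosed_eq continuous_id.matrix_conjTranspose continuous_id

lemma tendsto_ofReal_inv {l : Filter ℝ} (hl : l ≤ atTop) :
    Tendsto (fun Γ : ℝ => ((Γ : ℂ))⁻¹) l (𝓝 0) := by
  have h1 : Tendsto (fun Γ : ℝ => Γ⁻¹) l (𝓝 0) := tendsto_inv_atTop_zero.mono_left hl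
  have h2 := (Complex.continuous_ofReal.tendsto 0).comp h1
  simpa [Function.comp_def] using h2

lemma continuous_trace_op : Continuous fun X : Op m n => X.trace := by
  fun_prop

lemma continuous_rep_reduced (b : OrthonormalBasis (Fin (n + 1)) ℂ (Ket₁ n))
    (α β : Fin (n + 1)) : Continuous fun X : Op m n => rep b (reduced X) α β :=
  (continuous_apply_apply α β).comp ((continuous_rep b).comp continuous_reduced)

/-- Limit points of rescaled remainders. -/
lemma IsExpansion.limit_point (h : IsExpansion H ψ lam₀ ℓ a φ₁ φ₂ φ₃ μ) (hH : H.IsHermitian)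
    (hL : HasPureKernel (jordan m)) (hψ : ‖ψ‖ = 1)
    (hcond : H *ᵥ ket 0 ψ = (lam₀ : ℂ) • ket 0 ψ + κ • ket 1 ψ) (hℓ : ℓ = -2 * Complex.I * κ)
    (hρ : ∀ Γ : ℝ, 0 < Γ → IsNESS H (jordan m) Γ (ρ Γ))
    {l : Filter ℝ} [l.NeBot] (hl : l ≤ atTop) {s : ℝ → ℝ} {s₀ : ℝ} (hs : Tendsto s l (𝓝 s₀))
    {x₀ : Op m n}
    (hx : Tendsto (fun Γ => (s Γ : ℂ) • remainder ψ φ₁ φ₂ φ₃ ρ Γ) l (𝓝 x₀)) :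
    x₀ = emb m (reduced x₀) ∧ block H 0 0 * reduced x₀ = reduced x₀ * block H 0 0 ∧
    (reduced x₀).IsHermitian ∧ (reduced x₀).trace = -(s₀ : ℂ) * normDefect ψ φ₁ φ₂ φ₃ 0 ∧
    ∀ b lam, IsEigenbasis (block H 0 0) ψ b lam → ∀ α : Fin (n + 1),
      2 * repGen H b (reduced x₀) α α =
        -(s₀ : ℂ) * rep b (reduced (residual H ψ lam₀ ℓ μ φ₁ φ₂ φ₃ 0)) α α := by
  have hpos : ∀ᶠ Γ : ℝ in l, 0 < Γ := hl (eventually_gt_atTop 0)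
  have hinv := tendsto_ofReal_inv hl
  have hsC : Tendsto (fun Γ => (s Γ : ℂ)) l (𝓝 (s₀ : ℂ)) :=
    (Complex.continuous_ofReal.tendsto s₀).comp hs
  have hres : Tendsto (fun Γ : ℝ => residual H ψ lam₀ ℓ μ φ₁ φ₂ φ₃ (Γ : ℂ)⁻¹) l
      (𝓝 (residual H ψ lam₀ ℓ μ φ₁ φ₂ φ₃ 0)) :=
    ((continuous_residual H ψ lam₀ ℓ μ φ₁ φ₂ φ₃).tendsto 0).comp hinv
  have hlind : ∀ᶠ Γ : ℝ in l,
      lindbladian H (jordan m) Γ ((s Γ : ℂ) • remainder ψ φ₁ φ₂ φ₃ ρ Γ) =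
        (s Γ : ℂ) • (-(Γ : ℂ)⁻¹ • residual H ψ lam₀ ℓ μ φ₁ φ₂ φ₃ (Γ : ℂ)⁻¹) := by
    filter_upwards [hpos] with Γ hΓ
    rw [lindbladian_smul, h.lindbladian_remainder hH hcond hℓ hΓ.ne' (hρ Γ hΓ).2.2]
  have hp : Tendsto
      (fun Γ => lindbladian H (jordan m) Γ ((s Γ : ℂ) • remainder ψ φ₁ φ₂ φ₃ ρ Γ)) l (𝓝 0) := by
    have h1 := hsC.smul (hinv.neg.smul hres)
    rw [neg_zero, zero_smul, smul_zero] at h1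
    exact h1.congr' (hlind.mono fun Γ hΓ => hΓ.symm)
  obtain ⟨hemb, hcomm, -⟩ := tendsto_slow_drift hH hL (isJumpInverse_jordan m) hl hx hp
  refine ⟨hemb, hcomm, ?_, ?_, fun b lam hb α => ?_⟩
  · have h1 : x₀.IsHermitian := by
      refine isClosed_isHermitian.mem_of_tendsto hx ?_
      filter_upwards [hpos] with Γ hΓ
      have h2 := isHermitian_remainder (ψ := ψ) (φ₁ := φ₁) (φ₂ := φ₂) (φ₃ := φ₃)
        (hρ Γ hΓ).1.isHermitian
      change ((s Γ : ℂ) • remainder ψ φ₁ φ₂ φ₃ ρ Γ)ᴴ = _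
      rw [Matrix.conjTranspose_smul, h2.eq]
      simp
    rw [Matrix.IsHermitian, ← reduced_conjTranspose, h1.eq]
  · rw [trace_reduced]
    have h1 := (continuous_trace_op.tendsto _).comp hx
    have h2 := hsC.neg.mul (((continuous_normDefect ψ φ₁ φ₂ φ₃).tendsto 0).comp hinv)
    refine tendsto_nhds_unique h1 (h2.congr' ?_)
    filter_upwards [hpos] with Γ hΓ
    simp only [Function.comp_apply]
    rw [Matrix.trace_smul, h.trace_remainder hψ hΓ.ne' (hρ Γ hΓ).2.1, smul_eq_mul]
    ring
  · have h1 := tendsto_rep_slow_drift hH hL (isJumpInverse_jordan m) hl hx hp hb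
      (rfl : lam α = lam α)
    have h2 := hsC.neg.mul (((continuous_rep_reduced b α α).tendsto _).comp hres)
    refine tendsto_nhds_unique h1 (h2.congr' ?_)
    filter_upwards [hlind, hpos] with Γ hΓ hΓ0
    have hΓ' : (Γ : ℂ) ≠ 0 := by exact_mod_cast hΓ0.ne'
    simp only [Function.comp_apply]
    rw [hΓ, reduced_smul, reduced_smul, rep_smul, rep_smul, Matrix.smul_apply, Matrix.smul_apply,
      smul_eq_mul, smul_eq_mul]
    field_simp

/-- The rescaled remainders are bounded. -/
lemma IsExpansion.exists_entrySum_le (h : IsExpansion H ψ lam₀ ℓ a φ₁ φ₂ φ₃ μ)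
    (hH : H.IsHermitian) (hL : HasPureKernel (jordan m)) (hψ : ‖ψ‖ = 1)
    (hcond : H *ᵥ ket 0 ψ = (lam₀ : ℂ) • ket 0 ψ + κ • ket 1 ψ) (hℓ : ℓ = -2 * Complex.I * κ)
    (hnd : Module.finrank ℂ (Module.End.eigenspace
      (Matrix.toLin' (block H 0 0)) (lam₀ : ℂ)) = 1)
    (hK : ∀ b lam, IsEigenbasis (block H 0 0) ψ b lam → IsUnit (matK H b).det)
    (hρ : ∀ Γ : ℝ, 0 < Γ → IsNESS H (jordan m) Γ (ρ Γ)) :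
    ∃ r : ℝ, ∀ᶠ Γ : ℝ in atTop, entrySum (remainder ψ φ₁ φ₂ φ₃ ρ Γ) ≤ r := by
  by_contra! hc
  have hex (k : ℕ) : ∃ Γ : ℝ, (k : ℝ) ≤ Γ ∧ (k : ℝ) < entrySum (remainder ψ φ₁ φ₂ φ₃ ρ Γ) := by
    obtain ⟨Γ, h1, h2⟩ := ((hc k).and_eventually (eventually_ge_atTop (k : ℝ))).exists
    exact ⟨Γ, h2, h1⟩
  choose u hu hus using hex
  -- Along this ultrafilter `Γ` and the size of the remainder tend to infinity together, and bounded
  -- quantities converge.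
  let U : Ultrafilter ℝ := (Ultrafilter.of (atTop : Filter ℕ)).map u
  have hUle : ((Ultrafilter.of (atTop : Filter ℕ) : Ultrafilter ℕ) : Filter ℕ) ≤ atTop :=
    Ultrafilter.of_le _
  have hUtop : (U : Filter ℝ) ≤ atTop :=
    (tendsto_atTop_mono hu tendsto_natCast_atTop_atTop).mono_left hUle
  have hS : Tendsto (fun Γ => entrySum (remainder ψ φ₁ φ₂ φ₃ ρ Γ)) U atTop := by
    have h1 : Tendsto (fun k => entrySum (remainder ψ φ₁ φ₂ φ₃ ρ (u k))) atTop atTop :=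
      tendsto_atTop_mono (fun k => (hus k).le) tendsto_natCast_atTop_atTop
    exact Filter.tendsto_map'_iff.2 (h1.mono_left hUle)
  let s : ℝ → ℝ := fun Γ => (entrySum (remainder ψ φ₁ φ₂ φ₃ ρ Γ))⁻¹
  have hs : Tendsto s U (𝓝 0) := tendsto_inv_atTop_zero.comp hS
  let x : ℝ → Op m n := fun Γ => (s Γ : ℂ) • remainder ψ φ₁ φ₂ φ₃ ρ Γ
  have hx1 : ∀ᶠ Γ in (U : Filter ℝ), entrySum (x Γ) = 1 := by
    filter_upwards [hS.eventually_gt_atTop 0] with Γ hΓ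
    simp only [x, s]
    rw [entrySum_smul, Complex.norm_real, Real.norm_eq_abs, abs_of_pos (inv_pos.2 hΓ),
      inv_mul_cancel₀ hΓ.ne']
  obtain ⟨x₀, -, hx₀⟩ := (isCompact_entries_le (m := m) (n := n) 1).ultrafilter_le_nhds (U.map x)
    (by
      rw [le_principal_iff]
      refine Ultrafilter.mem_map.2 ?_
      filter_upwards [hx1] with Γ hΓ i j
      exact (norm_apply_le_entrySum _ i j).trans hΓ.le)
  have hx : Tendsto x U (𝓝 x₀) := hx₀
  obtain ⟨hemb, hcomm, hherm, htr, heff⟩ :=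
    h.limit_point hH hL hψ hcond hℓ hρ hUtop hs hx
  -- The scale `s` tends to `0`, so the trace and the source disappear and the normalized limit
  -- solves the homogeneous equation.
  have hzero : reduced x₀ = 0 := by
    refine eq_zero_of_repGen_eq_zero hH hψ hcond hnd hK hherm hcomm (by simpa using htr)
      fun b lam hb α => ?_
    simpa using heff b lam hb α.succ
  rw [hzero, emb_zero] at hemb
  have h1 : entrySum x₀ = 1 :=
    tendsto_nhds_unique ((continuous_entrySum.tendsto _).comp hx)
      (tendsto_const_nhds.congr' (hx1.mono fun Γ hΓ => hΓ.symm))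
  rw [hemb] at h1
  simp [entrySum] at h1

/-- The rescaled remainder converges to an operator on `e⁰ ⊗ H₁` determined by the effective
generator. -/
theorem IsExpansion.exists_correction (h : IsExpansion H ψ lam₀ ℓ a φ₁ φ₂ φ₃ μ)
    (hH : H.IsHermitian) (hL : HasPureKernel (jordan m)) (hψ : ‖ψ‖ = 1)
    (hcond : H *ᵥ ket 0 ψ = (lam₀ : ℂ) • ket 0 ψ + κ • ket 1 ψ) (hℓ : ℓ = -2 * Complex.I * κ)
    (hnd : Module.finrank ℂ (Module.End.eigenspace
      (Matrix.toLin' (block H 0 0)) (lam₀ : ℂ)) = 1)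
    (hK : ∀ b lam, IsEigenbasis (block H 0 0) ψ b lam → IsUnit (matK H b).det)
    (hρ : ∀ Γ : ℝ, 0 < Γ → IsNESS H (jordan m) Γ (ρ Γ)) :
    ∃ C : Op₁ n, Tendsto (remainder ψ φ₁ φ₂ φ₃ ρ) atTop (𝓝 (emb m C)) ∧ C.IsHermitian ∧
      block H 0 0 * C = C * block H 0 0 ∧
      ∀ b lam, IsEigenbasis (block H 0 0) ψ b lam → ∀ α : Fin (n + 1),
        2 * repGen H b C α α =
          -rep b (reduced (residual H ψ lam₀ ℓ μ φ₁ φ₂ φ₃ 0)) α α := by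
  obtain ⟨r, hr⟩ := h.exists_entrySum_le hH hL hψ hcond hℓ hnd hK hρ
  have hmem : ∀ᶠ Γ : ℝ in atTop,
      remainder ψ φ₁ φ₂ φ₃ ρ Γ ∈ {X : Op m n | ∀ i j, ‖X i j‖ ≤ r} := by
    filter_upwards [hr] with Γ hΓ i j
    exact (norm_apply_le_entrySum _ i j).trans hΓ
  -- Without rescaling, `s = 1`, the limit points satisfy the equation with its source; two of them
  -- differ by a traceless solution of the homogeneous equation.
  have hlim {l : Filter ℝ} [l.NeBot] (hl : l ≤ atTop) {x₀ : Op m n}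
      (hx : Tendsto (remainder ψ φ₁ φ₂ φ₃ ρ) l (𝓝 x₀)) :=
    h.limit_point hH hL hψ hcond hℓ hρ hl (s := fun _ => 1) (s₀ := 1) tendsto_const_nhds
      (x₀ := x₀) (by simpa using hx)
  let U : Ultrafilter ℝ := Ultrafilter.of atTop
  obtain ⟨x₀, -, hx₀⟩ := (isCompact_entries_le (m := m) (n := n) r).ultrafilter_le_nhds
    (U.map (remainder ψ φ₁ φ₂ φ₃ ρ)) (by
      rw [le_principal_iff]
      exact Ultrafilter.of_le _ hmem)
  obtain ⟨hemb, hcomm, hherm, htr, heff⟩ := hlim (Ultrafilter.of_le atTop) hx₀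
  refine ⟨reduced x₀, ?_, hherm, hcomm, fun b lam hb α => by simpa using heff b lam hb α⟩
  refine (isCompact_entries_le r).tendsto_nhds_of_unique_mapClusterPt hmem fun x₁ _ hx₁ => ?_
  obtain ⟨l, hl, hx⟩ := mapClusterPt_iff_ultrafilter.1 hx₁
  obtain ⟨hemb', hcomm', hherm', htr', heff'⟩ := hlim hl hx
  have hz : reduced x₁ - reduced x₀ = 0 := by
    refine eq_zero_of_repGen_eq_zero hH hψ hcond hnd hK (hherm'.sub hherm) ?_ ?_
      fun b lam hb α => ?_
    · rw [mul_sub, sub_mul, hcomm, hcomm']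
    · rw [Matrix.trace_sub, htr, htr', sub_self]
    · have h1 := heff b lam hb α.succ
      have h2 := heff' b lam hb α.succ
      rw [repGen, rep_sub, effGen_sub, Matrix.sub_apply, sub_eq_zero]
      exact mul_left_cancel₀ two_ne_zero (h2.trans h1.symm)
  rw [hemb', sub_eq_zero.1 hz]

end

end

/-! ### Second order limits of the reduced state and of the impurity -/

section

variable {m n : ℕ}

section

variable {H : Op m n} {ψ : Ket₁ n} {lam₀ : ℝ} {κ ℓ : ℂ} {a : Fin (n + 1) → ℂ}
  {φ₁ φ₂ φ₃ : Vec m n} {μ : ℝ} {b : OrthonormalBasis (Fin (n + 1)) ℂ (Ket₁ n)}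
  {lam : Fin (n + 1) → ℝ} {ρ : ℝ → Op m n} {C : Op₁ n}

lemma eq_approx_add_remainder {Γ : ℝ} (hΓ : Γ ≠ 0) :
    ρ Γ = Matrix.vecMulVec (approx ψ φ₁ φ₂ φ₃ (Γ : ℂ)⁻¹) (star (approx ψ φ₁ φ₂ φ₃ (Γ : ℂ)⁻¹)) +
      (Γ : ℂ)⁻¹ ^ 2 • remainder ψ φ₁ φ₂ φ₃ ρ Γ := by
  have hΓ' : (Γ : ℂ) ≠ 0 := by exact_mod_cast hΓ
  rw [remainder, smul_smul, ← mul_pow, inv_mul_cancel₀ hΓ', one_pow, one_smul]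
  abel

/-- The second order correction to the reduced state, in an eigenbasis of `h₀₀`. -/
lemma IsExpansion.tendsto_reduced_correction (h : IsExpansion H ψ lam₀ ℓ a φ₁ φ₂ φ₃ μ)
    (hC : Tendsto (remainder ψ φ₁ φ₂ φ₃ ρ) atTop (𝓝 (emb m C))) (hb : b 0 = ψ) (α β : Fin n) :
    Tendsto (fun Γ : ℝ => (Γ : ℂ) ^ 2 *
      (braket (b α.succ) (reduced (ρ Γ)) (b β.succ) -
        braket (b α.succ) (reduced (ρ Γ)) (b 0) * braket (b 0) (reduced (ρ Γ)) (b β.succ)))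
      atTop (𝓝 (rep b C α.succ β.succ)) := by
  let v : Fin n → Fin (m + 2) → ℂ → ℂ := fun γ k ε =>
    star (b γ.succ : Fin (n + 1) → ℂ) ⬝ᵥ comp (φ₁ + ε • φ₂ + ε ^ 2 • φ₃) k
  let u : Fin (m + 2) → ℂ → ℂ := fun k ε =>
    star (b 0 : Fin (n + 1) → ℂ) ⬝ᵥ comp (approx ψ φ₁ φ₂ φ₃ ε) k
  have hvu (γ : Fin n) (k) (ε : ℂ) :
      star (b γ.succ : Fin (n + 1) → ℂ) ⬝ᵥ comp (approx ψ φ₁ φ₂ φ₃ ε) k = ε * v γ k ε := by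
    have h0 : star (b γ.succ : Fin (n + 1) → ℂ) ⬝ᵥ comp (ket 0 ψ) k = 0 := by
      rw [comp_ket]
      split_ifs <;> simp [star_dotProduct_target hb (Fin.succ_ne_zero γ)]
    simp only [v, approx, comp_add, comp_smul, dotProduct_add, dotProduct_smul, h0, smul_eq_mul]
    ring
  have hvcont (γ k) : Continuous (v γ k) := by
    simp only [v, comp_add, comp_smul, dotProduct_add, dotProduct_smul]
    fun_prop
  have hucont (k) : Continuous (u k) := by
    simp only [u, approx, comp_add, comp_smul, dotProduct_add, dotProduct_smul]
    fun_prop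
  have hv0 (γ k) : v γ k 0 =
      if k = 0 then star (b γ.succ : Fin (n + 1) → ℂ) ⬝ᵥ a else 0 := by
    simp only [v, zero_smul, add_zero, ne_eq, OfNat.ofNat_ne_zero, not_false_eq_true, zero_pow,
      h.first, comp_add, comp_smul, comp_ket, comp_inj, dotProduct_add, dotProduct_smul]
    split_ifs <;> simp [star_dotProduct_target hb (Fin.succ_ne_zero γ)]
  have hu0 (k) : u k 0 = if k = 0 then 1 else 0 := by
    have : approx ψ φ₁ φ₂ φ₃ 0 = ket 0 ψ := by simp [approx]
    simp only [u, this, comp_ket]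
    split_ifs
    · rw [← hb, star_dotProduct_basis, if_pos rfl]
    · simp
  let y : Fin (n + 1) → Fin (n + 1) → ℝ → ℂ := fun γ δ Γ =>
    rep b (reduced (remainder ψ φ₁ φ₂ φ₃ ρ Γ)) γ δ
  have hy (γ δ) : Tendsto (y γ δ) atTop (𝓝 (rep b C γ δ)) := by
    have h1 := ((continuous_rep_reduced b γ δ).tendsto _).comp hC
    rwa [reduced_emb] at h1
  let P : Fin n → Fin n → ℂ → ℂ := fun γ δ ε => ∑ k, v γ k ε * star (v δ k ε)
  let Q : Fin n → ℂ → ℂ := fun γ ε => ∑ k, v γ k ε * star (u k ε)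
  have hP (γ δ) : Continuous (P γ δ) :=
    continuous_finsetSum _ fun k _ => (hvcont γ k).mul (hvcont δ k).star
  have hQ (γ) : Continuous (Q γ) :=
    continuous_finsetSum _ fun k _ => (hvcont γ k).mul (hucont k).star
  -- Against `α ≥ 1` the vector `φ₁` is visible only in its `e⁰` component, so `P α β 0` factorizes
  -- as `Q α 0` times the conjugate of `Q β 0`. The subtracted product in the statement cancels this
  -- pure contribution and leaves `C`.
  have hP0 : P α β 0 = (star (b α.succ : Fin (n + 1) → ℂ) ⬝ᵥ a) *
      star (star (b β.succ : Fin (n + 1) → ℂ) ⬝ᵥ a) := by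
    simp only [P, hv0]
    rw [Finset.sum_eq_single 0] <;> simp +contextual
  have hQ0 (γ) : Q γ 0 = star (b γ.succ : Fin (n + 1) → ℂ) ⬝ᵥ a := by
    simp only [Q, hv0, hu0]
    rw [Finset.sum_eq_single 0] <;> simp +contextual
  have hinv := tendsto_ofReal_inv (le_refl atTop)
  have hlim : Tendsto (fun Γ : ℝ => P α β (Γ : ℂ)⁻¹ + y α.succ β.succ Γ -
      (Q α (Γ : ℂ)⁻¹ + (Γ : ℂ)⁻¹ * y α.succ 0 Γ) *
        (star (Q β (Γ : ℂ)⁻¹) + (Γ : ℂ)⁻¹ * y 0 β.succ Γ)) atTop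
      (𝓝 (rep b C α.succ β.succ)) := by
    have h1 := ((hP α β).tendsto 0).comp hinv
    have h2 := ((hQ α).tendsto 0).comp hinv
    have h3 := ((hQ β).star.tendsto 0).comp hinv
    have h4 := (h1.add (hy α.succ β.succ)).sub
      ((h2.add (hinv.mul (hy α.succ 0))).mul (h3.add (hinv.mul (hy 0 β.succ))))
    rw [hP0, hQ0, hQ0] at h4
    refine h4.trans (le_of_eq ?_)
    congr 1
    ring
  refine hlim.congr' ?_
  filter_upwards [eventually_gt_atTop 0] with Γ hΓ
  have hΓ' : (Γ : ℂ) ≠ 0 := by exact_mod_cast hΓ.ne'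
  have hstar : star ((Γ : ℂ)⁻¹) = (Γ : ℂ)⁻¹ := by simp
  have hρ := eq_approx_add_remainder (ψ := ψ) (φ₁ := φ₁) (φ₂ := φ₂) (φ₃ := φ₃) (ρ := ρ) hΓ.ne'
  have hr (γ δ : Fin (n + 1)) : braket (b γ) (reduced (ρ Γ)) (b δ) =
      rep b (reduced (Matrix.vecMulVec (approx ψ φ₁ φ₂ φ₃ (Γ : ℂ)⁻¹)
        (star (approx ψ φ₁ φ₂ φ₃ (Γ : ℂ)⁻¹)))) γ δ + (Γ : ℂ)⁻¹ ^ 2 * y γ δ Γ := by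
    rw [braket_eq_rep, hρ, reduced_add, reduced_smul, rep_add, rep_smul]
    rfl
  have e1 : braket (b α.succ) (reduced (ρ Γ)) (b β.succ) =
      (Γ : ℂ)⁻¹ ^ 2 * (P α β (Γ : ℂ)⁻¹ + y α.succ β.succ Γ) := by
    rw [hr, rep_reduced_vecMulVec]
    simp only [hvu, star_mul', hstar, P]
    rw [mul_add, Finset.mul_sum]
    congr 1
    exact Finset.sum_congr rfl fun k _ => by ring
  have e2 : braket (b α.succ) (reduced (ρ Γ)) (b 0) =
      (Γ : ℂ)⁻¹ * (Q α (Γ : ℂ)⁻¹ + (Γ : ℂ)⁻¹ * y α.succ 0 Γ) := by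
    rw [hr, rep_reduced_vecMulVec]
    simp only [hvu, Q]
    rw [mul_add, Finset.mul_sum]
    congr 1
    · exact Finset.sum_congr rfl fun k _ => by simp only [u]; ring
    · ring
  have e3 : braket (b 0) (reduced (ρ Γ)) (b β.succ) =
      (Γ : ℂ)⁻¹ * (star (Q β (Γ : ℂ)⁻¹) + (Γ : ℂ)⁻¹ * y 0 β.succ Γ) := by
    rw [hr, rep_reduced_vecMulVec]
    simp only [hvu, Q, star_mul', hstar, star_sum, star_star]
    rw [mul_add, Finset.mul_sum]
    congr 1
    · exact Finset.sum_congr rfl fun k _ => by simp only [u]; ring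
    · ring
  rw [e1, e2, e3]
  field_simp

/-- The impurity of the steady state, to second order. -/
lemma tendsto_impurity
    (hρ : ∀ Γ : ℝ, 0 < Γ → (ρ Γ).trace = 1)
    (hC : Tendsto (remainder ψ φ₁ φ₂ φ₃ ρ) atTop (𝓝 (emb m C))) (hb : b 0 = ψ) :
    Tendsto (fun Γ : ℝ => (Γ : ℂ) ^ 2 * (1 - (ρ Γ * ρ Γ).trace)) atTop
      (𝓝 (2 * ∑ α : Fin n, rep b C α.succ α.succ)) := by
  set y := remainder ψ φ₁ φ₂ φ₃ ρ with hy
  let t : ℝ → ℂ := fun Γ => (y Γ).trace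
  let s : ℝ → ℂ := fun Γ =>
    star (approx ψ φ₁ φ₂ φ₃ (Γ : ℂ)⁻¹) ⬝ᵥ approx ψ φ₁ φ₂ φ₃ (Γ : ℂ)⁻¹
  let q : ℝ → ℂ := fun Γ =>
    star (approx ψ φ₁ φ₂ φ₃ (Γ : ℂ)⁻¹) ⬝ᵥ (y Γ *ᵥ approx ψ φ₁ φ₂ φ₃ (Γ : ℂ)⁻¹)
  have hinv := tendsto_ofReal_inv (le_refl atTop)
  have hacont : Continuous (approx ψ φ₁ φ₂ φ₃) := by
    unfold approx
    fun_prop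
  have ha0 : approx ψ φ₁ φ₂ φ₃ 0 = ket 0 ψ := by simp [approx]
  have hΦ : Tendsto (fun Γ : ℝ => approx ψ φ₁ φ₂ φ₃ (Γ : ℂ)⁻¹) atTop (𝓝 (ket 0 ψ)) := by
    have := (hacont.tendsto 0).comp hinv
    rwa [ha0] at this
  have hψψ : star (ket (m := m) 0 ψ) ⬝ᵥ ket 0 ψ = 1 := by
    rw [star_ket_dotProduct, comp_ket, if_pos rfl, ← hb, star_dotProduct_basis, if_pos rfl]
  have ht : Tendsto t atTop (𝓝 C.trace) := by
    have h1 := (continuous_trace_op.tendsto _).comp hC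
    rwa [← trace_reduced, reduced_emb] at h1
  have hs : Tendsto s atTop (𝓝 1) := by
    have hcont : Continuous fun X : Vec m n => star X ⬝ᵥ X := by fun_prop
    have h1 := (hcont.tendsto _).comp hΦ
    rwa [hψψ] at h1
  have hq : Tendsto q atTop (𝓝 (rep b C 0 0)) := by
    have hcont : Continuous fun p : Op m n × Vec m n => star p.2 ⬝ᵥ (p.1 *ᵥ p.2) := by fun_prop
    have h1 := (hcont.tendsto _).comp (hC.prodMk_nhds hΦ)
    have h2 : star (ket 0 ψ) ⬝ᵥ (emb m C *ᵥ ket 0 ψ) = rep b C 0 0 := by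
      rw [star_ket_dotProduct, comp_mulVec_ket, block_emb, if_pos ⟨rfl, rfl⟩, rep_apply, hb]
    rwa [h2] at h1
  have htr2 : Tendsto (fun Γ => (y Γ * y Γ).trace) atTop (𝓝 (emb m C * emb m C).trace) := by
    have hcont : Continuous fun X : Op m n => (X * X).trace := by fun_prop
    exact (hcont.tendsto _).comp hC
  -- With `ρ = |Φ⟩⟨Φ| + ε²y` and `s + ε²t = 1`, one has `1 - s² = ε² t (1 + s)`; the cross term
  -- contributes `2ε²q`. The limit is `2 tr C - 2 ⟨0|C|0⟩`.
  have hlim : Tendsto (fun Γ : ℝ => t Γ * (1 + s Γ) - 2 * q Γ -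
      (Γ : ℂ)⁻¹ ^ 2 * (y Γ * y Γ).trace) atTop (𝓝 (2 * ∑ α : Fin n, rep b C α.succ α.succ)) := by
    have h1 := ((ht.mul (hs.const_add 1)).sub (hq.const_mul 2)).sub ((hinv.pow 2).mul htr2)
    refine h1.trans (le_of_eq ?_)
    rw [← trace_rep b C, Matrix.trace, Fin.sum_univ_succ]
    congr 1
    simp only [Matrix.diag]
    ring
  refine hlim.congr' ?_
  filter_upwards [eventually_gt_atTop 0] with Γ hΓ
  have hΓ' : (Γ : ℂ) ≠ 0 := by exact_mod_cast hΓ.ne'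
  have hdec := eq_approx_add_remainder (ψ := ψ) (φ₁ := φ₁) (φ₂ := φ₂) (φ₃ := φ₃) (ρ := ρ) hΓ.ne'
  rw [← hy] at hdec
  have htrace : s Γ + (Γ : ℂ)⁻¹ ^ 2 * t Γ = 1 := by
    rw [← hρ Γ hΓ, hdec, Matrix.trace_add, Matrix.trace_smul, trace_vecMulVec_star]
    rfl
  have hsq : (ρ Γ * ρ Γ).trace = s Γ ^ 2 + 2 * (Γ : ℂ)⁻¹ ^ 2 * q Γ +
      (Γ : ℂ)⁻¹ ^ 4 * (y Γ * y Γ).trace := by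
    have c1 (X : Vec m n) : (Matrix.vecMulVec X (star X) * Matrix.vecMulVec X (star X)).trace =
        (star X ⬝ᵥ X) ^ 2 := by
      rw [Matrix.mul_vecMulVec, Matrix.vecMulVec_mulVec, Matrix.trace_vecMulVec]
      simp only [smul_dotProduct]
      rw [dotProduct_comm X (star X), sq]
      rfl
    have c2 (X : Vec m n) (Y : Op m n) : (Y * Matrix.vecMulVec X (star X)).trace =
        star X ⬝ᵥ (Y *ᵥ X) := by
      rw [Matrix.mul_vecMulVec, Matrix.trace_vecMulVec, dotProduct_comm]
    have c3 (X : Vec m n) (Y : Op m n) : (Matrix.vecMulVec X (star X) * Y).trace =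
        star X ⬝ᵥ (Y *ᵥ X) := by
      rw [Matrix.trace_mul_comm, c2]
    rw [hdec]
    simp only [add_mul, mul_add, Matrix.trace_add, Matrix.smul_mul, Matrix.mul_smul,
      Matrix.trace_smul, c1, c2, c3, smul_eq_mul]
    simp only [s, q]
    ring
  have hs' : s Γ = 1 - (Γ : ℂ)⁻¹ ^ 2 * t Γ := by linear_combination htrace
  rw [hsq, hs']
  field_simp
  ring

end

/-- The second order impurity for the Jordan block. -/
theorem impurity_jordan {H : Op m n} (hH : H.IsHermitian) (hL : HasPureKernel (jordan m))
    {ρ : ℝ → Op m n} (hρ : ∀ Γ : ℝ, 0 < Γ → IsNESS H (jordan m) Γ (ρ Γ)) {ψ : Ket₁ n}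
    (hψ : ‖ψ‖ = 1) {lam₀ : ℝ} {κ : ℂ}
    (hcond : H *ᵥ ket 0 ψ = (lam₀ : ℂ) • ket 0 ψ + κ • ket 1 ψ)
    (hnd : Module.finrank ℂ (Module.End.eigenspace
      (Matrix.toLin' (block H 0 0)) (lam₀ : ℂ)) = 1)
    (hK : ∀ b lam, IsEigenbasis (block H 0 0) ψ b lam → IsUnit (matK H b).det) :
    (∃ b lam, IsEigenbasis (block H 0 0) ψ b lam ∧ DiagonalizesCorrection ρ b lam) ∧
    ∀ b lam, IsEigenbasis (block H 0 0) ψ b lam → DiagonalizesCorrection ρ b lam →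
      Tendsto (fun Γ : ℝ => (Γ : ℂ) ^ 2 * (1 - (ρ Γ * ρ Γ).trace)) atTop
        (𝓝 ((gammaChSq H κ b lam : ℝ) : ℂ)) := by
  have hψe : block H 0 0 *ᵥ (ψ : Fin (n + 1) → ℂ) = (lam₀ : ℂ) • (ψ : Fin (n + 1) → ℂ) := by
    simpa using block_mulVec_target hcond 0
  obtain ⟨a, φ₁, φ₂, φ₃, μ, h⟩ := exists_isExpansion hH hψ hcond hnd
  obtain ⟨C, hC, hherm, hcomm, heff⟩ :=
    h.exists_correction hH hL hψ hcond rfl hnd hK hρ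
  refine ⟨?_, fun b lam hb hdiag => ?_⟩
  · obtain ⟨b, lam, hb, hd⟩ := exists_isEigenbasis (isHermitian_block hH) hherm hcomm hψ hψe hnd
    refine ⟨b, lam, hb, fun α β hαβ _ => ?_⟩
    have h1 := h.tendsto_reduced_correction hC hb.1 α β
    rwa [hd _ _ fun h2 => hαβ (Fin.succ_injective _ h2)] at h1
  · have hlam : lam 0 = lam₀ := hb.lam_zero hψe
    have hnd' := hnd
    rw [← hlam] at hnd'
    have hne (α : Fin n) : lam α.succ ≠ lam 0 := hb.lam_ne hnd' (Fin.succ_ne_zero α)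
    -- Commutation with `h₀₀` handles distinct eigenvalues, nondegeneracy of `lam 0` the pairs
    -- involving the target, and the assumption on the basis the rest.
    have hd (α β : Fin (n + 1)) (hαβ : α ≠ β) : rep b C α β = 0 := by
      by_cases hl : lam α = lam β
      · induction α using Fin.cases with
        | zero =>
          induction β using Fin.cases with
          | zero => exact absurd rfl hαβ
          | succ β => exact absurd hl.symm (hne β)
        | succ α =>
          induction β using Fin.cases with
          | zero => exact absurd hl (hne α)
          | succ β =>
            exact tendsto_nhds_unique (h.tendsto_reduced_correction hC hb.1 α β)
              (hdiag α β (fun h2 => hαβ (congrArg Fin.succ h2)) hl)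
      · exact hb.rep_apply_eq_zero hcomm hl
    obtain ⟨c, hc⟩ : ∃ c : Fin (n + 1) → ℝ, rep b C = Matrix.diagonal fun α => (c α : ℂ) :=
      ⟨_, rep_eq_diagonal_re hherm hd⟩
    -- One factor `2` comes from the slow drift and one from the generator, so `4 K c = -16 |κ|² R`.
    have hKc : (matK H b *ᵥ fun β : Fin n => c β.succ) =
        (-4 * ‖κ‖ ^ 2) • vecR H b lam := by
      ext α
      have h1 := heff b lam hb α.succ
      rw [repGen_succ hcond hb.1 hc,
        h.rep_reduced_residual hH hcond rfl hb hlam hne] at h1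
      have h2 : 2 * (2 * (matK H b *ᵥ fun β : Fin n => c β.succ) α) =
          -(16 * ‖κ‖ ^ 2 * vecR H b lam α) := by exact_mod_cast h1
      rw [Pi.smul_apply, smul_eq_mul]
      linarith
    have hcs : (fun β : Fin n => c β.succ) =
        (-4 * ‖κ‖ ^ 2) • ((matK H b)⁻¹ *ᵥ vecR H b lam) := by
      have h1 := congrArg (fun v => (matK H b)⁻¹ *ᵥ v) hKc
      simpa only [Matrix.mulVec_mulVec, Matrix.nonsing_inv_mul _ (hK b lam hb),
        Matrix.one_mulVec, Matrix.mulVec_smul] using h1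
    have h1 := tendsto_impurity (fun Γ hΓ => (hρ Γ hΓ).2.1) hC hb.1
    refine h1.trans (le_of_eq ?_)
    congr 1
    have h2 : gammaChSq H κ b lam = 2 * ∑ α : Fin n, c α.succ := by
      have h3 (α : Fin n) : c α.succ =
          -4 * ‖κ‖ ^ 2 * ∑ β, (matK H b)⁻¹ α β * vecR H b lam β := congrFun hcs α
      simp only [h3]
      rw [gammaChSq, ← Finset.mul_sum]
      ring
    rw [h2, hc]
    push_cast
    simp

end

end ZenoTarget

end

theorem theorem2 (m n : ℕ) (H : ZenoTarget.Op m n) (hH : H.IsHermitian)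
    (L : Matrix (Fin (m + 2)) (Fin (m + 2)) ℂ) (hL : ZenoTarget.HasPureKernel L)
    -- uniqueness of the steady state, for every dissipative strength
    (ρ : ℝ → ZenoTarget.Op m n)
    (hρ : ∀ Γ : ℝ, 0 < Γ → ZenoTarget.IsNESS H L Γ (ρ Γ) ∧
      ∀ σ, ZenoTarget.IsNESS H L Γ σ → σ = ρ Γ)
    -- the targeting condition, with the unit vector `ψ` of `H₁` as target
    (ψ : ZenoTarget.Ket₁ n) (hψ : ‖ψ‖ = 1) (lam₀ : ℝ) (κ : ℂ) (hκ : κ ≠ 0)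
    (hcond : H *ᵥ ZenoTarget.ket 0 ψ =
      (lam₀ : ℂ) • ZenoTarget.ket 0 ψ + κ • ZenoTarget.ket 1 ψ)
    -- `lam₀` is a nondegenerate eigenvalue of `h₀₀`
    (hnd : Module.finrank ℂ (Module.End.eigenspace
      (Matrix.toLin' (ZenoTarget.block H 0 0)) (lam₀ : ℂ)) = 1)
    -- `K` is invertible
    (hK : ∀ b lam, ZenoTarget.IsEigenbasis (ZenoTarget.block H 0 0) ψ b lam →
      IsUnit (ZenoTarget.matK H b).det) :
    Tendsto ρ atTop
        (𝓝 (Matrix.vecMulVec (ZenoTarget.ket 0 ψ) (star (ZenoTarget.ket 0 ψ)))) ∧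
      (L = ZenoTarget.jordan m →
        (∃ b lam, ZenoTarget.IsEigenbasis (ZenoTarget.block H 0 0) ψ b lam ∧
          ZenoTarget.DiagonalizesCorrection ρ b lam) ∧
        ∀ b lam, ZenoTarget.IsEigenbasis (ZenoTarget.block H 0 0) ψ b lam →
          ZenoTarget.DiagonalizesCorrection ρ b lam →
          Tendsto (fun Γ : ℝ => (Γ : ℂ) ^ 2 * (1 - (ρ Γ * ρ Γ).trace)) atTop
            (𝓝 ((ZenoTarget.gammaChSq H κ b lam : ℝ) : ℂ))) := by
  have hss : ∀ Γ : ℝ, 0 < Γ → ZenoTarget.IsNESS H L Γ (ρ Γ) := fun Γ hΓ => (hρ Γ hΓ).1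
  refine ⟨ZenoTarget.tendsto_target hH hL hss hψ hcond hnd hK, ?_⟩
  rintro rfl
  exact ZenoTarget.impurity_jordan hH hL hss hψ hcond hnd hK
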